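/- Let $\Lambda$, $\mu$, $\phi$ be the von Mangoldt, M\"obius and Euler functions; $p$ denotes primes. For real $\theta, C$ let $EH(N^\theta(\log N)^C)$ be the assertion that for every $A'>0$ there is a constant $K$ such that for all integers $N\ge 2$ $$\sum_{q \leq N^\theta(\log N)^C} \max_{0\le y \leq N}\ \max_{(a,q)=1}\Big|\sum_{\substack{n \leq y \\ n \equiv a \bmod q}} \Lambda(n) - \frac{y}{\phi(q)}\Big| \le K\frac{N}{(\log N)^{A'}},$$ and let $EH_\mu(N^\theta)$ be the assertion that for every $A'>0$ there is a constant $K$ such that for all integers $N\ge 2$ $$\sum_{q \leq N^\theta} \max_{0\le y < N}\ \max_{(a,q)=1}\Big|\sum_{\substack{n \leq y \\ n \equiv a \bmod q}} \Lambda(n)\mu(N-n) - \frac{1}{\phi(q)}\sum_{n\le y}\Lambda(n)\mu(N-n)\Big| \le K\frac{N}{(\log N)^{A'}}.$$ In both, $q$ runs over positive integers, $y$ and $n\geq 1$ over integers. For even $N\ge 2$ put $$\widetilde r(N)=\sum_{1\le n<N}\Lambda(n)\Lambda(N-n),\qquad \mathfrak S(N)=2\prod_{p>2}\Big(1-\frac1{(p-1)^2}\Big)\prod_{\substack{p\mid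 N\\ p>2}}\Big(1+\frac1{p-2}\Big),\qquad \mathcal A(N)=\prod_{\substack{p\nmid N\\ p>2}}\Big(1-\frac1{p(p-1)}\Big).$$ **Theorem.** Let $A>0$ and $0<\theta<1$, and suppose that $EH(N^\theta(\log N)^{2A+8})$ and $EH_\mu(N^{1-\theta})$ hold. Then, for all positive even integers $N$, with implied constants depending only on $A$ and $\theta$, $$\widetilde r(N)\ \ge\ \mathfrak S(N)\,(1-\mathcal A(N))\,N+O\Big(\frac{N}{(\log N)^A}\Big)$$ and $$\widetilde r(N)=\mathfrak S(N)\Big(N-\sum_{1\le n<N}\Lambda(n)\mu(N-n)\Big)+O\Big(\frac{N}{(\log N)^A}\Big).$$ Moreover, as $N\to\infty$ through even integers, $\widetilde r(N)\sim\mathfrak S(N)N$ if and only if $\sum_{1\le n<N}\Lambda(n)\mu(N-n)=o(N)$. -/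

import Mathlib

open Filter Asymptotics
open scoped Topology

noncomputable section

/-- The weighted number of Goldbach representations of `N`, the sum over `0 < n < N` of
`Λ(n) Λ(N - n)`. -/
def goldbachSum (N : ℕ) : ℝ :=
  ∑ n ∈ Finset.Ico 1 N,
    ArithmeticFunction.vonMangoldt n * ArithmeticFunction.vonMangoldt (N - n)

/-- The sum over `0 < n < N` of `Λ(n) μ(N - n)`. -/
def moebiusTwistedSum (N : ℕ) : ℝ :=
  ∑ n ∈ Finset.Ico 1 N,
    ArithmeticFunction.vonMangoldt n * (ArithmeticFunction.moebius (N - n) : ℝ)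

/-- The singular series `𝔖(N)` of the binary Goldbach problem. -/
def singularSeries (N : ℕ) : ℝ :=
  if Even N then
    2 * (∏' p : Nat.Primes, if 2 < (p : ℕ) then 1 - 1 / ((p : ℝ) - 1) ^ 2 else 1) *
      ∏ p ∈ N.primeFactors with 2 < p, (1 + 1 / ((p : ℝ) - 2))
  else 0

/-- `𝒜(N)`: the product of `1 - 1 / (p (p - 1))` over the primes `p > 2` not dividing `N`. -/
def artinFactor (N : ℕ) : ℝ :=
  ∏' p : Nat.Primes,
    if 2 < (p : ℕ) ∧ ¬ (p : ℕ) ∣ N then 1 - 1 / ((p : ℝ) * ((p : ℝ) - 1)) else 1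

/-- The Elliott-Halberstam conjecture `EH(N ^ θ (log N) ^ C)`. For `q ≥ 1` the two suprema are
over finite nonempty index types, hence maxima: over the integers `0 ≤ y ≤ N`, and over the
residue classes `a` modulo `q` that are coprime to `q`. -/
def ElliottHalberstam (θ C : ℝ) : Prop :=
  ∀ A : ℝ, 0 < A → ∃ K : ℝ, ∀ N : ℕ, 2 ≤ N →
    ∑ q ∈ Finset.Icc 1 ⌊(N : ℝ) ^ θ * Real.log N ^ C⌋₊,
        (⨆ y : Fin (N + 1), ⨆ a : (ZMod q)ˣ,
          |(∑ n ∈ Finset.Icc 1 (y : ℕ) with ((n : ℕ) : ZMod q) = (a : ZMod q),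
              ArithmeticFunction.vonMangoldt n) - ((y : ℕ) : ℝ) / (Nat.totient q : ℝ)|)
      ≤ K * ((N : ℝ) / Real.log N ^ A)

/-- The variant `EH_μ(N ^ θ)` of the Elliott-Halberstam conjecture twisted by the Möbius
function; here the maximum is over the integers `0 ≤ y < N`. -/
def ElliottHalberstamMoebius (θ : ℝ) : Prop :=
  ∀ A : ℝ, 0 < A → ∃ K : ℝ, ∀ N : ℕ, 2 ≤ N →
    ∑ q ∈ Finset.Icc 1 ⌊(N : ℝ) ^ θ⌋₊,
        (⨆ y : Fin N, ⨆ a : (ZMod q)ˣ,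
          |(∑ n ∈ Finset.Icc 1 (y : ℕ) with ((n : ℕ) : ZMod q) = (a : ZMod q),
              ArithmeticFunction.vonMangoldt n * (ArithmeticFunction.moebius (N - n) : ℝ)) -
            1 / (Nat.totient q : ℝ) *
              ∑ n ∈ Finset.Icc 1 (y : ℕ),
                ArithmeticFunction.vonMangoldt n * (ArithmeticFunction.moebius (N - n) : ℝ)|)
      ≤ K * ((N : ℝ) / Real.log N ^ A)

end

noncomputable section

/-! Put `m = N - n`, and let `D` be about `N ^ θ`. For `m > 1`, `Λ(m) = ∑_{d ∣ m} μ(d) log (D / d)`,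
and the divisors split at `D`. Inserting the weight `μ(m)²` discards only proper prime powers, so up
to a negligible error the Goldbach sum is `smallDivisorSum - largeDivisorSum`
(`abs_goldbachSum_sub_le`).

For `d ≤ D`, expand `μ(m)²` over squares `e² ∣ m`. With `d₁ = gcd(d, e)` and `d = d₁ d₂`, the
conditions amount to the single modulus `d₂ e²`. For `e ≤ E ≍ (log N) ^ (A + 4)` this modulus is at
most `N ^ θ (log N) ^ (2A + 8)`, the range of the Elliott-Halberstam hypothesis. The main term
contains `∑_{d₁ ∣ e} μ(d₁) L(D / d₁)`, where `L(x) = ∑_{k ≤ x, (k, eN) = 1} μ(k) / φ(k) log (x / k)`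
is `coprimeLogSum`. As `L(x)` tends to `𝔖(eN)`, the limit does not depend on `d₁`, and the sum over
`d₁` annihilates every `e` except `e = 1`. The small divisors therefore give `𝔖(N) N`
(`abs_smallDivisorSum_sub_le`).

For `d > D`, pass to the complementary divisor `k = m / d < N / D ≤ N ^ (1 - θ)`. For squarefree
`m`, `μ(m)² μ(d) = μ(m) μ(k)`, so the sum over `n` becomes `Λ(n) μ(N - n)` in a progression modulo
`k`, which is what `EH_μ` controls. Abel's inequality removes the logarithmic weight, and the same
limit of `L` leaves `𝔖(N) ∑ Λ(n) μ(N - n)` (`abs_largeDivisorSum_sub_main_le`,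
`abs_largeDivisorMain_sub_le`). This proves the asymptotic formula. The lower bound follows from `μ
≤ μ²` and `∑ Λ(n) μ(N - n)² = 𝒜(N) N + O(N / (log N) ^ (A + 1))`. The equivalence follows because
`𝔖(N) ≥ 1`.

The remaining input is the uniform convergence of `L` with an error smaller than any power of the
logarithm. Modulus 1 in the Elliott-Halberstam hypothesis gives the prime number theorem in that
strength. A bootstrap turns it into bounds for `∑ μ(k) / k` and then into `∑_{k ≤ x} μ(k) / k log (x
/ k) = 1 + O((log x) ^ (-n))` (`moebiusLogSum_sub_one_bound`). Factoring `μ / φ` on integers coprime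
to `M` as `h * (μ / id)`, with `h = singularWeight M` small and `∑ h = 𝔖(M)` for even `M`, transfers
this to `L` (`coprimeLogSum_sub_singularSeries_bound`). -/

/-- The prime number theorem with an error smaller than any power of the logarithm. -/
def PsiLogPowError : Prop :=
  ∀ j : ℕ, ∃ K : ℝ, ∀ n : ℕ, 2 ≤ n →
    |(∑ m ∈ Finset.Ioc 0 n, ArithmeticFunction.vonMangoldt m) - n| ≤ K * (n / Real.log n ^ j)

/-! ### Convolutions weighted by 1 / n, and Abel's inequality -/

/-- The arithmetic function `n ↦ f n / n`. -/
def ArithmeticFunction.divId (f : ArithmeticFunction ℝ) : ArithmeticFunction ℝ :=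
  ⟨fun n => f n / n, by simp⟩

open ArithmeticFunction in
lemma ArithmeticFunction.divId_apply (f : ArithmeticFunction ℝ) (n : ℕ) :
    divId f n = f n / n := rfl

-- Since `n ↦ 1 / n` is completely multiplicative, it passes through each product `x.1 * x.2 = n` of
-- the convolution.
open ArithmeticFunction in
lemma ArithmeticFunction.divId_mul (f g : ArithmeticFunction ℝ) :
    divId (f * g) = divId f * divId g := by
  ext n
  rw [divId_apply, mul_apply, mul_apply, Finset.sum_div]
  refine Finset.sum_congr rfl fun x hx => ?_
  rw [divId_apply, divId_apply, ← (Nat.mem_divisorsAntidiagonal.1 hx).1]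
  push_cast
  rw [mul_div_mul_comm]

/-- The Möbius function with real values. -/
def realMoebius : ArithmeticFunction ℝ := (ArithmeticFunction.moebius : ArithmeticFunction ℝ)

lemma realMoebius_apply (n : ℕ) : realMoebius n = (ArithmeticFunction.moebius n : ℝ) := by
  simp [realMoebius]

lemma abs_moebius_real_le (n : ℕ) : |(ArithmeticFunction.moebius n : ℝ)| ≤ 1 := by
  have := ArithmeticFunction.abs_moebius_le_one (n := n)
  exact_mod_cast this

/-- **Abel's inequality**: partial sums bounded by `S` against a nonincreasing weight. -/
lemma abs_sum_Ioc_mul_le {a w : ℕ → ℝ} {K n : ℕ} {S W : ℝ} (hKn : K ≤ n)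
    (ha : ∀ j, K ≤ j → j ≤ n → |∑ k ∈ Finset.Ioc K j, a k| ≤ S)
    (hw : ∀ k, K ≤ k → k < n → w (k + 1) ≤ w k) (hn : 0 ≤ w n) (hK : w K ≤ W) :
    |∑ k ∈ Finset.Ioc K n, a k * w k| ≤ S * W := by
  -- Induction on the summation-by-parts remainder: passing from `j` to `j + 1` adds the partial sum
  -- at `j` times `w j - w (j + 1)`, so the bounds telescope.
  have key : ∀ j, K ≤ j → j ≤ n →
      |∑ k ∈ Finset.Ioc K j, a k * w k - (∑ k ∈ Finset.Ioc K j, a k) * w j| ≤ S * (W - w j) ∧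
      0 ≤ W - w j := by
    have hS : 0 ≤ S := (abs_nonneg _).trans (ha K le_rfl hKn)
    intro j hj
    induction j, hj using Nat.le_induction with
    | base =>
      intro _
      simp only [Finset.Ioc_self, Finset.sum_empty, zero_mul, sub_zero, abs_zero]
      exact ⟨mul_nonneg hS (by linarith), by linarith⟩
    | succ j hj ih =>
      intro hjn
      obtain ⟨h1, h2⟩ := ih (by omega)
      have h3 := hw j hj (by omega)
      rw [Finset.sum_Ioc_succ_top (by omega), Finset.sum_Ioc_succ_top (by omega)]
      refine ⟨?_, by linarith⟩
      have h4 := ha j hj (by omega)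
      have h5 : (∑ k ∈ Finset.Ioc K j, a k * w k) + a (j + 1) * w (j + 1) -
          ((∑ k ∈ Finset.Ioc K j, a k) + a (j + 1)) * w (j + 1) =
          ((∑ k ∈ Finset.Ioc K j, a k * w k) - (∑ k ∈ Finset.Ioc K j, a k) * w j) +
          (∑ k ∈ Finset.Ioc K j, a k) * (w j - w (j + 1)) := by ring
      rw [h5]
      calc _ ≤ _ := abs_add_le _ _
        _ ≤ S * (W - w j) + S * (w j - w (j + 1)) := by
            rw [abs_mul, abs_of_nonneg (sub_nonneg.2 h3)]
            gcongr
        _ = _ := by ring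
  obtain ⟨h1, h2⟩ := key n hKn le_rfl
  have h4 := ha n hKn le_rfl
  calc _ = |(∑ k ∈ Finset.Ioc K n, a k * w k - (∑ k ∈ Finset.Ioc K n, a k) * w n) +
        (∑ k ∈ Finset.Ioc K n, a k) * w n| := by ring_nf
    _ ≤ _ := abs_add_le _ _
    _ ≤ S * (W - w n) + S * w n := by
        rw [abs_mul, abs_of_nonneg hn]
        gcongr
    _ = _ := by ring

/-! ### Möbius sums against slowly varying weights -/

/-- The partial sums of `μ(k) / k`. -/
def moebiusRecipSum (n : ℕ) : ℝ := ∑ k ∈ Finset.Ioc 0 n, realMoebius.divId k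

lemma sum_Ioc_inv_le (n : ℕ) :
    ∑ k ∈ Finset.Ioc 0 n, (1 : ℝ) / k ≤ 1 + Real.log n := by
  have := harmonic_le_one_add_log n
  rw [harmonic_eq_sum_Icc] at this
  push_cast at this
  have h : Finset.Ioc 0 n = Finset.Icc 1 n := by ext; simp; omega
  rw [h]
  simpa using this

lemma abs_divId_realMoebius_le (k : ℕ) : |realMoebius.divId k| ≤ 1 / k := by
  rw [ArithmeticFunction.divId_apply, realMoebius_apply, abs_div, Nat.abs_cast]
  gcongr
  exact abs_moebius_real_le k

lemma sum_abs_divId_realMoebius_le {x : ℝ} (hx : 1 ≤ x) :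
    ∑ k ∈ Finset.Ioc 0 ⌊x⌋₊, |realMoebius.divId k| ≤ 1 + Real.log x := by
  have h1 : 1 ≤ ⌊x⌋₊ := Nat.le_floor (by simpa using hx)
  calc _ ≤ ∑ k ∈ Finset.Ioc 0 ⌊x⌋₊, (1 : ℝ) / k :=
        Finset.sum_le_sum fun k _ => abs_divId_realMoebius_le k
    _ ≤ 1 + Real.log ⌊x⌋₊ := sum_Ioc_inv_le _
    _ ≤ _ := by
        gcongr
        exact Nat.floor_le (by linarith)

/-- A Möbius sum against the difference of two monotone functions that are close
beyond `U`, in terms of bounds for the partial sums of `μ(k) / k`. -/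
lemma abs_sum_moebius_mul_sub_le {w v : ℝ → ℝ} (hw : MonotoneOn w (Set.Ici 1))
    (hv : MonotoneOn v (Set.Ici 1)) (hw0 : 0 ≤ w 1) (hv0 : 0 ≤ v 1) {x U η F : ℝ}
    (hU : 1 ≤ U) (hUx : U ≤ x) (hη : ∀ y, U ≤ y → |w y - v y| ≤ η)
    (hF : ∀ t : ℕ, ⌊x / U⌋₊ ≤ t → t ≤ ⌊x⌋₊ → |moebiusRecipSum t| ≤ F) :
    |∑ k ∈ Finset.Ioc 0 ⌊x⌋₊, realMoebius.divId k * (w (x / k) - v (x / k))| ≤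
      η * (1 + Real.log x) + 2 * F * (w U + v U) := by
  have hx : 1 ≤ x := hU.trans hUx
  have hη0 : 0 ≤ η := (abs_nonneg _).trans (hη U le_rfl)
  set K := ⌊x / U⌋₊ with hK
  have hKn : K ≤ ⌊x⌋₊ := Nat.floor_mono (div_le_self (by linarith) hU)
  have hK1 : 1 ≤ K := Nat.le_floor (by simpa using (one_le_div (by linarith)).2 hUx)
  have tail : ∀ u : ℝ → ℝ, MonotoneOn u (Set.Ici 1) → 0 ≤ u 1 →
      |∑ k ∈ Finset.Ioc K ⌊x⌋₊, realMoebius.divId k * u (x / k)| ≤ 2 * F * u U := by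
    intro u hu hu0
    -- Abel's inequality starts from the weight at `k = K`, where `x / K` may exceed `U`. Capping
    -- the argument at `U` changes no term with `k > K` and bounds that first weight by `u U`.
    have : ∑ k ∈ Finset.Ioc K ⌊x⌋₊, realMoebius.divId k * u (x / k) =
        ∑ k ∈ Finset.Ioc K ⌊x⌋₊, realMoebius.divId k * u (min (x / k) U) := by
      refine Finset.sum_congr rfl fun k hk => ?_
      rw [Finset.mem_Ioc] at hk
      have hk0 : (0 : ℝ) < k := by exact_mod_cast (by omega : 0 < k)
      have h1 : x / U < k := (Nat.floor_lt (by positivity)).1 hk.1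
      rw [min_eq_left]
      rw [div_lt_iff₀ (by linarith)] at h1
      rw [div_le_iff₀ hk0]
      linarith
    rw [this]
    have hmem : ∀ k : ℕ, 1 ≤ k → k ≤ ⌊x⌋₊ → (1 : ℝ) ≤ min (x / k) U := by
      intro k hk hk'
      have hk0 : (0 : ℝ) < k := by exact_mod_cast hk
      have h2 : (k : ℝ) ≤ x := (Nat.le_floor_iff (by linarith)).1 hk'
      exact le_min ((one_le_div hk0).2 h2) hU
    refine abs_sum_Ioc_mul_le (w := fun k : ℕ => u (min (x / k) U)) hKn ?_ ?_ ?_ ?_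
    · intro j hj hj'
      have h1 : ∑ k ∈ Finset.Ioc K j, realMoebius.divId k =
          moebiusRecipSum j - moebiusRecipSum K := by
        rw [moebiusRecipSum, moebiusRecipSum, eq_sub_iff_add_eq, add_comm]
        exact Finset.sum_Ioc_consecutive _ (Nat.zero_le _) hj
      rw [h1]
      calc _ ≤ _ := abs_sub _ _
        _ ≤ F + F := add_le_add (hF j hj hj') (hF K le_rfl hKn)
        _ = _ := by ring
    · intro k hk hk'
      have hk0 : (0 : ℝ) < k := by exact_mod_cast (by omega : 0 < k)
      refine hu (hmem _ (by omega) (by omega)) (hmem _ (by omega) (by omega)) ?_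
      refine min_le_min ?_ le_rfl
      gcongr
      simp
    · exact hu0.trans (hu (Set.mem_Ici.2 le_rfl) (hmem _ (by omega) le_rfl) (hmem _ (by omega) le_rfl))
    · exact hu (hmem _ hK1 hKn) hU (min_le_right _ _)
  rw [← Finset.sum_Ioc_consecutive _ (Nat.zero_le K) hKn]
  have h1 : |∑ k ∈ Finset.Ioc 0 K, realMoebius.divId k * (w (x / k) - v (x / k))| ≤
      η * (1 + Real.log x) := by
    calc _ ≤ ∑ k ∈ Finset.Ioc 0 K, |realMoebius.divId k * (w (x / k) - v (x / k))| :=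
          Finset.abs_sum_le_sum_abs _ _
      _ ≤ ∑ k ∈ Finset.Ioc 0 K, |realMoebius.divId k| * η := by
          refine Finset.sum_le_sum fun k hk => ?_
          rw [Finset.mem_Ioc] at hk
          rw [abs_mul]
          gcongr
          apply hη
          have hk0 : (0 : ℝ) < k := by exact_mod_cast hk.1
          have := (Nat.le_floor_iff (by positivity)).1 hk.2
          rw [le_div_iff₀ (by linarith)] at this
          rw [le_div_iff₀ hk0]
          linarith
      _ ≤ ∑ k ∈ Finset.Ioc 0 ⌊x⌋₊, |realMoebius.divId k| * η := by
          refine Finset.sum_le_sum_of_subset_of_nonneg ?_ fun _ _ _ => by positivity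
          exact Finset.Ioc_subset_Ioc_right hKn
      _ = η * ∑ k ∈ Finset.Ioc 0 ⌊x⌋₊, |realMoebius.divId k| := by
          rw [← Finset.sum_mul, mul_comm]
      _ ≤ _ := by
          gcongr
          exact sum_abs_divId_realMoebius_le hx
  have h2 : |∑ k ∈ Finset.Ioc K ⌊x⌋₊, realMoebius.divId k * (w (x / k) - v (x / k))| ≤
      2 * F * (w U + v U) := by
    simp_rw [mul_sub, Finset.sum_sub_distrib]
    calc _ ≤ _ := abs_sub _ _
      _ ≤ _ := add_le_add (tail w hw hw0) (tail v hv hv0)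
      _ = _ := by ring
  exact (abs_add_le _ _).trans (add_le_add h1 h2)

/-! ### Mertens-type sums with strong error terms -/

/-- Partial sums of `Λ(m) / m`. -/
def mangoldtRecipSum (y : ℝ) : ℝ :=
  ∑ m ∈ Finset.Ioc 0 ⌊y⌋₊, (ArithmeticFunction.vonMangoldt).divId m

/-- Partial sums of the harmonic series. -/
def recipSum (y : ℝ) : ℝ := ∑ m ∈ Finset.Ioc 0 ⌊y⌋₊, (1 : ℝ) / m

lemma monotone_mangoldtRecipSum : Monotone mangoldtRecipSum := by
  intro a b h
  refine Finset.sum_le_sum_of_subset_of_nonneg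
    (Finset.Ioc_subset_Ioc_right (Nat.floor_mono h)) fun _ _ _ => ?_
  exact div_nonneg ArithmeticFunction.vonMangoldt_nonneg (Nat.cast_nonneg _)

lemma monotone_recipSum : Monotone recipSum := by
  intro a b h
  refine Finset.sum_le_sum_of_subset_of_nonneg
    (Finset.Ioc_subset_Ioc_right (Nat.floor_mono h)) fun _ _ _ => ?_
  positivity

/-- Comes from `μ * Λ = -μ log`, itself obtained by Möbius inversion of `∑_{d ∣ n} μ(d) log d =
-Λ(n)`. The factor `log k` is what makes the bootstrap gain: it trades a sum of `Λ(m) / m` for `log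
x` times the Möbius sum. -/
lemma sum_moebius_mul_mangoldtRecipSum (x : ℝ) :
    ∑ k ∈ Finset.Ioc 0 ⌊x⌋₊, realMoebius.divId k * mangoldtRecipSum (x / k) =
      -∑ k ∈ Finset.Ioc 0 ⌊x⌋₊, realMoebius.divId k * Real.log k := by
  simp_rw [mangoldtRecipSum, Nat.floor_div_natCast]
  rw [← ArithmeticFunction.sum_Ioc_mul_eq_sum_sum, ← ArithmeticFunction.divId_mul,
    ← Finset.sum_neg_distrib]
  refine Finset.sum_congr rfl fun n _ => ?_
  rw [ArithmeticFunction.divId_apply, ArithmeticFunction.divId_apply]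
  have : (realMoebius * ArithmeticFunction.vonMangoldt) n = - (realMoebius n * Real.log n) := by
    have h1 : ArithmeticFunction.vonMangoldt = realMoebius * ArithmeticFunction.log :=
      ArithmeticFunction.moebius_mul_log_eq_vonMangoldt.symm
    have h2 : (realMoebius.pmul ArithmeticFunction.log) * (ArithmeticFunction.zeta :
        ArithmeticFunction ℝ) = - ArithmeticFunction.vonMangoldt := by
      ext n
      rw [ArithmeticFunction.coe_mul_zeta_apply]
      simp only [ArithmeticFunction.pmul_apply, realMoebius_apply, ArithmeticFunction.log_apply]
      have h := ArithmeticFunction.sum_moebius_mul_log_eq (n := n)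
      simp only [ArithmeticFunction.log_apply] at h
      rw [h]
      rfl
    have h3 : realMoebius * ArithmeticFunction.vonMangoldt =
        - realMoebius.pmul ArithmeticFunction.log := by
      have h4 : (ArithmeticFunction.zeta : ArithmeticFunction ℝ) * realMoebius = 1 :=
        ArithmeticFunction.coe_zeta_mul_coe_moebius
      have : ArithmeticFunction.vonMangoldt =
        - (realMoebius.pmul ArithmeticFunction.log) * (ArithmeticFunction.zeta :
        ArithmeticFunction ℝ) := by rw [neg_mul, h2, neg_neg]
      rw [this, mul_comm, mul_assoc, h4, mul_one]
    rw [h3]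
    rfl
  rw [this]
  ring

/-- Here `μ * ζ = 1`, so only the term `n = 1` survives; this is the source of the limit 1 of
`moebiusLogSum`. -/
lemma sum_moebius_mul_recipSum {x : ℝ} (hx : 1 ≤ x) :
    ∑ k ∈ Finset.Ioc 0 ⌊x⌋₊, realMoebius.divId k * recipSum (x / k) = 1 := by
  have h : ∀ y : ℝ, recipSum y = ∑ m ∈ Finset.Ioc 0 ⌊y⌋₊,
      (ArithmeticFunction.zeta : ArithmeticFunction ℝ).divId m := by
    intro y
    refine Finset.sum_congr rfl fun m hm => ?_
    have : m ≠ 0 := by simp at hm; omega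
    simp [ArithmeticFunction.divId_apply, ArithmeticFunction.natCoe_apply, this]
  simp_rw [h, Nat.floor_div_natCast]
  have h4 : realMoebius * (ArithmeticFunction.zeta : ArithmeticFunction ℝ) = 1 :=
    ArithmeticFunction.coe_moebius_mul_coe_zeta
  rw [← ArithmeticFunction.sum_Ioc_mul_eq_sum_sum, ← ArithmeticFunction.divId_mul, h4]
  rw [Finset.sum_eq_single 1]
  · simp [ArithmeticFunction.divId_apply]
  · intro b _ hb
    simp [ArithmeticFunction.divId_apply, ArithmeticFunction.one_apply_ne hb]
  · intro h
    simp at h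
    linarith

lemma log_pow_le_factorial_mul {y : ℝ} (hy : 1 ≤ y) (n : ℕ) :
    Real.log y ^ n ≤ n.factorial * y := by
  have h := Real.pow_div_factorial_le_exp (Real.log y) (Real.log_nonneg hy) n
  rw [Real.exp_log (by linarith), div_le_iff₀ (by positivity)] at h
  linarith

lemma log_floor_ge {y : ℝ} (hy : 2 ≤ y) : Real.log y / 2 ≤ Real.log ⌊y⌋₊ := by
  have h1 : 2 ≤ ⌊y⌋₊ := Nat.le_floor (by simpa using hy)
  have h2 : y < ⌊y⌋₊ + 1 := Nat.lt_floor_add_one y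
  have h1' : (2 : ℝ) ≤ ⌊y⌋₊ := by exact_mod_cast h1
  have h3 : y ≤ (⌊y⌋₊ : ℝ) ^ 2 := by nlinarith
  have := Real.log_le_log (by linarith) h3
  rw [Real.log_pow] at this
  push_cast at this
  linarith

/-- The two standard monotone sequences enclose Euler's constant and leave an error `2 / y`; the
weaker logarithmic form matches the shape available for `Λ`. -/
lemma recipSum_sub_log_bound (j : ℕ) : ∃ C : ℝ, 0 ≤ C ∧ ∀ y : ℝ, 2 ≤ y →
    |recipSum y - Real.log y - Real.eulerMascheroniConstant| ≤ C / Real.log y ^ j := by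
  refine ⟨2 * j.factorial, by positivity, fun y hy => ?_⟩
  have h1 : 2 ≤ ⌊y⌋₊ := Nat.le_floor (by simpa using hy)
  have h1' : (2 : ℝ) ≤ ⌊y⌋₊ := by exact_mod_cast h1
  have h2 : y < ⌊y⌋₊ + 1 := Nat.lt_floor_add_one y
  have h3 : (⌊y⌋₊ : ℝ) ≤ y := Nat.floor_le (by linarith)
  have hr : recipSum y = (harmonic ⌊y⌋₊ : ℝ) := by
    rw [harmonic_eq_sum_Icc, recipSum]
    push_cast
    have h : Finset.Ioc 0 ⌊y⌋₊ = Finset.Icc 1 ⌊y⌋₊ := by ext; simp; omega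
    rw [h]
    simp
  have h4 := Real.eulerMascheroniSeq_lt_eulerMascheroniConstant ⌊y⌋₊
  have h5 := Real.eulerMascheroniConstant_lt_eulerMascheroniSeq' ⌊y⌋₊
  rw [Real.eulerMascheroniSeq] at h4
  rw [Real.eulerMascheroniSeq', if_neg (by omega)] at h5
  have h6 : Real.log (⌊y⌋₊ + 1) - Real.log ⌊y⌋₊ ≤ 1 / ⌊y⌋₊ := by
    rw [← Real.log_div (by positivity) (by positivity)]
    calc _ ≤ ((⌊y⌋₊ : ℝ) + 1) / ⌊y⌋₊ - 1 := Real.log_le_sub_one_of_pos (by positivity)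
      _ = _ := by field_simp; ring
  have h7 : Real.log ⌊y⌋₊ ≤ Real.log y := Real.log_le_log (by linarith) h3
  have h8 : Real.log y ≤ Real.log (⌊y⌋₊ + 1) := Real.log_le_log (by linarith) h2.le
  have h9 : (1 : ℝ) / ⌊y⌋₊ ≤ 2 / y := by
    rw [div_le_div_iff₀ (by linarith) (by linarith)]
    linarith
  have hl : 0 < Real.log y := Real.log_pos (by linarith)
  have h10 : 2 / y ≤ 2 * j.factorial / Real.log y ^ j := by
    rw [div_le_div_iff₀ (by linarith) (by positivity)]
    have := log_pow_le_factorial_mul (y := y) (by linarith) j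
    nlinarith
  rw [hr, abs_le]
  constructor <;> linarith

/-- Telescopes, because `log (M + 1) - log M ≥ 1 / (M + 1)` makes each new term at most `1 / log M -
1 / log (M + 1)`. -/
lemma sum_inv_mul_log_sq_le {n M : ℕ} (hn : 2 ≤ n) (hM : n ≤ M) :
    ∑ m ∈ Finset.Ioc n M, 1 / ((m : ℝ) * Real.log m ^ 2) ≤
      1 / Real.log n - 1 / Real.log M := by
  induction M, hM using Nat.le_induction with
  | base => simp
  | succ M hM ih =>
    rw [Finset.sum_Ioc_succ_top (by omega)]
    have hM0 : (2 : ℝ) ≤ M := by exact_mod_cast hn.trans hM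
    have h1 : 0 < Real.log M := Real.log_pos (by linarith)
    have h2 : Real.log M ≤ Real.log (M + 1) := Real.log_le_log (by linarith) (by linarith)
    have h3 : 1 / ((M : ℝ) + 1) ≤ Real.log (M + 1) - Real.log M := by
      rw [← Real.log_div (by positivity) (by positivity)]
      have := Real.one_sub_inv_le_log_of_pos (x := ((M : ℝ) + 1) / M) (by positivity)
      refine le_trans (le_of_eq ?_) this
      field_simp
      ring
    have h4 : 1 / (((M : ℝ) + 1) * Real.log (M + 1) ^ 2) ≤
        1 / Real.log M - 1 / Real.log (M + 1) := by
      have h5 : 0 < Real.log (M + 1) := by linarith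
      calc _ = 1 / ((M : ℝ) + 1) / (Real.log (M + 1) * Real.log (M + 1)) := by
            field_simp
        _ ≤ (Real.log (M + 1) - Real.log M) / (Real.log M * Real.log (M + 1)) := by
            gcongr
        _ = _ := by field_simp
    push_cast
    linarith

/-- Summation by parts of `Λ - 1` against `1 / m`, so that only `ψ(k) - k` enters. -/
lemma sum_mangoldt_sub_one_div_eq (n : ℕ) :
    mangoldtRecipSum n - recipSum n =
      ((∑ m ∈ Finset.Ioc 0 n, ArithmeticFunction.vonMangoldt m) - n) / (n + 1) +
      ∑ k ∈ Finset.Ioc 0 n, ((∑ m ∈ Finset.Ioc 0 k, ArithmeticFunction.vonMangoldt m) - k) /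
        ((k : ℝ) * (k + 1)) := by
  simp only [mangoldtRecipSum, recipSum, Nat.floor_natCast]
  induction n with
  | zero => simp
  | succ n ih =>
    have e : ∀ f : ℕ → ℝ, ∑ m ∈ Finset.Ioc 0 (n + 1), f m =
        (∑ m ∈ Finset.Ioc 0 n, f m) + f (n + 1) :=
      fun f => Finset.sum_Ioc_succ_top (by omega) f
    rw [e fun k => (ArithmeticFunction.vonMangoldt).divId k, e fun k => (1 : ℝ) / k,
      e fun k => ((∑ m ∈ Finset.Ioc 0 k, ArithmeticFunction.vonMangoldt m) - k) /
        ((k : ℝ) * (k + 1)), e fun k => ArithmeticFunction.vonMangoldt k]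
    rw [add_sub_add_comm, ih, ArithmeticFunction.divId_apply]
    push_cast
    field_simp
    ring

/-- Mertens' estimate for `∑ Λ(m) / m` with a strong error term. -/
lemma mangoldtRecipSum_sub_log_bound (h : PsiLogPowError) : ∃ c : ℝ, ∀ j : ℕ, ∃ C : ℝ, 0 ≤ C ∧
    ∀ y : ℝ, 2 ≤ y → |mangoldtRecipSum y - Real.log y - c| ≤ C / Real.log y ^ j := by
  set e : ℕ → ℝ := fun n => (∑ m ∈ Finset.Ioc 0 n, ArithmeticFunction.vonMangoldt m) - n with he
  set s : ℕ → ℝ := fun n => ∑ k ∈ Finset.Ioc 0 n, e k / ((k : ℝ) * (k + 1)) with hs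
  have hK : ∀ j : ℕ, ∃ K : ℝ, 0 ≤ K ∧ ∀ n : ℕ, 2 ≤ n → |e n| ≤ K * (n / Real.log n ^ j) := by
    intro j
    obtain ⟨K, hK⟩ := h j
    refine ⟨|K|, abs_nonneg K, fun n hn => (hK n hn).trans ?_⟩
    gcongr
    exact le_abs_self K
  have hlog : ∀ n : ℕ, 2 ≤ n → 0 < Real.log n := fun n hn =>
    Real.log_pos (by exact_mod_cast (by omega : 1 < n))
  have tail : ∀ j : ℕ, ∃ K : ℝ, 0 ≤ K ∧ ∀ n M : ℕ, 2 ≤ n → n ≤ M →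
      |s n - s M| ≤ K / Real.log n ^ j := by
    intro j
    -- Two of the logarithmic powers are spent on the convergence of `∑ 1 / (k (log k)²)`; the other
    -- `j` remain as the rate.
    obtain ⟨K, hK0, hK⟩ := hK (j + 2)
    refine ⟨K * 2, by positivity, fun n M hn hM => ?_⟩
    have h1 : s M - s n = ∑ k ∈ Finset.Ioc n M, e k / ((k : ℝ) * (k + 1)) := by
      rw [sub_eq_iff_eq_add, add_comm]
      exact (Finset.sum_Ioc_consecutive _ (Nat.zero_le _) hM).symm
    rw [abs_sub_comm, h1]
    have hln := hlog n hn
    calc _ ≤ ∑ k ∈ Finset.Ioc n M, |e k / ((k : ℝ) * (k + 1))| :=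
          Finset.abs_sum_le_sum_abs _ _
      _ ≤ ∑ k ∈ Finset.Ioc n M, K / Real.log n ^ j * (1 / ((k : ℝ) * Real.log k ^ 2)) := by
          refine Finset.sum_le_sum fun k hk => ?_
          rw [Finset.mem_Ioc] at hk
          have hk0 : (0 : ℝ) < k := by exact_mod_cast (by omega : 0 < k)
          have hlk := hlog k (by omega)
          have hle : Real.log n ≤ Real.log k :=
            Real.log_le_log (by exact_mod_cast (by omega : 0 < n)) (by exact_mod_cast hk.1.le)
          rw [abs_div, abs_of_pos (by positivity : (0 : ℝ) < (k : ℝ) * (k + 1))]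
          calc _ ≤ K * (k / Real.log k ^ (j + 2)) / ((k : ℝ) * (k + 1)) := by
                gcongr
                exact hK k (by omega)
            _ = K / Real.log k ^ j * (1 / (((k : ℝ) + 1) * Real.log k ^ 2)) := by
                rw [pow_add]
                field_simp
            _ ≤ _ := by
                gcongr
                linarith
      _ = K / Real.log n ^ j * ∑ k ∈ Finset.Ioc n M, 1 / ((k : ℝ) * Real.log k ^ 2) := by
          rw [Finset.mul_sum]
      _ ≤ K / Real.log n ^ j * 2 := by
          gcongr
          have hl2 : 1 / Real.log n ≤ 2 := by
            rw [div_le_iff₀ hln]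
            have := Real.log_le_log (by norm_num) (by exact_mod_cast hn : (2 : ℝ) ≤ n)
            have := Real.log_two_gt_d9
            linarith
          have := sum_inv_mul_log_sq_le hn hM
          have h2 : 0 ≤ 1 / Real.log M := (one_div_pos.2 (hlog M (by omega))).le
          linarith
      _ = _ := by
          ring
  have hlim : ∃ c, Tendsto (fun n => s (n + 2)) atTop (𝓝 c) := by
    obtain ⟨K, hK0, hK⟩ := tail 1
    refine cauchySeq_tendsto_of_complete (cauchySeq_of_le_tendsto_0'
      (fun n : ℕ => K / Real.log ((n + 2 : ℕ) : ℝ) ^ 1) ?_ ?_)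
    · intro n m hnm
      rw [Real.dist_eq]
      exact hK (n + 2) (m + 2) (by omega) (by omega)
    · simp only [pow_one]
      refine Tendsto.const_div_atTop ?_ K
      exact Real.tendsto_log_atTop.comp
        (tendsto_natCast_atTop_atTop.comp (tendsto_add_atTop_nat 2))
  obtain ⟨c, hc⟩ := hlim
  -- The constant is fixed before `j`: it is Euler's constant plus the sum of the series `(ψ(k) - k)
  -- / (k (k + 1))`, independently of the rate at which the tail is measured.
  refine ⟨Real.eulerMascheroniConstant + c, fun j => ?_⟩
  obtain ⟨C1, hC1, h1⟩ := recipSum_sub_log_bound j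
  obtain ⟨K2, hK2, h2⟩ := hK j
  obtain ⟨K3, hK3, h3⟩ := tail j
  refine ⟨C1 + K2 * 2 ^ j + K3 * 2 ^ j, by positivity, fun y hy => ?_⟩
  have hn : 2 ≤ ⌊y⌋₊ := Nat.le_floor (by simpa using hy)
  set n := ⌊y⌋₊ with hndef
  have hly : 0 < Real.log y := Real.log_pos (by linarith)
  have hln := log_floor_ge hy
  rw [← hndef] at hln
  have hscale : ∀ K : ℝ, 0 ≤ K → K / Real.log n ^ j ≤ K * 2 ^ j / Real.log y ^ j := by
    intro K hK
    calc K / Real.log n ^ j ≤ K / (Real.log y / 2) ^ j := by gcongr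
      _ = _ := by rw [div_pow]; field_simp
  have hs3 : |s n - c| ≤ K3 * 2 ^ j / Real.log y ^ j := by
    refine le_trans ?_ (hscale K3 hK3)
    have ht : Tendsto (fun m => |s n - s (m + 2)|) atTop (𝓝 |s n - c|) :=
      (tendsto_const_nhds.sub hc).abs
    refine le_of_tendsto ht ?_
    filter_upwards [eventually_ge_atTop n] with m hm
    exact h3 n (m + 2) hn (by omega)
  have he2 : |e n / (n + 1)| ≤ K2 * 2 ^ j / Real.log y ^ j := by
    refine le_trans ?_ (hscale K2 hK2)
    rw [abs_div, abs_of_pos (by positivity : (0 : ℝ) < (n : ℝ) + 1), div_le_iff₀ (by positivity)]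
    refine (h2 n hn).trans ?_
    have := hlog n hn
    rw [div_mul_eq_mul_div, mul_div_assoc]
    gcongr
    linarith
  have heq : mangoldtRecipSum y = recipSum y + e n / (n + 1) + s n := by
    have := sum_mangoldt_sub_one_div_eq n
    have e1 : mangoldtRecipSum n = mangoldtRecipSum y := by
      simp [mangoldtRecipSum, hndef]
    have e2 : recipSum n = recipSum y := by
      simp [recipSum, hndef]
    rw [e1, e2] at this
    linarith
  rw [heq]
  have h1y := h1 y hy
  calc |recipSum y + e n / (n + 1) + s n - Real.log y - (Real.eulerMascheroniConstant + c)|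
      = |(recipSum y - Real.log y - Real.eulerMascheroniConstant) + e n / (n + 1) + (s n - c)| := by
        ring_nf
    _ ≤ _ := abs_add_three _ _ _
    _ ≤ C1 / Real.log y ^ j + K2 * 2 ^ j / Real.log y ^ j + K3 * 2 ^ j / Real.log y ^ j := by
        gcongr
    _ = _ := by ring

lemma abs_moebiusRecipSum_le {x : ℝ} (hx : 1 ≤ x) : |moebiusRecipSum ⌊x⌋₊| ≤ 1 + Real.log x :=
  (Finset.abs_sum_le_sum_abs _ _).trans (sum_abs_divId_realMoebius_le hx)

/-! ### Bootstrapping the decay of the Möbius sums -/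

/-- Bounds for the partial sums of `μ(k) / k`, with `x = exp (s ^ 2)`. -/
def MoebiusRecipSumBound (j : ℕ) (C : ℝ) : Prop :=
  0 ≤ C ∧ ∀ s : ℝ, 1 ≤ s → |moebiusRecipSum ⌊Real.exp (s ^ 2)⌋₊| ≤ C * (s ^ 2 / s ^ j)

/-- Cut at `U = exp s`, where `s = √(log x)`. For `k ≤ x / U` the two weights differ by at most `K /
s ^ j`, and summing `1 / k` costs `O(s²)`. For `k > x / U` the Möbius partial sums satisfy the
assumed bound at a scale at least `s / 2`, and the weights at `U` are `O(s)`. The outcome is worse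
than the assumed bound by only one factor `s`, while a later division by `log x = s²` gains two. -/
lemma MoebiusRecipSumBound.abs_sum_le {j : ℕ} {C : ℝ} (hC : MoebiusRecipSumBound j C)
    {w v : ℝ → ℝ} (hw : MonotoneOn w (Set.Ici 1))
    (hv : MonotoneOn v (Set.Ici 1)) (hw0 : 0 ≤ w 1) (hv0 : 0 ≤ v 1) {K a : ℝ} (hK : 0 ≤ K)
    (ha : 0 ≤ a) (hwv : ∀ y, 2 ≤ y → |w y - v y| ≤ K / Real.log y ^ j)
    (hva : ∀ y, 1 ≤ y → v y ≤ a + Real.log y) :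
    ∃ C' : ℝ, 0 ≤ C' ∧ ∀ s : ℝ, 4 ≤ s →
      |∑ k ∈ Finset.Ioc 0 ⌊Real.exp (s ^ 2)⌋₊, realMoebius.divId k *
        (w (Real.exp (s ^ 2) / k) - v (Real.exp (s ^ 2) / k))| ≤ C' * (s ^ 3 / s ^ j) := by
  obtain ⟨hC0, hC⟩ := hC
  refine ⟨2 * K + 2 * (C * 2 ^ j) * (2 * a + 2 + K), by positivity, fun s hs => ?_⟩
  have hexp2 : (2 : ℝ) ≤ Real.exp 1 := by
    have := Real.add_one_le_exp (1 : ℝ)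
    linarith
  have hU2 : 2 ≤ Real.exp s := hexp2.trans (Real.exp_le_exp.2 (by linarith))
  have hUx : Real.exp s ≤ Real.exp (s ^ 2) := Real.exp_le_exp.2 (by nlinarith)
  have hsj : 0 < s ^ j := by positivity
  have h := abs_sum_moebius_mul_sub_le hw hv hw0 hv0 (x := Real.exp (s ^ 2)) (U := Real.exp s)
    (η := K / s ^ j) (F := C * 2 ^ j * (s ^ 2 / s ^ j)) (by linarith) hUx ?_ ?_
  · have hs1 : 1 ≤ s ^ j := one_le_pow₀ (by linarith)
    have hwU : w (Real.exp s) ≤ v (Real.exp s) + K := by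
      have := hwv _ hU2
      rw [Real.log_exp] at this
      have h2 : K / s ^ j ≤ K := div_le_self hK hs1
      linarith [(abs_le.1 this).2]
    have hvU : v (Real.exp s) ≤ a + s := by
      have := hva (Real.exp s) (by linarith)
      rwa [Real.log_exp] at this
    refine h.trans ?_
    rw [Real.log_exp]
    have h3 : w (Real.exp s) + v (Real.exp s) ≤ (2 * a + 2 + K) * s := by nlinarith
    have h4 : 1 + s ^ 2 ≤ 2 * s ^ 3 := by nlinarith [mul_nonneg (by linarith : 0 ≤ s) (by linarith : 0 ≤ s)]
    calc K / s ^ j * (1 + s ^ 2) + 2 * (C * 2 ^ j * (s ^ 2 / s ^ j)) *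
          (w (Real.exp s) + v (Real.exp s))
        ≤ K / s ^ j * (2 * s ^ 3) + 2 * (C * 2 ^ j * (s ^ 2 / s ^ j)) *
          ((2 * a + 2 + K) * s) := by gcongr
      _ = _ := by field_simp
  · intro y hy
    have hly : s ≤ Real.log y := (Real.le_log_iff_exp_le (by linarith)).2 hy
    refine (hwv y (by linarith)).trans ?_
    gcongr
  · intro t ht ht'
    -- The square of `exp (s² / 4)` is at most `exp (s² - s) < t + 1`. Weakening the exponent from
    -- `s² - s` to `s² / 4` absorbs the loss from the floor.
    have h1 : Real.exp (s ^ 2 / 4) ≤ t := by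
      have h2 : Real.exp (s ^ 2) / Real.exp s < t + 1 :=
        (Nat.lt_floor_add_one _).trans_le (by exact_mod_cast Nat.succ_le_succ ht)
      rw [← Real.exp_sub] at h2
      have h3 : Real.exp (s ^ 2 / 4) * Real.exp (s ^ 2 / 4) ≤ Real.exp (s ^ 2 - s) := by
        rw [← Real.exp_add]
        exact Real.exp_le_exp.2 (by nlinarith)
      have h4 : Real.exp 1 ≤ Real.exp (s ^ 2 / 4) := Real.exp_le_exp.2 (by nlinarith)
      nlinarith
    have ht0 : (0 : ℝ) < t := (Real.exp_pos _).trans_le h1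
    have h5 : s ^ 2 / 4 ≤ Real.log t := (Real.le_log_iff_exp_le ht0).2 h1
    have h6 : Real.log t ≤ s ^ 2 := by
      rw [← Real.log_exp (s ^ 2)]
      exact Real.log_le_log ht0 ((Nat.le_floor_iff (Real.exp_pos _).le).1 ht')
    have h7 : s / 2 ≤ √(Real.log t) := by
      apply Real.le_sqrt_of_sq_le
      linarith [h5]
    have h8 : √(Real.log t) ≤ s := by
      rw [Real.sqrt_le_left (by linarith)]
      exact h6
    have h9 := hC (√(Real.log t)) (by linarith)
    rw [Real.sq_sqrt (by nlinarith), Real.exp_log ht0, Nat.floor_natCast] at h9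
    refine h9.trans ?_
    calc C * (Real.log t / √(Real.log t) ^ j) ≤ C * (s ^ 2 / (s / 2) ^ j) := by gcongr
      _ = _ := by rw [div_pow]; field_simp

/-- Induction on `j` from the trivial bound. Splitting `log x = log (x / k) + log k` expresses `log
x ∑ μ(k) / k` through `∑ μ(k) / k (∑_{m ≤ x / k} Λ(m) / m - log (x / k) - c)` and `c ∑ μ(k) / k`;
each division by `log x` gains one more factor `s`. -/
lemma exists_moebiusRecipSumBound (h : PsiLogPowError) (j : ℕ) :
    ∃ C, MoebiusRecipSumBound j C := by
  have triv : ∀ s : ℝ, 1 ≤ s → |moebiusRecipSum ⌊Real.exp (s ^ 2)⌋₊| ≤ 2 * s ^ 2 := by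
    intro s hs
    have := abs_moebiusRecipSum_le (x := Real.exp (s ^ 2)) (Real.one_le_exp (by positivity))
    rw [Real.log_exp] at this
    nlinarith
  induction j with
  | zero =>
    refine ⟨2, by norm_num, fun s hs => ?_⟩
    simpa using triv s hs
  | succ j ih =>
    obtain ⟨C, hC⟩ := ih
    obtain ⟨c, hc⟩ := mangoldtRecipSum_sub_log_bound h
    obtain ⟨K, hK, hcK⟩ := hc j
    have hlogmono : MonotoneOn Real.log (Set.Ici 1) := fun a ha b _ hab =>
      Real.log_le_log (lt_of_lt_of_le one_pos ha) hab
    -- Adding `|c|` to both functions makes them nonnegative at 1 whatever the sign of `c`, without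
    -- changing their difference.
    obtain ⟨C', hC', hs⟩ := hC.abs_sum_le (w := fun y => mangoldtRecipSum y + |c|)
      (v := fun y => Real.log y + (c + |c|)) (K := K) (a := c + |c|)
      ((monotone_mangoldtRecipSum.add_const _).monotoneOn _) (hlogmono.add_const _)
      (add_nonneg (Finset.sum_nonneg fun _ _ =>
        div_nonneg ArithmeticFunction.vonMangoldt_nonneg (Nat.cast_nonneg _)) (abs_nonneg _))
      (by simp only [Real.log_one, zero_add]; linarith [neg_abs_le c]) hK
      (by linarith [neg_abs_le c])
      (fun y hy => by
        have := hcK y hy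
        rwa [show mangoldtRecipSum y + |c| - (Real.log y + (c + |c|)) =
          mangoldtRecipSum y - Real.log y - c by ring])
      (fun y _ => by linarith)
    refine ⟨C' + |c| * C + 2 * 4 ^ (j + 1), by have := hC.1; positivity, fun s hs1 => ?_⟩
    have hsj : 0 < s ^ (j + 1) := by positivity
    have hC0 := hC.1
    rcases lt_or_ge s 4 with h4 | h4
    · refine (triv s hs1).trans ?_
      rw [← mul_div_assoc, le_div_iff₀ hsj]
      have h5 : s ^ (j + 1) ≤ 4 ^ (j + 1) := pow_le_pow_left₀ (by linarith) h4.le _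
      have h6 : 0 ≤ (C' + |c| * C) * s ^ 2 := by positivity
      have h7 : 2 * s ^ 2 * s ^ (j + 1) ≤ 2 * s ^ 2 * 4 ^ (j + 1) := by gcongr
      linarith
    · have hsum := hs s h4
      set x := Real.exp (s ^ 2) with hx
      have hx0 : 0 < x := Real.exp_pos _
      have hlogx : Real.log x = s ^ 2 := Real.log_exp _
      have hid : moebiusRecipSum ⌊x⌋₊ * s ^ 2 =
          -(∑ k ∈ Finset.Ioc 0 ⌊x⌋₊, realMoebius.divId k *
            (mangoldtRecipSum (x / k) + |c| - (Real.log (x / k) + (c + |c|)))) -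
          c * moebiusRecipSum ⌊x⌋₊ := by
        have h1 := sum_moebius_mul_mangoldtRecipSum x
        have h2 : ∑ k ∈ Finset.Ioc 0 ⌊x⌋₊, realMoebius.divId k *
            (mangoldtRecipSum (x / k) + |c| - (Real.log (x / k) + (c + |c|))) =
            ∑ k ∈ Finset.Ioc 0 ⌊x⌋₊, realMoebius.divId k * mangoldtRecipSum (x / k) +
            ∑ k ∈ Finset.Ioc 0 ⌊x⌋₊, realMoebius.divId k * Real.log k -
            ∑ k ∈ Finset.Ioc 0 ⌊x⌋₊, realMoebius.divId k * (s ^ 2 + c) := by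
          rw [← Finset.sum_add_distrib, ← Finset.sum_sub_distrib]
          refine Finset.sum_congr rfl fun k hk => ?_
          have hk0 : (k : ℝ) ≠ 0 := by simp at hk; exact_mod_cast (by omega : k ≠ 0)
          rw [Real.log_div hx0.ne' hk0, hlogx]
          ring
        rw [h2, h1, ← Finset.sum_mul, moebiusRecipSum]
        ring
      have hb := hC.2 s hs1
      rw [← hx] at hb
      have h6 : |moebiusRecipSum ⌊x⌋₊| * s ^ 2 ≤
          C' * (s ^ 3 / s ^ j) + |c| * (C * (s ^ 2 / s ^ j)) := by
        rw [← abs_of_pos (by positivity : (0 : ℝ) < s ^ 2), ← abs_mul, hid]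
        refine (abs_sub _ _).trans ?_
        rw [abs_neg, abs_mul, abs_of_pos (by positivity : (0 : ℝ) < s ^ 2)]
        gcongr
      have h8 : |moebiusRecipSum ⌊x⌋₊| * s ^ 2 ≤ (C' + |c| * C) * (s ^ 2 / s ^ (j + 1)) * s ^ 2 := by
        refine h6.trans ?_
        have h9 : s ^ 3 / s ^ j = s ^ 2 / s ^ (j + 1) * s ^ 2 := by
          rw [pow_succ s j]
          field_simp
        have h10 : s ^ 2 / s ^ j ≤ s ^ 3 / s ^ j := by
          gcongr
          norm_num
        calc _ ≤ C' * (s ^ 3 / s ^ j) + |c| * (C * (s ^ 3 / s ^ j)) := by gcongr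
          _ = _ := by rw [h9]; ring
      have h11 := le_of_mul_le_mul_right h8 (by positivity)
      refine h11.trans (mul_le_mul_of_nonneg_right ?_ (by positivity))
      have : (0 : ℝ) ≤ 2 * 4 ^ (j + 1) := by positivity
      linarith

/-- The sum of `μ(k) / k * log (x / k)` over `k ≤ x`. -/
def moebiusLogSum (x : ℝ) : ℝ :=
  ∑ k ∈ Finset.Ioc 0 ⌊x⌋₊, realMoebius.divId k * Real.log (x / k)

lemma abs_moebiusLogSum_le {x : ℝ} (hx : 1 ≤ x) :
    |moebiusLogSum x| ≤ (1 + Real.log x) * Real.log x := by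
  calc _ ≤ ∑ k ∈ Finset.Ioc 0 ⌊x⌋₊, |realMoebius.divId k * Real.log (x / k)| :=
        Finset.abs_sum_le_sum_abs _ _
    _ ≤ ∑ k ∈ Finset.Ioc 0 ⌊x⌋₊, |realMoebius.divId k| * Real.log x := by
        refine Finset.sum_le_sum fun k hk => ?_
        rw [Finset.mem_Ioc] at hk
        have hk1 : (1 : ℝ) ≤ k := by exact_mod_cast hk.1
        have hkx : (k : ℝ) ≤ x := (Nat.le_floor_iff (by linarith)).1 hk.2
        have h1 : 0 ≤ Real.log (x / k) := Real.log_nonneg ((one_le_div (by linarith)).2 hkx)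
        rw [abs_mul, abs_of_nonneg h1]
        gcongr
        exact div_le_self (by linarith) hk1
    _ = (∑ k ∈ Finset.Ioc 0 ⌊x⌋₊, |realMoebius.divId k|) * Real.log x := by
        rw [Finset.sum_mul]
    _ ≤ _ := by
        have := Real.log_nonneg hx
        gcongr
        exact sum_abs_divId_realMoebius_le hx

/-- `∑_{k ≤ x} μ(k) / k * log (x / k) = 1 + O((log x) ^ (-n))`. -/
theorem moebiusLogSum_sub_one_bound (h : PsiLogPowError) (n : ℕ) :
    ∃ C : ℝ, 0 ≤ C ∧ ∀ x : ℝ, 0 < x → 1 ≤ Real.log x →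
      |moebiusLogSum x - 1| ≤ C / Real.log x ^ n := by
  -- With `s² = log x`, the exponent `2n + 3` turns the resulting `s ^ 3 / s ^ (2n + 3)` into
  -- exactly `(log x) ^ (-n)`.
  obtain ⟨C, hC⟩ := exists_moebiusRecipSumBound h (2 * n + 3)
  obtain ⟨K, hK, hcK⟩ := recipSum_sub_log_bound (2 * n + 3)
  have hlogmono : MonotoneOn Real.log (Set.Ici 1) := fun a ha b _ hab =>
    Real.log_le_log (lt_of_lt_of_le one_pos ha) hab
  have hγ : 0 ≤ Real.eulerMascheroniConstant := by
    linarith [Real.one_half_lt_eulerMascheroniConstant]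
  obtain ⟨C', hC', hs⟩ := hC.abs_sum_le (w := recipSum)
    (v := fun y => Real.log y + Real.eulerMascheroniConstant) (K := K)
    (a := Real.eulerMascheroniConstant)
    (monotone_recipSum.monotoneOn _) (hlogmono.add_const _)
    (Finset.sum_nonneg fun _ _ => by positivity)
    (by simpa using hγ) hK hγ
    (fun y hy => by
      have := hcK y hy
      rwa [show recipSum y - (Real.log y + Real.eulerMascheroniConstant) =
        recipSum y - Real.log y - Real.eulerMascheroniConstant by ring])
    (fun y _ => by linarith)
  have hC0 := hC.1
  refine ⟨C' + Real.eulerMascheroniConstant * C + (17 * 16 + 1) * 16 ^ n, by positivity,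
    fun x hx0 hx => ?_⟩
  have hx1 : 1 ≤ x := by
    by_contra! hlt
    linarith [Real.log_nonpos hx0.le hlt.le]
  have hlp : 0 < Real.log x ^ n := by positivity
  set s := √(Real.log x) with hsdef
  have hs2 : s ^ 2 = Real.log x := Real.sq_sqrt (by linarith)
  have hxs : Real.exp (s ^ 2) = x := by rw [hs2, Real.exp_log hx0]
  have hs1 : 1 ≤ s := Real.one_le_sqrt.2 hx
  rcases lt_or_ge s 4 with h4 | h4
  -- For `s < 4`, that is `log x < 16`, the trivial bound suffices; it is the source of the summand
  -- `(17 * 16 + 1) * 16 ^ n`.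
  · rw [le_div_iff₀ hlp]
    have hl16 : Real.log x ≤ 16 := by rw [← hs2]; nlinarith
    have h1 := abs_moebiusLogSum_le hx1
    have h2 : |moebiusLogSum x - 1| ≤ 17 * 16 + 1 := by
      refine (abs_sub _ _).trans ?_
      rw [abs_one]
      nlinarith
    have h3 : Real.log x ^ n ≤ 16 ^ n := pow_le_pow_left₀ (by linarith) hl16 _
    have h4 : 0 ≤ C' + Real.eulerMascheroniConstant * C := by positivity
    have h5 : |moebiusLogSum x - 1| * Real.log x ^ n ≤ (17 * 16 + 1) * 16 ^ n := by gcongr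
    linarith
  · have hsum := hs s h4
    have hb := hC.2 s hs1
    rw [hxs] at hsum hb
    have hid : moebiusLogSum x - 1 =
        -(∑ k ∈ Finset.Ioc 0 ⌊x⌋₊, realMoebius.divId k *
            (recipSum (x / k) - (Real.log (x / k) + Real.eulerMascheroniConstant))) -
          Real.eulerMascheroniConstant * moebiusRecipSum ⌊x⌋₊ := by
      have h1 := sum_moebius_mul_recipSum hx1
      have h2 : ∑ k ∈ Finset.Ioc 0 ⌊x⌋₊, realMoebius.divId k *
            (recipSum (x / k) - (Real.log (x / k) + Real.eulerMascheroniConstant)) =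
          ∑ k ∈ Finset.Ioc 0 ⌊x⌋₊, realMoebius.divId k * recipSum (x / k) -
          ∑ k ∈ Finset.Ioc 0 ⌊x⌋₊, realMoebius.divId k * Real.log (x / k) -
          (∑ k ∈ Finset.Ioc 0 ⌊x⌋₊, realMoebius.divId k) * Real.eulerMascheroniConstant := by
        rw [Finset.sum_mul, ← Finset.sum_sub_distrib, ← Finset.sum_sub_distrib]
        exact Finset.sum_congr rfl fun k _ => by ring
      rw [h2, h1, moebiusLogSum, moebiusRecipSum]
      ring
    rw [hid]
    have hpow : s ^ 3 / s ^ (2 * n + 3) = 1 / Real.log x ^ n := by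
      rw [← hs2, ← pow_mul, pow_add]
      field_simp
    have h10 : s ^ 2 / s ^ (2 * n + 3) ≤ s ^ 3 / s ^ (2 * n + 3) := by
      gcongr
      norm_num
    calc _ ≤ _ := abs_sub _ _
      _ ≤ C' * (s ^ 3 / s ^ (2 * n + 3)) +
          Real.eulerMascheroniConstant * (C * (s ^ 3 / s ^ (2 * n + 3))) := by
          rw [abs_neg, abs_mul, abs_of_nonneg hγ]
          gcongr
          exact hb.trans (by gcongr)
      _ = (C' + Real.eulerMascheroniConstant * C) / Real.log x ^ n := by rw [hpow]; ring
      _ ≤ _ := by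
          refine div_le_div_of_nonneg_right ?_ hlp.le
          have : (0 : ℝ) ≤ (17 * 16 + 1) * 16 ^ n := by positivity
          linarith

/-! ### Elementary bounds for the totient and the number of prime factors -/

/-- The extremal set is `{2, …, |S| + 1}`, for which the product telescopes. Remove the largest
element `a`: the others lie in `[2, a)`, which forces `a ≥ |S| + 1`. -/
lemma prod_div_sub_one_le_card_add_one (S : Finset ℕ) (hS : ∀ s ∈ S, 2 ≤ s) :
    ∏ s ∈ S, ((s : ℝ) / (s - 1)) ≤ S.card + 1 := by
  induction S using Finset.induction_on_max with
  | empty => simp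
  | insert a T hT ih =>
    have haT : a ∉ T := fun h => lt_irrefl a (hT a h)
    rw [Finset.prod_insert haT, Finset.card_insert_of_notMem haT]
    have hcard : T.card + 2 ≤ a := by
      have hsub : T ⊆ Finset.Ico 2 a := fun t ht =>
        Finset.mem_Ico.2 ⟨hS t (Finset.mem_insert_of_mem ht), hT t ht⟩
      have := Finset.card_le_card hsub
      have h2 := hS a (Finset.mem_insert_self a T)
      simp at this
      omega
    have hcard' : (T.card : ℝ) + 2 ≤ a := by exact_mod_cast hcard
    have hpos : (0 : ℝ) ≤ T.card := Nat.cast_nonneg _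
    have ih' := ih fun s hs => hS s (Finset.mem_insert_of_mem hs)
    calc (a : ℝ) / (a - 1) * ∏ s ∈ T, ((s : ℝ) / (s - 1)) ≤
          (a : ℝ) / (a - 1) * (T.card + 1) := by
          have : (0 : ℝ) ≤ (a : ℝ) / (a - 1) := div_nonneg (by linarith) (by linarith)
          gcongr
      _ ≤ _ := by
          rw [div_mul_eq_mul_div, div_le_iff₀ (by linarith)]
          push_cast
          nlinarith

lemma card_primeFactors_le_two_mul_log {n : ℕ} (hn : n ≠ 0) :
    (n.primeFactors.card : ℝ) ≤ 2 * Real.log n := by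
  have h1 : 2 ^ n.primeFactors.card ≤ n := by
    calc 2 ^ n.primeFactors.card ≤ ∏ p ∈ n.primeFactors, p := by
          apply Finset.pow_card_le_prod
          intro p hp
          exact (Nat.prime_of_mem_primeFactors hp).two_le
      _ ≤ n := Nat.le_of_dvd (Nat.pos_of_ne_zero hn) (Nat.prod_primeFactors_dvd n)
  have h2 : (2 : ℝ) ^ n.primeFactors.card ≤ n := by exact_mod_cast h1
  have h3 := Real.log_le_log (by positivity) h2
  rw [Real.log_pow] at h3
  have h4 := Real.log_two_gt_d9
  have h5 : (0 : ℝ) ≤ n.primeFactors.card := Nat.cast_nonneg _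
  nlinarith

lemma totient_sq (n : ℕ) : (n ^ 2).totient = n * n.totient := by
  rcases Nat.eq_zero_or_pos n with rfl | hn
  · simp
  · have h := Nat.totient_gcd_mul_totient_mul n n
    rw [Nat.gcd_self, mul_assoc] at h
    rw [sq, mul_comm n n.totient]
    exact Nat.eq_of_mul_eq_mul_left (Nat.totient_pos.2 hn) h

/-- `n / φ(n) = ∏_{p ∣ n} p / (p - 1)` is at most `ω(n) + 1`, and `ω(n) ≤ 2 log n`. -/
lemma inv_totient_le {n : ℕ} (hn : n ≠ 0) :
    1 / (n.totient : ℝ) ≤ (1 + 2 * Real.log n) / n := by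
  have h := Nat.totient_eq_mul_prod_factors n
  have h' : (n.totient : ℝ) = n * ∏ p ∈ n.primeFactors, (1 - (p : ℝ)⁻¹) := by
    have := congrArg (Rat.cast : ℚ → ℝ) h
    push_cast at this
    exact this
  have hprod : (∏ p ∈ n.primeFactors, (1 - (p : ℝ)⁻¹)) *
      ∏ p ∈ n.primeFactors, ((p : ℝ) / (p - 1)) = 1 := by
    rw [← Finset.prod_mul_distrib]
    refine Finset.prod_eq_one fun p hp => ?_
    have h2 : (2 : ℝ) ≤ p := by exact_mod_cast (Nat.prime_of_mem_primeFactors hp).two_le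
    have : (p : ℝ) - 1 ≠ 0 := by linarith
    field_simp
  have hle := prod_div_sub_one_le_card_add_one n.primeFactors
    fun p hp => (Nat.prime_of_mem_primeFactors hp).two_le
  have hω := card_primeFactors_le_two_mul_log hn
  have hn0 : (0 : ℝ) < n := by exact_mod_cast Nat.pos_of_ne_zero hn
  have hφ : (0 : ℝ) < n.totient := by exact_mod_cast Nat.totient_pos.2 (Nat.pos_of_ne_zero hn)
  rw [div_le_div_iff₀ hφ hn0]
  calc 1 * (n : ℝ) = n.totient * ∏ p ∈ n.primeFactors, ((p : ℝ) / (p - 1)) := by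
        rw [h', mul_assoc, hprod]; ring
    _ ≤ n.totient * (1 + 2 * Real.log n) := by
        gcongr
        linarith
    _ = _ := by ring

/-- Tails of `∑ 1 / φ(e²)`. -/
lemma sum_inv_totient_sq_tail_le {E M : ℕ} (hE : 1 ≤ E) (hEM : E ≤ M) :
    ∑ e ∈ Finset.Ioc E M, 1 / ((e ^ 2).totient : ℝ) ≤
      (5 + 2 * Real.log E) / E - (5 + 2 * Real.log M) / M := by
  induction M, hEM using Nat.le_induction with
  | base => simp
  | succ M hM ih =>
    rw [Finset.sum_Ioc_succ_top (by omega)]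
    have hM1 : (1 : ℝ) ≤ M := by exact_mod_cast hE.trans hM
    have h1 : 1 / (((M + 1) ^ 2).totient : ℝ) ≤
        (1 + 2 * Real.log (M + 1)) / ((M : ℝ) + 1) ^ 2 := by
      rw [totient_sq]
      have := inv_totient_le (n := M + 1) (by omega)
      push_cast at this ⊢
      calc _ = 1 / ((M : ℝ) + 1) * (1 / ((M + 1).totient : ℝ)) := by
            rw [div_mul_div_comm]; norm_num
        _ ≤ 1 / ((M : ℝ) + 1) * ((1 + 2 * Real.log (M + 1)) / ((M : ℝ) + 1)) := by gcongr
        _ = _ := by field_simp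
    have h2 : Real.log (M + 1) - Real.log M ≤ 1 / M := by
      rw [← Real.log_div (by positivity) (by positivity)]
      calc _ ≤ ((M : ℝ) + 1) / M - 1 := Real.log_le_sub_one_of_pos (by positivity)
        _ = _ := by field_simp; ring
    have hl : 0 ≤ Real.log (M + 1) := Real.log_nonneg (by linarith)
    -- The constant 5 lets `(5 + 2 log M) / M` serve as a telescoping majorant: what is left over is
    -- `(2M - 2) / (M² (M + 1)) ≥ 0`.
    have h3 : (1 + 2 * Real.log (M + 1)) / ((M : ℝ) + 1) ^ 2 ≤
        (5 + 2 * Real.log M) / M - (5 + 2 * Real.log (M + 1)) / (M + 1) := by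
      have h4 : (5 + 2 * (Real.log (M + 1) - 1 / M)) / M ≤ (5 + 2 * Real.log M) / M := by
        gcongr
        linarith
      have h5 : (1 + 2 * Real.log (M + 1)) / ((M : ℝ) + 1) ^ 2 ≤
          (1 + 2 * Real.log (M + 1)) / (M * ((M : ℝ) + 1)) := by
        gcongr
        nlinarith
      have h6 : (5 + 2 * (Real.log (M + 1) - 1 / M)) / M - (5 + 2 * Real.log (M + 1)) / (M + 1)
          - (1 + 2 * Real.log (M + 1)) / (M * ((M : ℝ) + 1)) =
          (2 * M - 2) / ((M : ℝ) ^ 2 * (M + 1)) := by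
        field_simp
        ring
      have h7 : 0 ≤ (2 * (M : ℝ) - 2) / ((M : ℝ) ^ 2 * (M + 1)) :=
        div_nonneg (by linarith) (by positivity)
      linarith
    push_cast
    linarith

lemma sum_inv_totient_sq_le {E M : ℕ} (hE : 1 ≤ E) :
    ∑ e ∈ Finset.Ioc E M, 1 / ((e ^ 2).totient : ℝ) ≤ (5 + 2 * Real.log E) / E := by
  rcases le_or_gt E M with h | h
  · have := sum_inv_totient_sq_tail_le hE h
    have h2 : 0 ≤ (5 + 2 * Real.log M) / M :=
      div_nonneg (by have := Real.log_natCast_nonneg M; linarith) (Nat.cast_nonneg _)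
    linarith
  · rw [Finset.Ioc_eq_empty (by omega)]
    exact div_nonneg (by have := Real.log_natCast_nonneg E; simp; linarith) (Nat.cast_nonneg _)

lemma summable_inv_totient_sq : Summable fun e : ℕ => 1 / ((e ^ 2).totient : ℝ) := by
  refine summable_of_sum_range_le (c := 1 + (5 + 2 * Real.log (1 : ℕ)) / (1 : ℕ))
    (fun _ => by positivity) fun n => ?_
  calc ∑ e ∈ Finset.range n, 1 / ((e ^ 2).totient : ℝ)
      ≤ ∑ e ∈ Finset.range (n + 2), 1 / ((e ^ 2).totient : ℝ) := by
        refine Finset.sum_le_sum_of_subset_of_nonneg (Finset.range_mono (by omega))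
          fun _ _ _ => by positivity
    _ = 1 + ∑ e ∈ Finset.Ioc 1 (n + 1), 1 / ((e ^ 2).totient : ℝ) := by
        have h : Finset.range (n + 2) = insert 0 (insert 1 (Finset.Ioc 1 (n + 1))) := by
          ext x
          simp
          omega
        -- The term `e = 0` is `1 / 0 = 0`, and `e = 1` contributes the 1.
        rw [h, Finset.sum_insert (by simp), Finset.sum_insert (by simp)]
        simp
    _ ≤ _ := by
        gcongr
        exact sum_inv_totient_sq_le le_rfl

/-- Beyond some `P` every prime has `4 ≤ p ^ ε`, so those primes contribute at most `n ^ ε`; there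
are at most `P` smaller ones. -/
lemma four_pow_card_primeFactors_le {ε : ℝ} (hε : 0 < ε) :
    ∃ C : ℝ, 0 < C ∧ ∀ n : ℕ, n ≠ 0 → (4 : ℝ) ^ n.primeFactors.card ≤ C * (n : ℝ) ^ ε := by
  obtain ⟨P, hP⟩ : ∃ P : ℕ, ∀ p : ℕ, P ≤ p → (4 : ℝ) ≤ (p : ℝ) ^ ε := by
    have := (tendsto_rpow_atTop hε).comp (tendsto_natCast_atTop_atTop (R := ℝ))
    obtain ⟨P, hP⟩ := eventually_atTop.1 (this.eventually_ge_atTop 4)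
    exact ⟨P, hP⟩
  refine ⟨4 ^ P, by positivity, fun n hn => ?_⟩
  rw [← Finset.card_filter_add_card_filter_not (fun p => p < P) (s := n.primeFactors), pow_add]
  gcongr
  · norm_num
  · calc _ ≤ (Finset.range P).card := Finset.card_le_card fun p hp => by
          simp at hp ⊢; omega
      _ = P := Finset.card_range P
  · calc (4 : ℝ) ^ (Finset.filter (fun p => ¬ p < P) n.primeFactors).card
        = ∏ p ∈ n.primeFactors with ¬ p < P, (4 : ℝ) := by rw [Finset.prod_const]
      _ ≤ ∏ p ∈ n.primeFactors with ¬ p < P, (p : ℝ) ^ ε := by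
          refine Finset.prod_le_prod (fun _ _ => by norm_num) fun p hp => hP p ?_
          simp at hp
          omega
      _ = (∏ p ∈ n.primeFactors with ¬ p < P, (p : ℝ)) ^ ε := by
          rw [Real.finsetProd_rpow _ _ fun _ _ => Nat.cast_nonneg _]
      _ ≤ (n : ℝ) ^ ε := by
          gcongr
          have : ∏ p ∈ n.primeFactors with ¬ p < P, p ≤ n := by
            refine Nat.le_of_dvd (Nat.pos_of_ne_zero hn) ?_
            exact (Finset.prod_dvd_prod_of_subset _ _ _ (Finset.filter_subset _ _)).trans
              (Nat.prod_primeFactors_dvd n)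
          rw [← Nat.cast_prod]
          exact_mod_cast this

/-! ### The multiplicative weights behind the singular series -/

/-- The arithmetic function `k ↦ μ(k) / φ(k)` restricted to `k` coprime to `M`. -/
def coprimeMoebiusTotient (M : ℕ) : ArithmeticFunction ℝ :=
  ⟨fun k => if k.Coprime M then (ArithmeticFunction.moebius k : ℝ) / k.totient else 0, by simp⟩

lemma coprimeMoebiusTotient_apply (M k : ℕ) : coprimeMoebiusTotient M k =
    if k.Coprime M then (ArithmeticFunction.moebius k : ℝ) / k.totient else 0 := rfl

lemma coprimeMoebiusTotient_one (M : ℕ) : coprimeMoebiusTotient M 1 = 1 := by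
  simp [coprimeMoebiusTotient_apply]

lemma isMultiplicative_coprimeMoebiusTotient (M : ℕ) :
    (coprimeMoebiusTotient M).IsMultiplicative := by
  refine ⟨coprimeMoebiusTotient_one M, fun {m n} hmn => ?_⟩
  rw [coprimeMoebiusTotient_apply, coprimeMoebiusTotient_apply, coprimeMoebiusTotient_apply,
    ArithmeticFunction.isMultiplicative_moebius.map_mul_of_coprime hmn, Nat.totient_mul hmn]
  by_cases h1 : m.Coprime M
  · by_cases h2 : n.Coprime M
    · rw [if_pos (Nat.Coprime.mul_left h1 h2), if_pos h1, if_pos h2]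
      push_cast
      rw [mul_div_mul_comm]
    · rw [if_neg fun h => h2 (Nat.coprime_mul_iff_left.1 h).2, if_neg h2, mul_zero]
  · rw [if_neg fun h => h1 (Nat.coprime_mul_iff_left.1 h).1, if_neg h1, zero_mul]

lemma isMultiplicative_divId {f : ArithmeticFunction ℝ} (hf : f.IsMultiplicative) :
    f.divId.IsMultiplicative := by
  refine ⟨by simp [ArithmeticFunction.divId_apply, hf.1], fun {m n} hmn => ?_⟩
  simp only [ArithmeticFunction.divId_apply, hf.map_mul_of_coprime hmn, Nat.cast_mul]
  rw [mul_div_mul_comm]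

/-- The Dirichlet convolution of `1 / n` with `coprimeMoebiusTotient M`; its sum is the singular
series. -/
def singularWeight (M : ℕ) : ArithmeticFunction ℝ :=
  (ArithmeticFunction.zeta : ArithmeticFunction ℝ).divId * coprimeMoebiusTotient M

lemma isMultiplicative_singularWeight (M : ℕ) : (singularWeight M).IsMultiplicative :=
  (isMultiplicative_divId ArithmeticFunction.isMultiplicative_zeta.natCast).mul
    (isMultiplicative_coprimeMoebiusTotient M)

/-- `1 / n` and `μ(n) / n` are convolution inverses. This factorization reduces sums of `μ / φ` to
sums of `μ(k) / k`. -/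
lemma singularWeight_mul_divId_moebius (M : ℕ) :
    singularWeight M * realMoebius.divId = coprimeMoebiusTotient M := by
  have h : (ArithmeticFunction.zeta : ArithmeticFunction ℝ) * realMoebius = 1 :=
    ArithmeticFunction.coe_zeta_mul_coe_moebius
  have h1 : (1 : ArithmeticFunction ℝ).divId = 1 := by
    ext n
    rw [ArithmeticFunction.divId_apply]
    by_cases hn : n = 1
    · simp [hn]
    · simp [ArithmeticFunction.one_apply_ne hn]
  rw [singularWeight, mul_right_comm, ← ArithmeticFunction.divId_mul, h, h1, one_mul]

/-- Only the divisors 1 and `p` of `p ^ a` carry a nonzero Möbius value. For `p ∤ M` the two terms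
almost cancel, and the remaining factor `1 / (p - 1)` gives convergence. -/
lemma singularWeight_prime_pow (M : ℕ) {p : ℕ} (hp : p.Prime) {a : ℕ} (ha : a ≠ 0) :
    singularWeight M (p ^ a) =
      (if p ∣ M then 1 else -1 / ((p : ℝ) - 1)) * (1 / (p : ℝ)) ^ a := by
  have hp0 : (p : ℝ) ≠ 0 := by exact_mod_cast hp.ne_zero
  have hp1 : (p : ℝ) - 1 ≠ 0 := by
    have : (2 : ℝ) ≤ p := by exact_mod_cast hp.two_le
    linarith
  rw [singularWeight, ArithmeticFunction.mul_apply,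
    Nat.sum_divisorsAntidiagonal' (f := fun x y =>
      (ArithmeticFunction.zeta : ArithmeticFunction ℝ).divId x * coprimeMoebiusTotient M y),
    Nat.sum_divisors_prime_pow hp]
  have hsub : Finset.range 2 ⊆ Finset.range (a + 1) := Finset.range_mono (by omega)
  rw [← Finset.sum_subset hsub]
  · have hz : ∀ n : ℕ, n ≠ 0 →
        (ArithmeticFunction.zeta : ArithmeticFunction ℝ).divId n = 1 / n := by
      intro n hn
      simp [ArithmeticFunction.divId_apply, ArithmeticFunction.natCoe_apply, hn]
    have hdiv : p ^ a / p = p ^ (a - 1) := by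
      rw [Nat.div_eq_iff_eq_mul_left hp.pos (dvd_pow_self p ha), ← pow_succ]
      congr 1; omega
    have hpa : (p : ℝ) ^ a = p ^ (a - 1) * p := by rw [← pow_succ]; congr 1; omega
    rw [Finset.sum_range_succ, Finset.sum_range_one, pow_zero, pow_one, Nat.div_one, hdiv,
      hz _ (pow_ne_zero _ hp.ne_zero), hz _ (pow_ne_zero _ hp.ne_zero), coprimeMoebiusTotient_one,
      coprimeMoebiusTotient_apply, ArithmeticFunction.moebius_apply_prime hp, Nat.totient_prime hp,
      Nat.cast_sub hp.one_le]
    simp only [hp.coprime_iff_not_dvd]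
    push_cast
    by_cases h : p ∣ M
    · simp [h]
    · simp only [h, not_false_eq_true, if_true, if_false]
      rw [one_div_pow, hpa]
      field_simp
      ring
  · intro x _ hx2
    have hx : 2 ≤ x := by simp at hx2; omega
    have hm : ArithmeticFunction.moebius (p ^ x) = 0 := by
      rw [ArithmeticFunction.moebius_apply_prime_pow hp (by omega), if_neg (by omega)]
    rw [coprimeMoebiusTotient_apply, hm]
    simp

lemma abs_singularWeight_prime_pow_le (M : ℕ) {p : ℕ} (hp : p.Prime) (a : ℕ) :
    |singularWeight M (p ^ a)| ≤ (1 / (p : ℝ)) ^ a := by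
  have hp1 : (2 : ℝ) ≤ p := by exact_mod_cast hp.two_le
  rcases eq_or_ne a 0 with rfl | ha
  · simp [(isMultiplicative_singularWeight M).1]
  · rw [singularWeight_prime_pow M hp ha, abs_mul, abs_of_nonneg (by positivity : 0 ≤ (1 / (p : ℝ)) ^ a)]
    refine mul_le_of_le_one_left (by positivity) ?_
    split_ifs
    · simp
    · rw [abs_div, abs_neg, abs_one, abs_of_pos (by linarith), div_le_one (by linarith)]
      linarith

lemma abs_singularWeight_le (M : ℕ) {b : ℕ} (hb : b ≠ 0) : |singularWeight M b| ≤ 1 / b := by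
  rw [(isMultiplicative_singularWeight M).multiplicative_factorization _ hb, Finsupp.prod,
    Finset.abs_prod]
  calc _ ≤ ∏ p ∈ b.factorization.support, (1 / (p : ℝ)) ^ b.factorization p := by
        refine Finset.prod_le_prod (fun _ _ => abs_nonneg _) fun p hp => ?_
        exact abs_singularWeight_prime_pow_le M (Nat.prime_of_mem_primeFactors (by simpa using hp)) _
    _ = 1 / b := by
        simp_rw [one_div, inv_pow]
        rw [Finset.prod_inv_distrib]
        congr 1
        have := Nat.prod_factorization_pow_eq_self hb
        conv_rhs => rw [← this]
        rw [Finsupp.prod]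
        push_cast
        rfl

/-- Partial sums of a nonnegative multiplicative function are bounded by partial Euler products. -/
lemma sum_Ioc_le_prod_tsum {F : ℕ → ℝ} (hF : ∀ n, 0 ≤ F n) (h1 : F 1 = 1)
    (hmul : ∀ {m n : ℕ}, m.Coprime n → F (m * n) = F m * F n)
    (hsum : ∀ {p : ℕ}, p.Prime → Summable fun e : ℕ => F (p ^ e)) (n : ℕ) :
    ∑ b ∈ Finset.Ioc 0 n, F b ≤ ∏ p ∈ Finset.range (n + 1) with p.Prime, ∑' e : ℕ, F (p ^ e) := by
  obtain ⟨hs, hp⟩ := EulerProduct.summable_and_hasSum_factoredNumbers_prod_filter_prime_tsum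
    h1 hmul (fun {p} hp => by simpa [abs_of_nonneg (hF _)] using hsum hp) (Finset.range (n + 1))
  have hmem : ∀ b ∈ Finset.Ioc 0 n, b ∈ Nat.factoredNumbers (Finset.range (n + 1)) := by
    intro b hb
    rw [Finset.mem_Ioc] at hb
    refine ⟨by omega, fun p hp => ?_⟩
    have := Nat.le_of_mem_primeFactorsList hp
    simp
    omega
  have := sum_le_hasSum (Finset.subtype (· ∈ Nat.factoredNumbers (Finset.range (n + 1)))
    (Finset.Ioc 0 n)) (fun i _ => hF _) hp
  refine le_trans (le_of_eq ?_) this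
  symm
  exact Finset.sum_subtype_of_mem (f := F) hmem

lemma inv_pow_mul_sqrt_pow {p : ℕ} (hp : 0 < p) (e : ℕ) :
    (1 / (p : ℝ)) ^ e * √((p ^ e : ℕ) : ℝ) = (1 / √(p : ℝ)) ^ e := by
  have hp' : (0 : ℝ) < p := by exact_mod_cast hp
  have h0 : 0 < √(p : ℝ) := Real.sqrt_pos.2 hp'
  have h1 : √((p ^ e : ℕ) : ℝ) = √(p : ℝ) ^ e := by
    rw [← Real.sqrt_sq (by positivity : 0 ≤ √(p : ℝ) ^ e), ← pow_mul, mul_comm, pow_mul,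
      Real.sq_sqrt hp'.le]
    push_cast
    rfl
  rw [h1, ← mul_pow]
  congr 1
  field_simp
  rw [Real.sq_sqrt hp'.le]

/-- The ratio is largest at `p = 2`, where `1 / √2 ≤ 3 / 4`. Hence every geometric series is at most
4, which explains the base of `4 ^ ω(M)`. -/
lemma hasSum_sqrt_weight {p : ℕ} (hp : p.Prime) :
    HasSum (fun e : ℕ => (1 / √(p : ℝ)) ^ e) (1 - 1 / √(p : ℝ))⁻¹ ∧ 1 / √(p : ℝ) ≤ 3 / 4 := by
  have hp1 : (2 : ℝ) ≤ p := by exact_mod_cast hp.two_le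
  have h : 4 / 3 ≤ √(p : ℝ) := Real.le_sqrt_of_sq_le (by norm_num; linarith)
  have h2 : 1 / √(p : ℝ) ≤ 3 / 4 := by
    rw [div_le_div_iff₀ (by linarith) (by norm_num)]
    linarith
  exact ⟨hasSum_geometric_of_lt_one (by positivity) (by linarith), h2⟩

/-- `∑ |h(b)| √b` is bounded by a constant times `4 ^ ω(M)`. -/
lemma sum_abs_singularWeight_mul_sqrt_le : ∃ C : ℝ, 0 < C ∧ ∀ M : ℕ, M ≠ 0 → ∀ n : ℕ,
    ∑ b ∈ Finset.Ioc 0 n, |singularWeight M b| * √(b : ℝ) ≤ C * 4 ^ M.primeFactors.card := by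
  have hsum32 : Summable fun n : ℕ => 8 * (1 / (n : ℝ) ^ (3 / 2 : ℝ)) :=
    (Real.summable_one_div_nat_rpow.2 (by norm_num)).mul_left 8
  refine ⟨Real.exp (∑' n : ℕ, 8 * (1 / (n : ℝ) ^ (3 / 2 : ℝ))), Real.exp_pos _, fun M hM n => ?_⟩
  have hmult := isMultiplicative_singularWeight M
  have heq : ∀ {p : ℕ}, p.Prime → ∀ e : ℕ, |singularWeight M (p ^ e)| * √((p ^ e : ℕ) : ℝ) =
      if e = 0 then 1 else (if p ∣ M then 1 else 1 / ((p : ℝ) - 1)) * (1 / √(p : ℝ)) ^ e := by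
    intro p hp e
    have hp1 : (2 : ℝ) ≤ p := by exact_mod_cast hp.two_le
    split_ifs with he hpM
    · simp [he, hmult.1]
    · rw [singularWeight_prime_pow M hp he, if_pos hpM, one_mul, one_mul, abs_of_nonneg (by positivity)]
      exact inv_pow_mul_sqrt_pow hp.pos e
    · rw [singularWeight_prime_pow M hp he, if_neg hpM, abs_mul, abs_div, abs_neg, abs_one,
        abs_of_pos (by linarith : (0 : ℝ) < p - 1), abs_of_nonneg (by positivity), mul_assoc]
      congr 1
      exact inv_pow_mul_sqrt_pow hp.pos e
  have hle : ∀ {p : ℕ}, p.Prime → ∀ e : ℕ, |singularWeight M (p ^ e)| * √((p ^ e : ℕ) : ℝ) ≤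
      (1 / √(p : ℝ)) ^ e := by
    intro p hp e
    have hp1 : (2 : ℝ) ≤ p := by exact_mod_cast hp.two_le
    rw [heq hp]
    split_ifs with he hpM
    · simp [he]
    · simp
    · refine mul_le_of_le_one_left (by positivity) ?_
      rw [div_le_one (by linarith)]
      linarith
  have hsummable : ∀ {p : ℕ}, p.Prime →
      Summable fun e : ℕ => |singularWeight M (p ^ e)| * √((p ^ e : ℕ) : ℝ) := fun hp =>
    Summable.of_nonneg_of_le (fun _ => by positivity) (hle hp) (hasSum_sqrt_weight hp).1.summable
  -- A prime dividing `M` costs at most the factor 4. The others carry an extra `1 / (p - 1) ≤ 2 /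
  -- p`, so their local sum is at most `1 + 8 p ^ (-3 / 2)` and their product is bounded uniformly
  -- in `M`.
  have hlocal : ∀ {p : ℕ}, p.Prime →
      ∑' e : ℕ, |singularWeight M (p ^ e)| * √((p ^ e : ℕ) : ℝ) ≤
      (if p ∣ M then 4 else 1) * Real.exp (8 * (1 / (p : ℝ) ^ (3 / 2 : ℝ))) := by
    intro p hp
    have hp1 : (2 : ℝ) ≤ p := by exact_mod_cast hp.two_le
    obtain ⟨hgeo, hr⟩ := hasSum_sqrt_weight hp
    have hgeo4 : (1 - 1 / √(p : ℝ))⁻¹ ≤ 4 := by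
      rw [inv_le_comm₀ (by linarith) (by norm_num)]
      linarith
    split_ifs with hpM
    · calc _ ≤ ∑' e : ℕ, (1 / √(p : ℝ)) ^ e :=
            (hsummable hp).tsum_le_tsum (hle hp) hgeo.summable
        _ ≤ 4 := by rw [hgeo.tsum_eq]; exact hgeo4
        _ ≤ _ := by
            have : 1 ≤ Real.exp (8 * (1 / (p : ℝ) ^ (3 / 2 : ℝ))) := Real.one_le_exp (by positivity)
            linarith
    · rw [(hsummable hp).tsum_eq_zero_add]
      have h0 : |singularWeight M (p ^ 0)| * √((p ^ 0 : ℕ) : ℝ) = 1 := by simp [hmult.1]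
      have h1 : ∀ e : ℕ, |singularWeight M (p ^ (e + 1))| * √((p ^ (e + 1) : ℕ) : ℝ) =
          (1 / ((p : ℝ) - 1) * (1 / √(p : ℝ))) * (1 / √(p : ℝ)) ^ e := by
        intro e
        rw [heq hp, if_neg (by omega), if_neg hpM]
        ring
      simp_rw [h1]
      rw [h0, tsum_mul_left, hgeo.tsum_eq, one_mul]
      have h2 : (p : ℝ) ^ (3 / 2 : ℝ) = p * √(p : ℝ) := by
        rw [Real.sqrt_eq_rpow, show (3 / 2 : ℝ) = 1 + 1 / 2 by norm_num,
          Real.rpow_add (by linarith), Real.rpow_one]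
      rw [h2]
      have h3 : 1 / ((p : ℝ) - 1) ≤ 2 / p := by
        rw [div_le_div_iff₀ (by linarith) (by linarith)]
        linarith
      calc _ ≤ 1 + 2 / p * (1 / √(p : ℝ)) * 4 := by
            have : 0 ≤ (1 - 1 / √(p : ℝ))⁻¹ := inv_nonneg.2 (by linarith)
            gcongr
        _ = 8 * (1 / (p * √(p : ℝ))) + 1 := by
            have h0 : 0 < √(p : ℝ) := Real.sqrt_pos.2 (by linarith)
            field_simp
            ring
        _ ≤ _ := Real.add_one_le_exp _
  have hmain := sum_Ioc_le_prod_tsum (F := fun b => |singularWeight M b| * √(b : ℝ))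
    (fun _ => by positivity) (by simp [hmult.1])
    (fun {m n} hmn => by
      simp only [hmult.map_mul_of_coprime hmn, abs_mul, Nat.cast_mul]
      rw [Real.sqrt_mul (Nat.cast_nonneg _)]
      ring)
    (fun hp => hsummable hp) n
  refine hmain.trans ?_
  calc _ ≤ ∏ p ∈ Finset.range (n + 1) with p.Prime,
        ((if p ∣ M then 4 else 1) * Real.exp (8 * (1 / (p : ℝ) ^ (3 / 2 : ℝ)))) := by
        refine Finset.prod_le_prod (fun p _ => tsum_nonneg fun _ => by positivity) fun p hp => ?_
        exact hlocal (Finset.mem_filter.1 hp).2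
    _ = (∏ p ∈ Finset.range (n + 1) with p.Prime, (if p ∣ M then (4 : ℝ) else 1)) *
        Real.exp (∑ p ∈ Finset.range (n + 1) with p.Prime, 8 * (1 / (p : ℝ) ^ (3 / 2 : ℝ))) := by
        rw [Finset.prod_mul_distrib, Real.exp_sum]
    _ ≤ 4 ^ M.primeFactors.card * Real.exp (∑' n : ℕ, 8 * (1 / (n : ℝ) ^ (3 / 2 : ℝ))) := by
        gcongr
        · rw [← Finset.prod_filter, Finset.prod_const]
          refine pow_le_pow_right₀ (by norm_num) (Finset.card_le_card fun p hp => ?_)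
          simp only [Finset.mem_filter] at hp
          exact Nat.mem_primeFactors.2 ⟨hp.1.2, hp.2, hM⟩
        · exact hsum32.sum_le_tsum _ fun _ _ => by positivity
    _ = _ := mul_comm _ _

lemma summable_abs_singularWeight {M : ℕ} (hM : M ≠ 0) :
    Summable fun b => |singularWeight M b| := by
  obtain ⟨C, hC, h⟩ := sum_abs_singularWeight_mul_sqrt_le
  refine summable_of_sum_range_le (c := C * 4 ^ M.primeFactors.card) (fun _ => abs_nonneg _)
    fun n => ?_
  refine le_trans ?_ (h M hM n)
  calc ∑ b ∈ Finset.range n, |singularWeight M b|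
      ≤ ∑ b ∈ Finset.range (n + 1), |singularWeight M b| :=
        Finset.sum_le_sum_of_subset_of_nonneg (Finset.range_mono (by omega))
          fun _ _ _ => abs_nonneg _
    _ = ∑ b ∈ Finset.Ioc 0 n, |singularWeight M b| := by
        have h : Finset.range (n + 1) = insert 0 (Finset.Ioc 0 n) := by
          ext x; simp
        rw [h, Finset.sum_insert (by simp)]
        simp
    _ ≤ _ := by
        refine Finset.sum_le_sum fun b hb => ?_
        have : 1 ≤ √(b : ℝ) := by
          rw [Real.one_le_sqrt]
          exact_mod_cast (Finset.mem_Ioc.1 hb).1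
        exact le_mul_of_one_le_right (abs_nonneg _) this

lemma tsum_singularWeight_prime_pow {M p : ℕ} (hp : p.Prime) :
    ∑' e : ℕ, singularWeight M (p ^ e) =
      if p ∣ M then (p : ℝ) / (p - 1) else 1 - 1 / ((p : ℝ) - 1) ^ 2 := by
  have hp1 : (2 : ℝ) ≤ p := by exact_mod_cast hp.two_le
  have hp2 : (p : ℝ) - 1 ≠ 0 := by linarith
  have hgeo : HasSum (fun e : ℕ => (1 / (p : ℝ)) ^ e) (1 - 1 / (p : ℝ))⁻¹ :=
    hasSum_geometric_of_lt_one (by positivity) (by rw [div_lt_one] <;> linarith)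
  have hval : (1 - 1 / (p : ℝ))⁻¹ = p / (p - 1) := by field_simp
  have hs : Summable fun e : ℕ => singularWeight M (p ^ e) :=
    Summable.of_norm_bounded hgeo.summable fun e => abs_singularWeight_prime_pow_le M hp e
  rw [hs.tsum_eq_zero_add, pow_zero, (isMultiplicative_singularWeight M).1]
  have h1 : ∀ e : ℕ, singularWeight M (p ^ (e + 1)) =
      ((if p ∣ M then 1 else -1 / ((p : ℝ) - 1)) * (1 / (p : ℝ))) * (1 / (p : ℝ)) ^ e := by
    intro e
    rw [singularWeight_prime_pow M hp (by omega)]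
    ring
  simp_rw [h1]
  rw [tsum_mul_left, hgeo.tsum_eq, hval]
  split_ifs
  · field_simp
    ring
  · field_simp
    ring

lemma hasProd_singularWeight {M : ℕ} (hM : M ≠ 0) :
    HasProd (fun p : Nat.Primes => if (p : ℕ) ∣ M then (p : ℝ) / (p - 1)
      else 1 - 1 / ((p : ℝ) - 1) ^ 2) (∑' b, singularWeight M b) := by
  have hmult := isMultiplicative_singularWeight M
  have := EulerProduct.eulerProduct_hasProd (f := fun b => singularWeight M b) hmult.1
    (fun h => hmult.map_mul_of_coprime h) (summable_abs_singularWeight hM)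
    (by simp)
  have h2 : (fun p : Nat.Primes => ∑' e : ℕ, singularWeight M ((p : ℕ) ^ e)) = fun p : Nat.Primes =>
      if (p : ℕ) ∣ M then (p : ℝ) / (p - 1) else 1 - 1 / ((p : ℝ) - 1) ^ 2 :=
    funext fun p => tsum_singularWeight_prime_pow p.2
  rwa [h2] at this

/-! ### The singular series: Euler product and size -/

/-- The local factor of the twin prime constant. -/
def twinFactor (p : ℕ) : ℝ := if 2 < p then 1 - 1 / ((p : ℝ) - 1) ^ 2 else 1

lemma multipliable_twinFactor : Multipliable fun p : Nat.Primes => twinFactor p := by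
  have hs : Summable fun p : Nat.Primes =>
      (if 2 < (p : ℕ) then -(1 / ((p : ℝ) - 1) ^ 2) else 0 : ℝ) := by
    have h1 : Summable fun n : ℕ => 4 * (1 / (n : ℝ) ^ 2) :=
      (Real.summable_one_div_nat_pow.2 (by norm_num)).mul_left 4
    refine Summable.of_norm_bounded (h1.comp_injective Nat.Primes.coe_nat_injective) fun p => ?_
    have hp1 : (2 : ℝ) ≤ (p : ℕ) := by exact_mod_cast p.2.two_le
    simp only [Function.comp]
    split_ifs
    · rw [norm_neg, Real.norm_of_nonneg (by positivity), mul_one_div,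
        div_le_div_iff₀ (by have : (0 : ℝ) < (p : ℕ) - 1 := by linarith
                            positivity) (by positivity)]
      nlinarith
    · rw [norm_zero]
      positivity
  refine (Real.multipliable_one_add_of_summable hs).congr fun p => ?_
  rw [twinFactor]
  split_ifs <;> ring

lemma twinFactor_le_one {p : ℕ} : twinFactor p ≤ 1 := by
  rw [twinFactor]
  split_ifs
  · have : 0 ≤ 1 / ((p : ℝ) - 1) ^ 2 := by positivity
    linarith
  · exact le_rfl

lemma twinFactor_nonneg {p : ℕ} : 0 ≤ twinFactor p := by
  rw [twinFactor]
  split_ifs with h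
  · have h2 : (3 : ℝ) ≤ p := by exact_mod_cast h
    have : 1 / ((p : ℝ) - 1) ^ 2 ≤ 1 := by
      rw [div_le_one (by have : (0 : ℝ) < p - 1 := by linarith
                         positivity)]
      nlinarith
    linarith
  · norm_num

/-- Telescopes, since each factor is `m (m - 2) / (m - 1)²`. -/
lemma prod_Ico_one_sub_inv_sq {n : ℕ} (hn : 3 ≤ n) :
    ∏ m ∈ Finset.Ico 3 n, (1 - 1 / ((m : ℝ) - 1) ^ 2) = ((n : ℝ) - 1) / (2 * (n - 2)) := by
  induction n, hn using Nat.le_induction with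
  | base => norm_num
  | succ n hn ih =>
    rw [Finset.prod_Ico_succ_top hn, ih]
    have : (3 : ℝ) ≤ n := by exact_mod_cast hn
    have h1 : (n : ℝ) - 1 ≠ 0 := by linarith
    have h2 : (n : ℝ) - 2 ≠ 0 := by linarith
    push_cast
    have h3 : (n : ℝ) + 1 - 2 ≠ 0 := by linarith
    field_simp
    ring

/-- All factors lie in `[0, 1]`, so enlarging the product from odd primes to all integers in `[3,
n)` only decreases it, and that product is explicit. -/
lemma half_le_prod_twinFactor (s : Finset Nat.Primes) : 1 / 2 ≤ ∏ p ∈ s, twinFactor p := by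
  obtain ⟨n, hn3, hn⟩ : ∃ n : ℕ, 3 ≤ n ∧ ∀ p ∈ s, (p : ℕ) < n := by
    refine ⟨(s.image fun p : Nat.Primes => (p : ℕ)).sup id + 3, by omega, fun p hp => ?_⟩
    have : (p : ℕ) ≤ _ := Finset.le_sup (f := id)
      (Finset.mem_image_of_mem (fun p : Nat.Primes => (p : ℕ)) hp)
    omega
  have hn3' : (3 : ℝ) ≤ n := by exact_mod_cast hn3
  calc (1 : ℝ) / 2 ≤ ((n : ℝ) - 1) / (2 * (n - 2)) := by
        rw [div_le_div_iff₀ (by norm_num) (by linarith)]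
        linarith
    _ = ∏ m ∈ Finset.Ico 3 n, twinFactor m := by
        rw [← prod_Ico_one_sub_inv_sq hn3]
        refine Finset.prod_congr rfl fun m hm => ?_
        rw [twinFactor, if_pos (by simp at hm; omega)]
    _ ≤ ∏ m ∈ s.image (fun p : Nat.Primes => (p : ℕ)) with 2 < m, twinFactor m := by
        have hsub : {m ∈ s.image (fun p : Nat.Primes => (p : ℕ)) | 2 < m} ⊆ Finset.Ico 3 n := by
          intro m hm
          obtain ⟨h1, h2⟩ := Finset.mem_filter.1 hm
          obtain ⟨p, hp, rfl⟩ := Finset.mem_image.1 h1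
          exact Finset.mem_Ico.2 ⟨h2, hn p hp⟩
        rw [← Finset.prod_sdiff hsub]
        exact mul_le_of_le_one_left (Finset.prod_nonneg fun _ _ => twinFactor_nonneg)
          (Finset.prod_le_one (fun _ _ => twinFactor_nonneg) fun _ _ => twinFactor_le_one)
    _ = ∏ m ∈ s.image (fun p : Nat.Primes => (p : ℕ)), twinFactor m := by
        refine Finset.prod_filter_of_ne fun m _ hm => ?_
        by_contra h
        exact hm (by rw [twinFactor, if_neg h])
    _ = _ := Finset.prod_image fun a _ b _ h => Nat.Primes.coe_nat_injective h

lemma tprod_twinFactor_mem : (∏' p : Nat.Primes, twinFactor p) ∈ Set.Icc (1 / 2 : ℝ) 1 := by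
  have h := multipliable_twinFactor.hasProd
  constructor
  · exact ge_of_tendsto' h half_le_prod_twinFactor
  · exact le_of_tendsto' h fun s => Finset.prod_le_one (fun _ _ => twinFactor_nonneg)
      fun _ _ => twinFactor_le_one

lemma singularSeries_eq {M : ℕ} (hM : Even M) : singularSeries M =
    2 * (∏' p : Nat.Primes, twinFactor p) *
      ∏ p ∈ M.primeFactors with 2 < p, (1 + 1 / ((p : ℝ) - 2)) := by
  rw [singularSeries, if_pos hM]
  rfl

/-- The leading 2 compensates the bound `1 / 2` for the twin prime product. This uniform lower bound
makes every `o(N)` also `o(𝔖(N) N)`. -/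
lemma one_le_singularSeries {M : ℕ} (hM : Even M) : 1 ≤ singularSeries M := by
  rw [singularSeries_eq hM]
  have h1 := tprod_twinFactor_mem.1
  have h2 : 1 ≤ ∏ p ∈ M.primeFactors with 2 < p, (1 + 1 / ((p : ℝ) - 2)) := by
    refine Finset.one_le_prod fun p hp => ?_
    have hp3 : (2 : ℝ) < p := by exact_mod_cast (Finset.mem_filter.1 hp).2
    have : 0 ≤ 1 / ((p : ℝ) - 2) := div_nonneg zero_le_one (by linarith)
    linarith
  nlinarith

/-- `1 + 1 / (p - 2) = s / (s - 1)` with `s = p - 1`, and these `s` are distinct integers at least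
2, so the product is at most their number plus one. -/
lemma singularSeries_le {M : ℕ} (hM : Even M) (hM0 : M ≠ 0) :
    singularSeries M ≤ 2 * (1 + 2 * Real.log M) := by
  rw [singularSeries_eq hM]
  have h1 := tprod_twinFactor_mem
  have h2 : ∏ p ∈ M.primeFactors with 2 < p, (1 + 1 / ((p : ℝ) - 2)) ≤ 1 + 2 * Real.log M := by
    have hinj : Set.InjOn (fun p : ℕ => p - 1) ↑({p ∈ M.primeFactors | 2 < p}) := by
      intro a ha b hb hab
      simp at ha hb hab
      omega
    have h3 := prod_div_sub_one_le_card_add_one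
      (({p ∈ M.primeFactors | 2 < p}).image fun p => p - 1) (by
        intro s hs
        simp at hs
        obtain ⟨a, ha, rfl⟩ := hs
        omega)
    rw [Finset.prod_image hinj, Finset.card_image_of_injOn hinj] at h3
    have h4 : (({p ∈ M.primeFactors | 2 < p}).card : ℝ) ≤ M.primeFactors.card := by
      exact_mod_cast Finset.card_filter_le _ _
    have h5 := card_primeFactors_le_two_mul_log hM0
    refine le_trans (le_of_eq ?_) (h3.trans (by linarith))
    refine Finset.prod_congr rfl fun p hp => ?_
    have hp2 : 3 ≤ p := (Finset.mem_filter.1 hp).2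
    have hp3 : (3 : ℝ) ≤ p := by exact_mod_cast hp2
    rw [Nat.cast_sub (by omega)]
    push_cast
    have : (p : ℝ) - 2 ≠ 0 := by linarith
    have h6 : (p : ℝ) - 1 - 1 ≠ 0 := by linarith
    have h7 : (p : ℝ) - 1 - 1 = p - 2 := by ring
    rw [h7]
    field_simp
    ring
  have hl : 0 ≤ Real.log M := Real.log_natCast_nonneg M
  have h3 : 2 * (∏' p : Nat.Primes, twinFactor p) ≤ 2 := by linarith [h1.2]
  have h4 : 0 ≤ 2 * (∏' p : Nat.Primes, twinFactor p) := by linarith [h1.1]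
  nlinarith

/-- The singular series as the sum of its weights. -/
theorem tsum_singularWeight_eq {M : ℕ} (hM : Even M) (hM0 : M ≠ 0) :
    ∑' b, singularWeight M b = singularSeries M := by
  -- `v` corrects the twin prime factors at the primes dividing `M`. At `p = 2` the twin factor is 1
  -- by convention and the true local factor is `p / (p - 1) = 2`, because `M` is even.
  set v : ℕ → ℝ := fun p => if p ∣ M then (if 2 < p then 1 + 1 / ((p : ℝ) - 2) else 2) else 1
    with hv
  set S : Finset Nat.Primes := M.primeFactors.subtype Nat.Prime with hS
  have hvS : HasProd (fun p : Nat.Primes => v p) (∏ p ∈ S, v p) := by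
    refine hasProd_prod_of_ne_finset_one fun p hp => ?_
    have : ¬ (p : ℕ) ∣ M := fun h => hp (by
      refine Finset.mem_subtype.2 ?_
      exact Nat.mem_primeFactors.2 ⟨p.2, h, hM0⟩)
    simp [hv, this]
  have hprod := multipliable_twinFactor.hasProd.mul hvS
  have hloc : (fun p : Nat.Primes => twinFactor p * v p) = fun p : Nat.Primes =>
      if (p : ℕ) ∣ M then (p : ℝ) / (p - 1) else 1 - 1 / ((p : ℝ) - 1) ^ 2 := by
    funext p
    have hp1 : 2 ≤ (p : ℕ) := p.2.two_le
    have hp2 : (2 : ℝ) ≤ (p : ℕ) := by exact_mod_cast hp1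
    have hne : ((p : ℕ) : ℝ) - 1 ≠ 0 := by linarith
    by_cases h2 : 2 < (p : ℕ)
    · have hp3 : (3 : ℝ) ≤ (p : ℕ) := by exact_mod_cast h2
      have hne2 : ((p : ℕ) : ℝ) - 2 ≠ 0 := by linarith
      by_cases hpM : (p : ℕ) ∣ M
      · simp only [hv, twinFactor, h2, hpM, if_true]
        field_simp
        ring
      · simp [hv, twinFactor, h2, hpM]
    · have hp : (p : ℕ) = 2 := by omega
      have : (2 : ℕ) ∣ M := hM.two_dvd
      simp only [hv, twinFactor, hp, this]
      norm_num
  have huniq := (hloc ▸ hprod).unique (hasProd_singularWeight hM0)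
  rw [← huniq, singularSeries_eq hM]
  have hSprod : ∏ p ∈ S, v p = ∏ p ∈ M.primeFactors, v p := by
    rw [hS]
    exact Finset.prod_subtype_of_mem v fun p hp => Nat.prime_of_mem_primeFactors hp
  have hsplit : ∏ p ∈ M.primeFactors, v p =
      (∏ p ∈ M.primeFactors with 2 < p, (1 + 1 / ((p : ℝ) - 2))) * 2 := by
    rw [← Finset.prod_filter_mul_prod_filter_not M.primeFactors (fun p => 2 < p)]
    congr 1
    · refine Finset.prod_congr rfl fun p hp => ?_
      rw [Finset.mem_filter] at hp
      simp [hv, Nat.dvd_of_mem_primeFactors hp.1, hp.2]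
    · have : ({p ∈ M.primeFactors | ¬ 2 < p}) = {2} := by
        ext p
        simp only [Finset.mem_filter, Finset.mem_singleton]
        constructor
        · rintro ⟨h1, h2⟩
          have := (Nat.prime_of_mem_primeFactors h1).two_le
          omega
        · rintro rfl
          exact ⟨Nat.mem_primeFactors.2 ⟨Nat.prime_two, hM.two_dvd, hM0⟩, by omega⟩
      rw [this, Finset.prod_singleton]
      simp [hv, hM.two_dvd]
  rw [hSprod, hsplit]
  ring

/-! ### The density of squarefree shifts -/

/-- The function `e ↦ μ(e) / φ(e²)` restricted to `e` coprime to `N`. -/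
def artinWeight (N e : ℕ) : ℝ :=
  if e.Coprime N then (ArithmeticFunction.moebius e : ℝ) / (e ^ 2).totient else 0

lemma abs_artinWeight_le (N e : ℕ) : |artinWeight N e| ≤ 1 / ((e ^ 2).totient : ℝ) := by
  rw [artinWeight]
  split_ifs
  · rw [abs_div, Nat.abs_cast]
    gcongr
    exact abs_moebius_real_le e
  · simp

lemma summable_abs_artinWeight (N : ℕ) : Summable fun e => |artinWeight N e| :=
  Summable.of_nonneg_of_le (fun _ => abs_nonneg _) (abs_artinWeight_le N) summable_inv_totient_sq

lemma artinWeight_mul (N : ℕ) {m n : ℕ} (hmn : m.Coprime n) :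
    artinWeight N (m * n) = artinWeight N m * artinWeight N n := by
  rw [artinWeight, artinWeight, artinWeight,
    ArithmeticFunction.isMultiplicative_moebius.map_mul_of_coprime hmn, mul_pow,
    Nat.totient_mul (hmn.pow 2 2)]
  by_cases h1 : m.Coprime N
  · by_cases h2 : n.Coprime N
    · rw [if_pos (Nat.Coprime.mul_left h1 h2), if_pos h1, if_pos h2]
      push_cast
      rw [mul_div_mul_comm]
    · rw [if_neg fun h => h2 (Nat.coprime_mul_iff_left.1 h).2, if_neg h2, mul_zero]
  · rw [if_neg fun h => h1 (Nat.coprime_mul_iff_left.1 h).1, if_neg h1, zero_mul]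

/-- `𝒜(N)` as the density of the squarefree numbers in its Dirichlet series form. -/
theorem tsum_artinWeight_eq {N : ℕ} (hN : Even N) :
    ∑' e, artinWeight N e = artinFactor N := by
  have hprod := EulerProduct.eulerProduct_hasProd (f := artinWeight N) (by simp [artinWeight])
    (fun h => artinWeight_mul N h) (summable_abs_artinWeight N) (by simp [artinWeight])
  rw [artinFactor, ← hprod.tprod_eq]
  congr 1
  funext p
  have hp := p.2
  have hp2 : (2 : ℝ) ≤ (p : ℕ) := by exact_mod_cast hp.two_le
  have hz : ∀ e ∉ Finset.range 2, artinWeight N ((p : ℕ) ^ e) = 0 := by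
    intro e he
    have he' : 2 ≤ e := by simp at he; omega
    have hm : ArithmeticFunction.moebius ((p : ℕ) ^ e) = 0 := by
      rw [ArithmeticFunction.moebius_apply_prime_pow hp (by omega), if_neg (by omega)]
    rw [artinWeight, hm]
    simp
  rw [tsum_eq_sum hz, Finset.sum_range_succ, Finset.sum_range_one, pow_zero, pow_one]
  have h1 : artinWeight N 1 = 1 := by simp [artinWeight]
  rw [h1, artinWeight, ArithmeticFunction.moebius_apply_prime hp, totient_sq,
    Nat.totient_prime hp]
  by_cases hpN : (p : ℕ) ∣ N
  · rw [if_neg fun h => (hp.coprime_iff_not_dvd.1 h) hpN, if_neg fun h => h.2 hpN, add_zero]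
  · have h2 : 2 < (p : ℕ) := by
      rcases hp.two_le.lt_or_eq with h | h
      · exact h
      · exact absurd (h ▸ hN.two_dvd) hpN
    rw [if_pos (hp.coprime_iff_not_dvd.2 hpN), if_pos ⟨h2, hpN⟩]
    push_cast [Nat.cast_sub hp.one_le]
    ring

lemma abs_tsum_sub_sum_le {f : ℕ → ℝ} (hf : Summable f) (h0 : f 0 = 0) {E : ℕ} {B : ℝ}
    (hB : ∀ M : ℕ, ∑ e ∈ Finset.Ioc E M, |f e| ≤ B) :
    |∑' e, f e - ∑ e ∈ Finset.Ioc 0 E, f e| ≤ B := by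
  have h1 : Tendsto (fun M : ℕ => |∑ e ∈ Finset.Ioc 0 M, f e - ∑ e ∈ Finset.Ioc 0 E, f e|) atTop
      (𝓝 |∑' e, f e - ∑ e ∈ Finset.Ioc 0 E, f e|) := by
    refine (Tendsto.sub_const ?_ _).abs
    refine ((tendsto_add_atTop_iff_nat 1).2 hf.hasSum.tendsto_sum_nat).congr fun M => ?_
    have h : Finset.range (M + 1) = insert 0 (Finset.Ioc 0 M) := by
      ext x; simp
    rw [h, Finset.sum_insert (by simp), h0, zero_add]
  refine le_of_tendsto h1 ?_
  filter_upwards [eventually_ge_atTop E] with M hM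
  rw [← Finset.sum_Ioc_consecutive f (Nat.zero_le E) hM, add_sub_cancel_left]
  exact (Finset.abs_sum_le_sum_abs _ _).trans (hB M)

lemma abs_artinFactor_sub_sum_le {N : ℕ} (hN : Even N) {E : ℕ} (hE : 1 ≤ E) :
    |artinFactor N - ∑ e ∈ Finset.Ioc 0 E, artinWeight N e| ≤ (5 + 2 * Real.log E) / E := by
  rw [← tsum_artinWeight_eq hN]
  refine abs_tsum_sub_sum_le (summable_abs_artinWeight N).of_abs (by simp [artinWeight]) fun M => ?_
  exact (Finset.sum_le_sum fun e _ => abs_artinWeight_le N e).trans (sum_inv_totient_sq_le hE)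

/-! ### Convergence of the coprime logarithmic sums to the singular series -/

/-- `∑_{k ≤ x, (k, M) = 1} μ(k) / φ(k) * log (x / k)`. -/
def coprimeLogSum (M : ℕ) (x : ℝ) : ℝ :=
  ∑ k ∈ Finset.Ioc 0 ⌊x⌋₊, coprimeMoebiusTotient M k * Real.log (x / k)

lemma sum_Ioc_mul_mul_eq_sum_sum (f g : ArithmeticFunction ℝ) (w : ℕ → ℝ) (N : ℕ) :
    ∑ n ∈ Finset.Ioc 0 N, (f * g) n * w n =
      ∑ b ∈ Finset.Ioc 0 N, ∑ k ∈ Finset.Ioc 0 (N / b), f b * g k * w (b * k) := by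
  have h1 : ∀ n ∈ Finset.Ioc 0 N, (f * g) n * w n =
      ∑ x ∈ Finset.Ioc 0 N ×ˢ Finset.Ioc 0 N with x.1 * x.2 = n, f x.1 * g x.2 * w (x.1 * x.2) := by
    intro n hn
    simp only [Finset.mem_Ioc] at hn
    rw [ArithmeticFunction.mul_apply, Nat.divisorsAntidiagonal_eq_prod_filter_of_le hn.1.ne' hn.2,
      Finset.sum_mul]
    refine Finset.sum_congr rfl fun x hx => ?_
    rw [(Finset.mem_filter.1 hx).2]
  rw [Finset.sum_congr rfl h1]
  simp_rw [Finset.sum_filter]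
  rw [Finset.sum_comm, Finset.sum_product]
  refine Finset.sum_congr rfl fun b hb => ?_
  rw [Finset.mem_Ioc] at hb
  simp_rw [Finset.sum_ite_eq]
  rw [← Finset.sum_filter]
  refine Finset.sum_congr ?_ fun _ _ => rfl
  ext k
  simp only [Finset.mem_filter, Finset.mem_Ioc]
  rw [Nat.le_div_iff_mul_le hb.1, mul_comm k b]
  constructor
  · rintro ⟨⟨h1, _⟩, h3, h4⟩
    exact ⟨h1, h4⟩
  · rintro ⟨h1, h2⟩
    exact ⟨⟨h1, (Nat.le_mul_of_pos_left k hb.1).trans h2⟩, Nat.mul_pos hb.1 h1, h2⟩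

/-- Regrouping along `μ / φ = h * (μ / id)`. Each inner sum tends to 1, so the limit is `∑ h(b)`. -/
lemma coprimeLogSum_eq (M : ℕ) (x : ℝ) :
    coprimeLogSum M x = ∑ b ∈ Finset.Ioc 0 ⌊x⌋₊, singularWeight M b * moebiusLogSum (x / b) := by
  rw [coprimeLogSum, ← singularWeight_mul_divId_moebius]
  rw [sum_Ioc_mul_mul_eq_sum_sum (w := fun k : ℕ => Real.log (x / k))]
  refine Finset.sum_congr rfl fun b _ => ?_
  rw [moebiusLogSum, Nat.floor_div_natCast, Finset.mul_sum]
  refine Finset.sum_congr rfl fun k _ => ?_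
  push_cast
  rw [div_div, mul_assoc]

/-- Convergence of `coprimeLogSum` to the singular series, uniformly in the modulus. -/
theorem coprimeLogSum_sub_tsum_bound (h : PsiLogPowError) (n : ℕ) : ∃ C : ℝ, 0 ≤ C ∧
    ∀ M : ℕ, M ≠ 0 → ∀ x : ℝ, 0 < x → 2 ≤ Real.log x →
      |coprimeLogSum M x - ∑' b, singularWeight M b| ≤
        C / Real.log x ^ n +
          C * 4 ^ M.primeFactors.card * (1 + Real.log x) ^ 2 / x ^ (1 / 4 : ℝ) := by
  -- One power more than required: summing `|h(b)| ≤ 1 / b` over `b ≤ √x` costs a logarithm.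
  obtain ⟨C1, hC1, hB⟩ := moebiusLogSum_sub_one_bound h (n + 1)
  obtain ⟨C2, hC2, hw⟩ := sum_abs_singularWeight_mul_sqrt_le
  refine ⟨C1 * 2 ^ (n + 1) * 2 + 2 * C2, by positivity, fun M hM x hx0 hx => ?_⟩
  have hx1 : 1 ≤ x := by
    by_contra! hlt
    linarith [Real.log_nonpos hx0.le hlt.le]
  set l := Real.log x with hl
  have hl0 : 0 < l := by linarith
  set Y := ⌊√x⌋₊ with hY
  have hsq1 : 1 ≤ √x := Real.one_le_sqrt.2 hx1
  have hsqx : √x ≤ x := by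
    rw [Real.sqrt_le_left hx0.le]
    nlinarith
  have hYx : Y ≤ ⌊x⌋₊ := Nat.floor_mono hsqx
  have hq : 0 < x ^ (1 / 4 : ℝ) := Real.rpow_pos_of_pos hx0 _
  set T := C2 * 4 ^ M.primeFactors.card / x ^ (1 / 4 : ℝ) with hT
  have hT0 : 0 ≤ T := by positivity
  -- For `b > √x` the weight `√b` exceeds `x ^ (1 / 4)`, so the bound for `∑ |h(b)| √b` turns into a
  -- power saving.
  have htail : ∀ K : ℕ, ∑ b ∈ Finset.Ioc Y K, |singularWeight M b| ≤ T := by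
    intro K
    rw [hT, le_div_iff₀ hq, Finset.sum_mul]
    refine le_trans ?_ (hw M hM K)
    calc _ ≤ ∑ b ∈ Finset.Ioc Y K, |singularWeight M b| * √(b : ℝ) := by
          refine Finset.sum_le_sum fun b hb => ?_
          have hb' : √x < b := (Nat.floor_lt (Real.sqrt_nonneg _)).1 (Finset.mem_Ioc.1 hb).1
          gcongr
          have h4 : x ^ (1 / 4 : ℝ) = √(√x) := by
            rw [Real.sqrt_eq_rpow, Real.sqrt_eq_rpow, ← Real.rpow_mul hx0.le]
            norm_num
          rw [h4]
          exact Real.sqrt_le_sqrt hb'.le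
      _ ≤ _ := Finset.sum_le_sum_of_subset_of_nonneg
          (Finset.Ioc_subset_Ioc_left (Nat.zero_le _)) fun _ _ _ => by positivity
  have hts := abs_tsum_sub_sum_le (summable_abs_singularWeight hM).of_abs (by simp) htail
  have hmain : |∑ b ∈ Finset.Ioc 0 Y, singularWeight M b * (moebiusLogSum (x / b) - 1)| ≤
      C1 * 2 ^ (n + 1) * 2 / l ^ n := by
    calc _ ≤ ∑ b ∈ Finset.Ioc 0 Y, |singularWeight M b * (moebiusLogSum (x / b) - 1)| :=
          Finset.abs_sum_le_sum_abs _ _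
      _ ≤ ∑ b ∈ Finset.Ioc 0 Y, (1 : ℝ) / b * (C1 / (l / 2) ^ (n + 1)) := by
          refine Finset.sum_le_sum fun b hb => ?_
          rw [Finset.mem_Ioc] at hb
          have hb0 : (0 : ℝ) < b := by exact_mod_cast hb.1
          have hbx : (b : ℝ) ≤ √x := (Nat.le_floor_iff (by positivity)).1 hb.2
          have hlog : l / 2 ≤ Real.log (x / b) := by
            have : √x ≤ x / b := by
              rw [le_div_iff₀ hb0]
              nlinarith [Real.mul_self_sqrt hx0.le]
            have := Real.log_le_log (by positivity) this
            rwa [Real.log_sqrt hx0.le] at this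
          rw [abs_mul]
          refine mul_le_mul (abs_singularWeight_le M (by omega)) ?_ (abs_nonneg _) (by positivity)
          refine (hB (x / b) (by positivity) (by linarith)).trans ?_
          gcongr
      _ = (∑ b ∈ Finset.Ioc 0 Y, (1 : ℝ) / b) * (C1 / (l / 2) ^ (n + 1)) := by
          rw [Finset.sum_mul]
      _ ≤ (2 * l) * (C1 / (l / 2) ^ (n + 1)) := by
          gcongr
          refine (sum_Ioc_inv_le Y).trans ?_
          have : Real.log Y ≤ l := by
            rcases Nat.eq_zero_or_pos Y with h | h
            · rw [h]; simp [hl0.le]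
            · refine Real.log_le_log (by exact_mod_cast h) ?_
              exact (Nat.floor_le (by positivity)).trans hsqx
          linarith
      _ = _ := by
          rw [div_pow, pow_succ l n]
          field_simp
  have hrest : |∑ b ∈ Finset.Ioc Y ⌊x⌋₊, singularWeight M b * moebiusLogSum (x / b)| ≤
      T * ((1 + l) * l) := by
    calc _ ≤ ∑ b ∈ Finset.Ioc Y ⌊x⌋₊, |singularWeight M b * moebiusLogSum (x / b)| :=
          Finset.abs_sum_le_sum_abs _ _
      _ ≤ ∑ b ∈ Finset.Ioc Y ⌊x⌋₊, |singularWeight M b| * ((1 + l) * l) := by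
          refine Finset.sum_le_sum fun b hb => ?_
          rw [Finset.mem_Ioc] at hb
          have hb1 : (1 : ℝ) ≤ b := by exact_mod_cast (by omega : 1 ≤ b)
          have hbx : (b : ℝ) ≤ x := (Nat.le_floor_iff hx0.le).1 hb.2
          have h1 : 1 ≤ x / b := (one_le_div (by linarith)).2 hbx
          have h2 : Real.log (x / b) ≤ l :=
            Real.log_le_log (by linarith) (div_le_self hx0.le hb1)
          have h3 := Real.log_nonneg h1
          rw [abs_mul]
          gcongr
          refine (abs_moebiusLogSum_le h1).trans ?_
          gcongr
      _ = (∑ b ∈ Finset.Ioc Y ⌊x⌋₊, |singularWeight M b|) * ((1 + l) * l) := by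
          rw [Finset.sum_mul]
      _ ≤ _ := by
          gcongr
          exact htail _
  have hid : coprimeLogSum M x - ∑' b, singularWeight M b =
      ∑ b ∈ Finset.Ioc 0 Y, singularWeight M b * (moebiusLogSum (x / b) - 1) +
      ∑ b ∈ Finset.Ioc Y ⌊x⌋₊, singularWeight M b * moebiusLogSum (x / b) -
      (∑' b, singularWeight M b - ∑ b ∈ Finset.Ioc 0 Y, singularWeight M b) := by
    rw [coprimeLogSum_eq, ← Finset.sum_Ioc_consecutive _ (Nat.zero_le Y) hYx]
    simp_rw [mul_sub, Finset.sum_sub_distrib, mul_one]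
    ring
  rw [hid]
  calc _ ≤ C1 * 2 ^ (n + 1) * 2 / l ^ n + T * ((1 + l) * l) + T := by
        refine (abs_sub _ _).trans (add_le_add ((abs_add_le _ _).trans (add_le_add hmain hrest)) hts)
    _ ≤ C1 * 2 ^ (n + 1) * 2 / l ^ n + T * (2 * (1 + l) ^ 2) := by
        have : T * ((1 + l) * l) + T ≤ T * (2 * (1 + l) ^ 2) := by
          rw [← mul_add_one]
          gcongr
          nlinarith
        linarith
    _ = C1 * 2 ^ (n + 1) * 2 / l ^ n +
        2 * C2 * 4 ^ M.primeFactors.card * (1 + l) ^ 2 / x ^ (1 / 4 : ℝ) := by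
        rw [hT]; ring
    _ ≤ _ := by
        have h1 : 0 ≤ C1 * 2 ^ (n + 1) * 2 := by positivity
        gcongr <;> linarith

lemma one_add_log_pow_le (n : ℕ) {δ : ℝ} (hδ : 0 < δ) :
    ∃ C : ℝ, 0 < C ∧ ∀ x : ℝ, 1 ≤ x → (1 + Real.log x) ^ n ≤ C * x ^ δ := by
  have hε : 0 < δ / (n + 1) := by positivity
  set ε := δ / (n + 1) with hεdef
  refine ⟨(1 + 1 / ε) ^ n, by positivity, fun x hx => ?_⟩
  have h1 := Real.log_le_rpow_div (by linarith : 0 ≤ x) hε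
  have h2 : 1 ≤ x ^ ε := Real.one_le_rpow hx hε.le
  have h3 : 1 + Real.log x ≤ (1 + 1 / ε) * x ^ ε := by
    have : (1 + 1 / ε) * x ^ ε = x ^ ε + x ^ ε / ε := by ring
    linarith
  have h0 := Real.log_nonneg hx
  calc (1 + Real.log x) ^ n ≤ ((1 + 1 / ε) * x ^ ε) ^ n := by gcongr
    _ = (1 + 1 / ε) ^ n * x ^ (ε * n) := by
        rw [mul_pow, ← Real.rpow_mul_natCast (by linarith)]
    _ ≤ _ := by
        gcongr
        rw [hεdef, div_mul_eq_mul_div, div_le_iff₀ (by positivity)]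
        nlinarith

/-- A power saving beats any power of the logarithm. -/
lemma rpow_mul_log_pow_le (n j : ℕ) {a : ℝ} (ha : a < 1) :
    ∃ C : ℝ, 0 < C ∧ ∀ N : ℝ, 2 ≤ N →
      N ^ a * (1 + Real.log N) ^ n ≤ C * (N / Real.log N ^ j) := by
  obtain ⟨C, hC, h⟩ := one_add_log_pow_le (n + j) (δ := 1 - a) (by linarith)
  refine ⟨C, hC, fun N hN => ?_⟩
  have hl : 0 < Real.log N := Real.log_pos (by linarith)
  have hN0 : 0 < N := by linarith
  rw [← mul_div_assoc, le_div_iff₀ (by positivity)]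
  have h1 : N ^ a * N ^ (1 - a) = N := by
    rw [← Real.rpow_add hN0]; simp
  calc N ^ a * (1 + Real.log N) ^ n * Real.log N ^ j
      ≤ N ^ a * (1 + Real.log N) ^ n * (1 + Real.log N) ^ j := by
        gcongr
        linarith
    _ = N ^ a * (1 + Real.log N) ^ (n + j) := by ring
    _ ≤ N ^ a * (C * N ^ (1 - a)) := by
        gcongr
        exact h N (by linarith)
    _ = C * N := by rw [mul_left_comm, h1]

/-- Uniformity in `M` is what matters, since it is applied to `M = eN ≤ N²`. Both `4 ^ ω(M)` and the
logarithmic factors are `O(N ^ (c / 8))`, and together they are absorbed by `x ^ (1 / 4) ≥ N ^ (c /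
4)`. -/
theorem coprimeLogSum_sub_singularSeries_bound (h : PsiLogPowError) (n : ℕ) {c : ℝ} (hc : 0 < c) :
    ∃ C : ℝ, 0 ≤ C ∧ ∀ N : ℕ, 2 ≤ N → 2 ≤ c * Real.log N → ∀ M : ℕ, M ≠ 0 → Even M → M ≤ N ^ 2 →
      ∀ x : ℝ, (N : ℝ) ^ c ≤ x → x ≤ N →
      |coprimeLogSum M x - singularSeries M| ≤ C / Real.log N ^ n := by
  obtain ⟨C1, hC1, h1⟩ := coprimeLogSum_sub_tsum_bound h n
  obtain ⟨C2, hC2, h2⟩ := four_pow_card_primeFactors_le (ε := c / 16) (by positivity)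
  obtain ⟨C3, hC3, h3⟩ := one_add_log_pow_le (n + 2) (δ := c / 8) (by positivity)
  refine ⟨C1 / c ^ n + C1 * C2 * C3, by positivity, fun N hN hcN M hM0 hM hMN x hx hxN => ?_⟩
  have hN2 : (2 : ℝ) ≤ N := by exact_mod_cast hN
  have hN0 : (0 : ℝ) < N := by linarith
  have hl : 0 < Real.log N := Real.log_pos (by linarith)
  have hNc : 0 < (N : ℝ) ^ c := Real.rpow_pos_of_pos hN0 _
  have hx0 : 0 < x := hNc.trans_le hx
  have hlx : c * Real.log N ≤ Real.log x := by
    rw [← Real.log_rpow hN0]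
    exact Real.log_le_log hNc hx
  have hlx' : Real.log x ≤ Real.log N := Real.log_le_log hx0 hxN
  have hmain := h1 M hM0 x hx0 (by linarith)
  rw [tsum_singularWeight_eq hM hM0] at hmain
  refine hmain.trans ?_
  have e1 : C1 / Real.log x ^ n ≤ C1 / c ^ n / Real.log N ^ n := by
    rw [div_div, ← mul_pow]
    gcongr
  have e2 : C1 * 4 ^ M.primeFactors.card * (1 + Real.log x) ^ 2 / x ^ (1 / 4 : ℝ) ≤
      C1 * C2 * C3 / Real.log N ^ n := by
    have hM' : (M : ℝ) ^ (c / 16) ≤ (N : ℝ) ^ (c / 8) := by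
      calc (M : ℝ) ^ (c / 16) ≤ ((N : ℝ) ^ 2) ^ (c / 16) := by
            gcongr
            exact_mod_cast hMN
        _ = _ := by
            rw [← Real.rpow_natCast_mul hN0.le]
            congr 1
            push_cast
            ring
    have hxq : (N : ℝ) ^ (c / 4) ≤ x ^ (1 / 4 : ℝ) := by
      calc (N : ℝ) ^ (c / 4) = ((N : ℝ) ^ c) ^ (1 / 4 : ℝ) := by
            rw [← Real.rpow_mul hN0.le]
            congr 1
            ring
        _ ≤ _ := by gcongr
    have hsplit : (N : ℝ) ^ (c / 8) * (N : ℝ) ^ (c / 8) = (N : ℝ) ^ (c / 4) := by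
      rw [← Real.rpow_add hN0]
      congr 1
      ring
    have hN8 : 0 < (N : ℝ) ^ (c / 8) := Real.rpow_pos_of_pos hN0 _
    have hlogx0 : 0 ≤ Real.log x := by linarith
    rw [div_le_div_iff₀ (by positivity) (by positivity)]
    calc C1 * 4 ^ M.primeFactors.card * (1 + Real.log x) ^ 2 * Real.log N ^ n
        ≤ C1 * (C2 * (N : ℝ) ^ (c / 8)) * (1 + Real.log N) ^ 2 * (1 + Real.log N) ^ n := by
          gcongr
          · exact (h2 M hM0).trans (by gcongr)
          · linarith
      _ = C1 * (C2 * (N : ℝ) ^ (c / 8)) * (1 + Real.log N) ^ (n + 2) := by ring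
      _ ≤ C1 * (C2 * (N : ℝ) ^ (c / 8)) * (C3 * (N : ℝ) ^ (c / 8)) := by
          gcongr
          exact h3 N (by linarith)
      _ = C1 * C2 * C3 * (N : ℝ) ^ (c / 4) := by rw [← hsplit]; ring
      _ ≤ _ := by gcongr
  calc _ ≤ C1 / c ^ n / Real.log N ^ n + C1 * C2 * C3 / Real.log N ^ n := add_le_add e1 e2
    _ = _ := by ring

/-! ### Consequences of the Elliott-Halberstam hypotheses -/

open ArithmeticFunction in
/-- The prime powers up to `N` that are not coprime to `N` contribute little to `ψ(N)`. -/
lemma sum_vonMangoldt_not_coprime_le {N : ℕ} (hN : N ≠ 0) :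
    ∑ n ∈ Finset.Ico 1 N with ¬ n.Coprime N, vonMangoldt n ≤ 2 * Real.log N ^ 2 := by
  have hl : 0 ≤ Real.log N := Real.log_natCast_nonneg N
  set S : Finset ℕ := {n ∈ Finset.Ico 1 N | ¬ n.Coprime N ∧ IsPrimePow n} with hS
  have h1 : ∑ n ∈ Finset.Ico 1 N with ¬ n.Coprime N, vonMangoldt n = ∑ n ∈ S, vonMangoldt n := by
    rw [hS, ← Finset.filter_filter]
    refine (Finset.sum_filter_of_ne fun n _ hn => ?_).symm
    exact vonMangoldt_ne_zero_iff.1 hn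
  have hform : ∀ n ∈ S, ∃ p ∈ N.primeFactors, ∃ k ∈ Finset.Icc 1 (Nat.log p N), p ^ k = n := by
    intro n hn
    rw [hS, Finset.mem_filter, Finset.mem_Ico] at hn
    obtain ⟨⟨hn1, hnN⟩, hcop, hpp⟩ := hn
    obtain ⟨p, k, hp, hk, rfl⟩ := (isPrimePow_nat_iff _).1 hpp
    refine ⟨p, ?_, k, ?_, rfl⟩
    · refine Nat.mem_primeFactors.2 ⟨hp, ?_, hN⟩
      by_contra hdvd
      exact hcop (((Nat.Prime.coprime_iff_not_dvd hp).2 hdvd).pow_left k)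
    · exact Finset.mem_Icc.2 ⟨hk, Nat.le_log_of_pow_le hp.one_lt hnN.le⟩
  have hsub : S ⊆ N.primeFactors.biUnion fun p => (Finset.Icc 1 (Nat.log p N)).image (p ^ ·) := by
    intro n hn
    obtain ⟨p, hp, k, hk, h⟩ := hform n hn
    exact Finset.mem_biUnion.2 ⟨p, hp, Finset.mem_image.2 ⟨k, hk, h⟩⟩
  rw [h1]
  calc ∑ n ∈ S, vonMangoldt n ≤ ∑ n ∈ N.primeFactors.biUnion
        fun p => (Finset.Icc 1 (Nat.log p N)).image (p ^ ·), vonMangoldt n :=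
        Finset.sum_le_sum_of_subset_of_nonneg hsub fun _ _ _ => vonMangoldt_nonneg
    _ = ∑ p ∈ N.primeFactors, ∑ n ∈ (Finset.Icc 1 (Nat.log p N)).image (p ^ ·), vonMangoldt n := by
        refine Finset.sum_biUnion fun p hp q hq hpq => Finset.disjoint_left.2 fun n hn hn' => hpq ?_
        obtain ⟨k, hk, rfl⟩ := Finset.mem_image.1 hn
        obtain ⟨j, hj, hjk⟩ := Finset.mem_image.1 hn'
        have hpp := Nat.prime_of_mem_primeFactors hp
        have hqp := Nat.prime_of_mem_primeFactors hq
        have hdvd : p ∣ q ^ j := by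
          rw [hjk]
          exact dvd_pow_self p (by have := (Finset.mem_Icc.1 hk).1; omega)
        exact (Nat.prime_dvd_prime_iff_eq hpp hqp).1 (hpp.dvd_of_dvd_pow hdvd)
    _ ≤ ∑ p ∈ N.primeFactors, Real.log N := by
        refine Finset.sum_le_sum fun p hp => ?_
        have hpp := Nat.prime_of_mem_primeFactors hp
        rw [Finset.sum_image fun a _ b _ hab => Nat.pow_right_injective hpp.two_le hab]
        calc ∑ k ∈ Finset.Icc 1 (Nat.log p N), vonMangoldt (p ^ k)
            = ∑ k ∈ Finset.Icc 1 (Nat.log p N), Real.log p := by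
              refine Finset.sum_congr rfl fun k hk => ?_
              rw [vonMangoldt_apply_pow (by have := (Finset.mem_Icc.1 hk).1; omega),
                vonMangoldt_apply_prime hpp]
          _ = Nat.log p N * Real.log p := by simp
          _ = Real.log ((p : ℝ) ^ Nat.log p N) := (Real.log_pow _ _).symm
          _ ≤ _ := by
              refine Real.log_le_log (by have := hpp.pos; positivity) ?_
              exact_mod_cast Nat.pow_log_le_self p hN
    _ = N.primeFactors.card * Real.log N := by simp
    _ ≤ 2 * Real.log N * Real.log N := by
        gcongr
        exact card_primeFactors_le_two_mul_log hN
    _ = _ := by ring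

/-- The sum of `Λ(n)` over the `n < N` in the residue class of `N` modulo `q`. -/
def mangoldtProgression (N q : ℕ) : ℝ :=
  ∑ n ∈ Finset.Ico 1 N with q ∣ N - n, ArithmeticFunction.vonMangoldt n

/-- The error in the distribution of the primes in the residue class of `N` modulo `q`. -/
def progressionError (N q : ℕ) : ℝ :=
  |mangoldtProgression N q - if q.Coprime N then ((N : ℝ) - 1) / q.totient else 0|

lemma mangoldtProgression_nonneg (N q : ℕ) : 0 ≤ mangoldtProgression N q :=
  Finset.sum_nonneg fun _ _ => ArithmeticFunction.vonMangoldt_nonneg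

lemma not_coprime_of_dvd_sub {N q n : ℕ} (hn : n ≤ N) (hq : ¬ q.Coprime N) (h : q ∣ N - n) :
    ¬ n.Coprime N := by
  intro hcop
  obtain ⟨p, hp, hpq, hpN⟩ := Nat.Prime.not_coprime_iff_dvd.1 hq
  have hpn : p ∣ n := (Nat.dvd_sub_iff_right hn hpN).1 (hpq.trans h)
  exact Nat.not_coprime_of_dvd_of_dvd hp.one_lt hpn hpN hcop

/-- Every `n ≡ N` modulo `q` then shares a prime with `N`, and `Λ` sees only powers of the few
primes dividing `N`. -/
lemma mangoldtProgression_le_of_not_coprime {N q : ℕ} (hN : N ≠ 0) (hq : ¬ q.Coprime N) :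
    mangoldtProgression N q ≤ 2 * Real.log N ^ 2 := by
  refine le_trans ?_ (sum_vonMangoldt_not_coprime_le hN)
  refine Finset.sum_le_sum_of_subset_of_nonneg ?_
    fun _ _ _ => ArithmeticFunction.vonMangoldt_nonneg
  intro n hn
  rw [Finset.mem_filter, Finset.mem_Ico] at hn ⊢
  exact ⟨hn.1, not_coprime_of_dvd_sub hn.1.2.le hq hn.2⟩

lemma natCast_eq_iff_dvd_sub {N q n : ℕ} (hn : n ≤ N) :
    ((n : ℕ) : ZMod q) = (N : ZMod q) ↔ q ∣ N - n := by
  rw [ZMod.natCast_eq_natCast_iff, Nat.modEq_iff_dvd' hn]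

/-- A double supremum over finite index types dominates each of its instances. -/
lemma le_iSup_iSup_fin_units {q m : ℕ} [NeZero q] (F : Fin m → (ZMod q)ˣ → ℝ) (y : Fin m)
    (a : (ZMod q)ˣ) : F y a ≤ ⨆ y, ⨆ a, F y a :=
  (le_ciSup (Set.finite_range (F y)).bddAbove a).trans
    (le_ciSup (f := fun y => ⨆ a, F y a) (Set.finite_range _).bddAbove y)

lemma half_lt_log {N : ℕ} (hN : 2 ≤ N) : 1 / 2 < Real.log N := by
  have := Real.log_le_log (by norm_num) (by exact_mod_cast hN : (2 : ℝ) ≤ N)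
  have := Real.log_two_gt_d9
  linarith

/-- The hypotheses require a positive exponent, so they are invoked with `j + 1`; the extra power is
given away through `log N > 1 / 2`, which also makes `j = 0` available. -/
lemma mul_div_log_rpow_le (K : ℝ) (j : ℕ) {N : ℕ} (hN : 2 ≤ N) :
    K * ((N : ℝ) / Real.log N ^ ((j : ℝ) + 1)) ≤ 2 * |K| * (N / Real.log N ^ j) := by
  have hl := half_lt_log hN
  have hl0 : 0 < Real.log N := by linarith
  have h1 : (N : ℝ) / Real.log N ^ ((j : ℝ) + 1) ≤ 2 * (N / Real.log N ^ j) := by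
    rw [Real.rpow_add hl0, Real.rpow_natCast, Real.rpow_one, ← div_div, div_le_iff₀ hl0]
    have : 0 ≤ (N : ℝ) / Real.log N ^ j := by positivity
    nlinarith
  have h0 : 0 ≤ (N : ℝ) / Real.log N ^ ((j : ℝ) + 1) := by positivity
  calc _ ≤ |K| * ((N : ℝ) / Real.log N ^ ((j : ℝ) + 1)) := by
        gcongr
        exact le_abs_self K
    _ ≤ |K| * (2 * (N / Real.log N ^ j)) := by gcongr
    _ = _ := by ring

/-- Keep only the modulus `q = 1` and `y = N`. The case `N = 2` is separate: `log 2 < 1`, so the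
range of moduli may be empty there. -/
lemma psiLogPowError_of_elliottHalberstam {θ C : ℝ} (hθ : 0 ≤ θ) (hC : 0 ≤ C)
    (h : ElliottHalberstam θ C) : PsiLogPowError := by
  intro j
  obtain ⟨K, hK⟩ := h (j + 1) (by positivity)
  refine ⟨2 * |K| + Real.log 2 ^ j, fun N hN => ?_⟩
  have hN2 : (2 : ℝ) ≤ N := by exact_mod_cast hN
  have hl : 0 < Real.log N := Real.log_pos (by linarith)
  have hl2 : 0 < Real.log 2 := Real.log_pos one_lt_two
  have hIoc : Finset.Ioc 0 N = Finset.Icc 1 N := by ext; simp; omega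
  have hQ : 0 ≤ (N : ℝ) / Real.log N ^ j := by positivity
  rcases hN.eq_or_lt with rfl | hN3
  · have hval : ∑ m ∈ Finset.Ioc 0 2, ArithmeticFunction.vonMangoldt m = Real.log 2 := by
      have : Finset.Ioc 0 2 = {1, 2} := by decide
      rw [this, Finset.sum_pair (by norm_num), ArithmeticFunction.vonMangoldt_apply_one,
        ArithmeticFunction.vonMangoldt_apply_prime Nat.prime_two]
      simp
    have hlt := Real.log_two_lt_d9
    rw [hval, abs_of_nonpos (by push_cast; linarith), add_mul]
    have h1 : Real.log 2 ^ j * (((2 : ℕ) : ℝ) / Real.log ((2 : ℕ) : ℝ) ^ j) = 2 := by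
      push_cast
      field_simp
    have h2 : 0 ≤ 2 * |K| * (((2 : ℕ) : ℝ) / Real.log ((2 : ℕ) : ℝ) ^ j) := by positivity
    push_cast at h1 h2 ⊢
    linarith
  · have hN3' : (3 : ℝ) ≤ N := by exact_mod_cast hN3
    have hl1 : 1 ≤ Real.log N := by
      rw [Real.le_log_iff_exp_le (by linarith)]
      linarith [Real.exp_one_lt_d9]
    have hmem : 1 ∈ Finset.Icc 1 ⌊(N : ℝ) ^ θ * Real.log N ^ C⌋₊ := by
      refine Finset.mem_Icc.2 ⟨le_rfl, Nat.le_floor ?_⟩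
      push_cast
      exact one_le_mul_of_one_le_of_one_le (Real.one_le_rpow (by linarith) hθ)
        (Real.one_le_rpow hl1 hC)
    have hsum := hK N hN
    have hsingle := Finset.single_le_sum (f := fun q : ℕ => (⨆ y : Fin (N + 1), ⨆ a : (ZMod q)ˣ,
          |(∑ n ∈ Finset.Icc 1 (y : ℕ) with ((n : ℕ) : ZMod q) = (a : ZMod q),
              ArithmeticFunction.vonMangoldt n) - ((y : ℕ) : ℝ) / (Nat.totient q : ℝ)|))
      (fun q _ => Real.iSup_nonneg fun _ => Real.iSup_nonneg fun _ => abs_nonneg _) hmem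
    have hterm := le_iSup_iSup_fin_units (q := 1) (fun (y : Fin (N + 1)) (a : (ZMod 1)ˣ) =>
      |(∑ n ∈ Finset.Icc 1 (y : ℕ) with ((n : ℕ) : ZMod 1) = (a : ZMod 1),
              ArithmeticFunction.vonMangoldt n) - ((y : ℕ) : ℝ) / (Nat.totient 1 : ℝ)|)
      (Fin.last N) 1
    have hfilter : (∑ n ∈ Finset.Icc 1 N with ((n : ℕ) : ZMod 1) = ((1 : (ZMod 1)ˣ) : ZMod 1),
        ArithmeticFunction.vonMangoldt n) = ∑ n ∈ Finset.Icc 1 N, ArithmeticFunction.vonMangoldt n := by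
      rw [Finset.filter_true_of_mem fun n _ => Subsingleton.elim _ _]
    simp only [Fin.val_last, Nat.totient_one, Nat.cast_one, div_one] at hterm hsingle
    rw [hfilter] at hterm
    rw [hIoc]
    have h1 := (hterm.trans hsingle).trans (hsum.trans (mul_div_log_rpow_le K j hN))
    refine h1.trans ?_
    gcongr
    have : 0 < Real.log 2 ^ j := by positivity
    linarith

/-- Moduli coprime to `N` are covered by the class `a = N` and `y = N - 1`. The others contribute `2
(log N)²` each, and `θ < 1` makes their total a power smaller than `N`. -/
lemma sum_progressionError_bound {θ C : ℝ} (hθ1 : θ < 1) (h : ElliottHalberstam θ C) (j : ℕ) :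
    ∃ K : ℝ, 0 ≤ K ∧ ∀ N : ℕ, 2 ≤ N →
    ∑ q ∈ Finset.Icc 1 ⌊(N : ℝ) ^ θ * Real.log N ^ C⌋₊, progressionError N q ≤
      K * (N / Real.log N ^ j) := by
  obtain ⟨K, hK⟩ := h (j + 1) (by positivity)
  obtain ⟨m, hm⟩ := exists_nat_ge (max C 0)
  obtain ⟨K', hK', h'⟩ := rpow_mul_log_pow_le (m + 2) j hθ1
  obtain ⟨K2, hK2, h2⟩ : ∃ K2 : ℝ, 0 ≤ K2 ∧ ∀ N : ℕ, 2 ≤ N →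
      Real.log N ^ C ≤ K2 * (1 + Real.log N) ^ m := by
    refine ⟨1 + (1 / 2) ^ C, by positivity, fun N hN => ?_⟩
    have hl := half_lt_log hN
    have h1 : 1 ≤ (1 + Real.log N) ^ m := one_le_pow₀ (by linarith)
    have h2 : 0 < ((1 : ℝ) / 2) ^ C := by positivity
    rcases le_total 0 C with h0 | h0
    · have : Real.log N ^ C ≤ (1 + Real.log N) ^ m := by
        calc Real.log N ^ C ≤ (1 + Real.log N) ^ C :=
              Real.rpow_le_rpow (by linarith) (by linarith) h0
          _ ≤ (1 + Real.log N) ^ (m : ℝ) :=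
              Real.rpow_le_rpow_of_exponent_le (by linarith) ((le_max_left _ _).trans hm)
          _ = _ := Real.rpow_natCast _ _
      nlinarith
    · have : Real.log N ^ C ≤ (1 / 2) ^ C :=
        Real.rpow_le_rpow_of_nonpos (by norm_num) hl.le h0
      nlinarith
  refine ⟨2 * |K| + 2 * (K2 * K'), by positivity, fun N hN => ?_⟩
  have hN2 : (2 : ℝ) ≤ N := by exact_mod_cast hN
  have hl : 0 < Real.log N := by linarith [half_lt_log hN]
  set Q := ⌊(N : ℝ) ^ θ * Real.log N ^ C⌋₊ with hQ
  have hterm : ∀ q ∈ Finset.Icc 1 Q, progressionError N q ≤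
      (⨆ y : Fin (N + 1), ⨆ a : (ZMod q)ˣ,
          |(∑ n ∈ Finset.Icc 1 (y : ℕ) with ((n : ℕ) : ZMod q) = (a : ZMod q),
              ArithmeticFunction.vonMangoldt n) - ((y : ℕ) : ℝ) / (Nat.totient q : ℝ)|) +
      2 * Real.log N ^ 2 := by
    intro q hq
    have hq1 := (Finset.mem_Icc.1 hq).1
    have : NeZero q := ⟨by omega⟩
    rw [progressionError]
    split_ifs with hcop
    · have ht := le_iSup_iSup_fin_units (q := q) (fun (y : Fin (N + 1)) (a : (ZMod q)ˣ) =>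
        |(∑ n ∈ Finset.Icc 1 (y : ℕ) with ((n : ℕ) : ZMod q) = (a : ZMod q),
              ArithmeticFunction.vonMangoldt n) - ((y : ℕ) : ℝ) / (Nat.totient q : ℝ)|)
        ⟨N - 1, by omega⟩ (ZMod.unitOfCoprime N hcop.symm)
      have hset : ∑ n ∈ Finset.Icc 1 (N - 1) with ((n : ℕ) : ZMod q) =
          ((ZMod.unitOfCoprime N hcop.symm : (ZMod q)ˣ) : ZMod q), ArithmeticFunction.vonMangoldt n =
            mangoldtProgression N q := by
        rw [mangoldtProgression]
        refine Finset.sum_congr ?_ fun _ _ => rfl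
        ext n
        rw [Finset.mem_filter, Finset.mem_filter, Finset.mem_Icc, Finset.mem_Ico]
        constructor
        · rintro ⟨⟨h1, h2⟩, h3⟩
          rw [ZMod.coe_unitOfCoprime] at h3
          exact ⟨⟨h1, by omega⟩, (natCast_eq_iff_dvd_sub (by omega)).1 h3⟩
        · rintro ⟨⟨h1, h2⟩, h3⟩
          refine ⟨⟨h1, by omega⟩, ?_⟩
          rw [ZMod.coe_unitOfCoprime]
          exact (natCast_eq_iff_dvd_sub (by omega)).2 h3
      simp only [hset, Nat.cast_sub (by omega : 1 ≤ N), Nat.cast_one] at ht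
      have : 0 ≤ 2 * Real.log N ^ 2 := by positivity
      linarith
    · rw [sub_zero, abs_of_nonneg (mangoldtProgression_nonneg N q)]
      have h1 := mangoldtProgression_le_of_not_coprime (by omega : N ≠ 0) hcop
      have h2 : 0 ≤ (⨆ y : Fin (N + 1), ⨆ a : (ZMod q)ˣ,
          |(∑ n ∈ Finset.Icc 1 (y : ℕ) with ((n : ℕ) : ZMod q) = (a : ZMod q),
              ArithmeticFunction.vonMangoldt n) - ((y : ℕ) : ℝ) / (Nat.totient q : ℝ)|) :=
        Real.iSup_nonneg fun _ => Real.iSup_nonneg fun _ => abs_nonneg _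
      linarith
  calc _ ≤ _ := Finset.sum_le_sum hterm
    _ ≤ 2 * |K| * (N / Real.log N ^ j) + 2 * (K2 * K') * (N / Real.log N ^ j) := by
        rw [Finset.sum_add_distrib]
        refine add_le_add ((hK N hN).trans (mul_div_log_rpow_le K j hN)) ?_
        rw [Finset.sum_const, Nat.card_Icc, Nat.add_sub_cancel, nsmul_eq_mul]
        have hQ' : (Q : ℝ) ≤ (N : ℝ) ^ θ * Real.log N ^ C := Nat.floor_le (by positivity)
        calc (Q : ℝ) * (2 * Real.log N ^ 2)
            ≤ ((N : ℝ) ^ θ * (K2 * (1 + Real.log N) ^ m)) * (2 * (1 + Real.log N) ^ 2) := by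
              gcongr
              · exact hQ'.trans (by gcongr; exact h2 N hN)
              · linarith
          _ = 2 * K2 * ((N : ℝ) ^ θ * (1 + Real.log N) ^ (m + 2)) := by ring
          _ ≤ 2 * K2 * (K' * (N / Real.log N ^ j)) := by
              exact mul_le_mul_of_nonneg_left (h' N hN2) (by positivity)
          _ = _ := by ring
    _ = _ := by ring

/-- One majorant `R k` serves all `y < N` at once, as Abel's inequality will need. Classes not
coprime to the modulus are again bounded by `2 (log N)²`. -/
lemma sum_moebius_progression_bound {θ : ℝ} (hθ1 : θ < 1) (h : ElliottHalberstamMoebius θ) (j : ℕ) :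
    ∃ K : ℝ, 0 ≤ K ∧ ∀ N : ℕ, 2 ≤ N → ∃ R : ℕ → ℝ,
    (∀ k, 1 ≤ k → ∀ y < N, |(∑ n ∈ Finset.Ioc 0 y with k ∣ N - n,
        ArithmeticFunction.vonMangoldt n * (ArithmeticFunction.moebius (N - n) : ℝ)) -
      (if k.Coprime N then 1 / (k.totient : ℝ) else 0) * ∑ n ∈ Finset.Ioc 0 y,
        ArithmeticFunction.vonMangoldt n * (ArithmeticFunction.moebius (N - n) : ℝ)| ≤ R k) ∧
    ∑ k ∈ Finset.Icc 1 ⌊(N : ℝ) ^ θ⌋₊, R k ≤ K * (N / Real.log N ^ j) := by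
  obtain ⟨K, hK⟩ := h (j + 1) (by positivity)
  obtain ⟨K', hK', h'⟩ := rpow_mul_log_pow_le 2 j hθ1
  refine ⟨2 * |K| + 2 * K', by positivity, fun N hN => ?_⟩
  have hN2 : (2 : ℝ) ≤ N := by exact_mod_cast hN
  have hl : 0 < Real.log N := by linarith [half_lt_log hN]
  refine ⟨fun q => (⨆ y : Fin N, ⨆ a : (ZMod q)ˣ,
          |(∑ n ∈ Finset.Icc 1 (y : ℕ) with ((n : ℕ) : ZMod q) = (a : ZMod q),
              ArithmeticFunction.vonMangoldt n * (ArithmeticFunction.moebius (N - n) : ℝ)) -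
            1 / (Nat.totient q : ℝ) *
              ∑ n ∈ Finset.Icc 1 (y : ℕ),
                ArithmeticFunction.vonMangoldt n * (ArithmeticFunction.moebius (N - n) : ℝ)|) +
      2 * Real.log N ^ 2, ?_, ?_⟩
  · intro q hq y hy
    have : NeZero q := ⟨by omega⟩
    have hIoc : Finset.Ioc 0 y = Finset.Icc 1 y := by ext; simp; omega
    split_ifs with hcop
    · have ht := le_iSup_iSup_fin_units (q := q) (fun (y : Fin N) (a : (ZMod q)ˣ) =>
        |(∑ n ∈ Finset.Icc 1 (y : ℕ) with ((n : ℕ) : ZMod q) = (a : ZMod q),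
              ArithmeticFunction.vonMangoldt n * (ArithmeticFunction.moebius (N - n) : ℝ)) -
            1 / (Nat.totient q : ℝ) *
              ∑ n ∈ Finset.Icc 1 (y : ℕ),
                ArithmeticFunction.vonMangoldt n * (ArithmeticFunction.moebius (N - n) : ℝ)|)
        ⟨y, hy⟩ (ZMod.unitOfCoprime N hcop.symm)
      have hset : {n ∈ Finset.Icc 1 y | ((n : ℕ) : ZMod q) =
          ((ZMod.unitOfCoprime N hcop.symm : (ZMod q)ˣ) : ZMod q)} =
          {n ∈ Finset.Ioc 0 y | q ∣ N - n} := by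
        rw [hIoc]
        refine Finset.filter_congr fun n hn => ?_
        have := (Finset.mem_Icc.1 hn).2
        rw [ZMod.coe_unitOfCoprime]
        exact natCast_eq_iff_dvd_sub (by omega)
      dsimp only at ht
      rw [hset, ← hIoc] at ht
      have : 0 ≤ 2 * Real.log N ^ 2 := by positivity
      exact ht.trans (le_add_of_nonneg_right this)
    · rw [zero_mul, sub_zero]
      have h2 : 0 ≤ (⨆ y : Fin N, ⨆ a : (ZMod q)ˣ,
          |(∑ n ∈ Finset.Icc 1 (y : ℕ) with ((n : ℕ) : ZMod q) = (a : ZMod q),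
              ArithmeticFunction.vonMangoldt n * (ArithmeticFunction.moebius (N - n) : ℝ)) -
            1 / (Nat.totient q : ℝ) *
              ∑ n ∈ Finset.Icc 1 (y : ℕ),
                ArithmeticFunction.vonMangoldt n * (ArithmeticFunction.moebius (N - n) : ℝ)|) :=
        Real.iSup_nonneg fun _ => Real.iSup_nonneg fun _ => abs_nonneg _
      have h3 : |∑ n ∈ Finset.Ioc 0 y with q ∣ N - n,
          ArithmeticFunction.vonMangoldt n * (ArithmeticFunction.moebius (N - n) : ℝ)| ≤
          mangoldtProgression N q := by
        calc _ ≤ ∑ n ∈ Finset.Ioc 0 y with q ∣ N - n,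
            |ArithmeticFunction.vonMangoldt n * (ArithmeticFunction.moebius (N - n) : ℝ)| :=
              Finset.abs_sum_le_sum_abs _ _
          _ ≤ ∑ n ∈ Finset.Ioc 0 y with q ∣ N - n, ArithmeticFunction.vonMangoldt n := by
              refine Finset.sum_le_sum fun n _ => ?_
              rw [abs_mul, abs_of_nonneg ArithmeticFunction.vonMangoldt_nonneg]
              exact mul_le_of_le_one_right ArithmeticFunction.vonMangoldt_nonneg
                (abs_moebius_real_le _)
          _ ≤ _ := by
              refine Finset.sum_le_sum_of_subset_of_nonneg ?_
                fun _ _ _ => ArithmeticFunction.vonMangoldt_nonneg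
              intro n hn
              simp only [Finset.mem_filter, Finset.mem_Ioc, Finset.mem_Ico] at hn ⊢
              exact ⟨by omega, hn.2⟩
      have h1 := mangoldtProgression_le_of_not_coprime (by omega : N ≠ 0) hcop
      linarith
  · rw [Finset.sum_add_distrib, Finset.sum_const, Nat.card_Icc, Nat.add_sub_cancel, nsmul_eq_mul]
    have hQ : (⌊(N : ℝ) ^ θ⌋₊ : ℝ) ≤ (N : ℝ) ^ θ := Nat.floor_le (by positivity)
    calc _ ≤ 2 * |K| * (N / Real.log N ^ j) + 2 * K' * (N / Real.log N ^ j) := by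
          refine add_le_add ((hK N hN).trans (mul_div_log_rpow_le K j hN)) ?_
          calc _ ≤ (N : ℝ) ^ θ * (2 * (1 + Real.log N) ^ 2) := by
                gcongr
                linarith
            _ = 2 * ((N : ℝ) ^ θ * (1 + Real.log N) ^ 2) := by ring
            _ ≤ 2 * (K' * (N / Real.log N ^ j)) := by
                exact mul_le_mul_of_nonneg_left (h' N hN2) (by positivity)
            _ = _ := by ring
      _ = _ := by ring

/-! ### Detecting squarefree numbers by their square divisors -/

/-- On valuations, `2 v(e) ≤ 2 v(b) + v(a)` with `v(a) ≤ 1` forces `v(e) ≤ v(b)` by parity. -/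
lemma sq_dvd_sq_mul_squarefree_iff {a b e : ℕ} (ha : Squarefree a) (hb : b ≠ 0) (he : e ≠ 0) :
    e ^ 2 ∣ b ^ 2 * a ↔ e ∣ b := by
  constructor
  · intro h
    have ha0 : a ≠ 0 := ha.ne_zero
    rw [← Nat.factorization_le_iff_dvd (by positivity) (by positivity)] at h
    rw [← Nat.factorization_le_iff_dvd he hb]
    intro p
    have h1 := h p
    rw [Nat.factorization_mul (by positivity) ha0, Nat.factorization_pow, Nat.factorization_pow] at h1
    simp only [Finsupp.coe_add, Finsupp.coe_smul, Pi.add_apply, Pi.smul_apply, smul_eq_mul] at h1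
    have h2 := ha.natFactorization_le_one p
    omega
  · intro h
    exact Dvd.dvd.mul_right (pow_dvd_pow_of_dvd h 2) a

/-- The indicator of the squarefree numbers as a sum over square divisors. -/
lemma moebius_sq_eq_sum {m N : ℕ} (hm : 1 ≤ m) (hmN : m ≤ N) :
    (ArithmeticFunction.moebius m : ℝ) ^ 2 =
      ∑ e ∈ Finset.Ioc 0 N with e ^ 2 ∣ m, (ArithmeticFunction.moebius e : ℝ) := by
  obtain ⟨a, b, ha0, hb0, hab, ha⟩ := Nat.sq_mul_squarefree_of_pos (by omega : 0 < m)
  have hset : {e ∈ Finset.Ioc 0 N | e ^ 2 ∣ m} = b.divisors := by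
    ext e
    rw [Finset.mem_filter, Finset.mem_Ioc, Nat.mem_divisors]
    constructor
    · rintro ⟨⟨h1, h2⟩, h3⟩
      rw [← hab] at h3
      exact ⟨(sq_dvd_sq_mul_squarefree_iff ha hb0.ne' h1.ne').1 h3, hb0.ne'⟩
    · rintro ⟨h1, -⟩
      have he0 : 0 < e := Nat.pos_of_dvd_of_pos h1 hb0
      have h3 : e ^ 2 ∣ m := by
        rw [← hab]
        exact (sq_dvd_sq_mul_squarefree_iff ha hb0.ne' he0.ne').2 h1
      refine ⟨⟨he0, ?_⟩, h3⟩
      exact (Nat.le_self_pow two_ne_zero e).trans ((Nat.le_of_dvd hm h3).trans hmN)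
  rw [hset]
  have h1 : ∑ e ∈ b.divisors, (ArithmeticFunction.moebius e : ℝ) = if b = 1 then 1 else 0 := by
    have h := ArithmeticFunction.coe_mul_zeta_apply (f := ArithmeticFunction.moebius) (x := b)
    rw [ArithmeticFunction.moebius_mul_coe_zeta, ArithmeticFunction.one_apply] at h
    rw [← Int.cast_sum, ← h]
    split_ifs <;> simp
  rw [h1]
  by_cases hb : b = 1
  · have hsq : Squarefree m := by rw [← hab, hb]; simpa using ha
    rw [if_pos hb]
    exact_mod_cast ArithmeticFunction.moebius_sq_eq_one_of_squarefree hsq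
  · have hsq : ¬ Squarefree m := by
      intro h
      exact hb (Nat.isUnit_iff.1 (h b ⟨a, by rw [← hab]; ring⟩))
    rw [if_neg hb, ArithmeticFunction.moebius_eq_zero_of_not_squarefree hsq]
    simp

/-- Splitting the squarefree numbers up to `D` by their greatest common divisor with `e`. -/
lemma sum_Ioc_eq_sum_divisors_coprime {F : ℕ → ℝ} (hF : ∀ d, ¬ Squarefree d → F d = 0) (D : ℕ)
    {e : ℕ} (he : e ≠ 0) :
    ∑ d ∈ Finset.Ioc 0 D, F d =
      ∑ d₁ ∈ e.divisors, ∑ d₂ ∈ Finset.Ioc 0 (D / d₁) with d₂.Coprime e, F (d₁ * d₂) := by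
  have h1 : ∀ d ∈ Finset.Ioc 0 D, d.gcd e ∈ e.divisors := fun d _ =>
    Nat.mem_divisors.2 ⟨Nat.gcd_dvd_right d e, he⟩
  rw [← Finset.sum_fiberwise_of_maps_to h1]
  refine Finset.sum_congr rfl fun d₁ hd₁ => ?_
  have hd₁e := Nat.dvd_of_mem_divisors hd₁
  have hd₁0 : 0 < d₁ := Nat.pos_of_mem_divisors hd₁
  have hinj : Set.InjOn (fun d₂ => d₁ * d₂) ↑({d₂ ∈ Finset.Ioc 0 (D / d₁) | d₂.Coprime e}) :=
    fun a _ b _ h => Nat.eq_of_mul_eq_mul_left hd₁0 h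
  rw [← Finset.sum_image (f := F) hinj]
  symm
  refine Finset.sum_subset ?_ ?_
  · intro d hd
    obtain ⟨d₂, hd₂, rfl⟩ := Finset.mem_image.1 hd
    rw [Finset.mem_filter, Finset.mem_Ioc] at hd₂ ⊢
    refine ⟨⟨Nat.mul_pos hd₁0 hd₂.1.1, ?_⟩, ?_⟩
    · rw [mul_comm]
      exact (Nat.le_div_iff_mul_le hd₁0).1 hd₂.1.2
    · rw [mul_comm, Nat.Coprime.gcd_mul_left_cancel _ hd₂.2]
      exact Nat.gcd_eq_left hd₁e
  · intro d hd hd'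
    rw [Finset.mem_filter, Finset.mem_Ioc] at hd
    obtain ⟨⟨hd0, hdD⟩, hgcd⟩ := hd
    apply hF
    intro hsq
    apply hd'
    have hdvd : d₁ ∣ d := hgcd ▸ Nat.gcd_dvd_left d e
    obtain ⟨d₂, rfl⟩ := hdvd
    refine Finset.mem_image.2 ⟨d₂, ?_, rfl⟩
    rw [Finset.mem_filter, Finset.mem_Ioc]
    refine ⟨⟨Nat.pos_of_mul_pos_left hd0, ?_⟩, ?_⟩
    · rw [Nat.le_div_iff_mul_le hd₁0, mul_comm]
      exact hdD
    · by_contra hcop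
      obtain ⟨p, hp, hp2, hpe⟩ := Nat.Prime.not_coprime_iff_dvd.1 hcop
      have hp1 : p ∣ d₁ := by
        rw [← hgcd]
        exact Nat.dvd_gcd (hp2.mul_left d₁) hpe
      have := hsq p (mul_dvd_mul hp1 hp2)
      exact hp.one_lt.ne' (Nat.isUnit_iff.1 this)

/-! ### The contribution of the small divisors -/

/-- The part of the squarefree Goldbach sum that comes from the divisors up to `D`. -/
def smallDivisorSum (N D : ℕ) : ℝ :=
  ∑ n ∈ Finset.Ico 1 N, ArithmeticFunction.vonMangoldt n *
    (ArithmeticFunction.moebius (N - n) : ℝ) ^ 2 *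
      ∑ d ∈ Finset.Ioc 0 D with d ∣ N - n, (ArithmeticFunction.moebius d : ℝ) * Real.log (D / d)

/-- The contribution of the numbers divisible by `e ^ 2` to `smallDivisorSum`. -/
def squareDivisorSum (N D e : ℕ) : ℝ :=
  ∑ d ∈ Finset.Ioc 0 D, (ArithmeticFunction.moebius d : ℝ) * Real.log (D / d) *
    ∑ n ∈ Finset.Ico 1 N with d ∣ N - n ∧ e ^ 2 ∣ N - n, ArithmeticFunction.vonMangoldt n

lemma smallDivisorSum_eq (N D : ℕ) : smallDivisorSum N D =
    ∑ e ∈ Finset.Ioc 0 N, (ArithmeticFunction.moebius e : ℝ) * squareDivisorSum N D e := by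
  have h1 : smallDivisorSum N D = ∑ n ∈ Finset.Ico 1 N, ∑ e ∈ Finset.Ioc 0 N, ∑ d ∈ Finset.Ioc 0 D,
      (ArithmeticFunction.moebius e : ℝ) * ((ArithmeticFunction.moebius d : ℝ) * Real.log (D / d) *
        if d ∣ N - n ∧ e ^ 2 ∣ N - n then ArithmeticFunction.vonMangoldt n else 0) := by
    refine Finset.sum_congr rfl fun n hn => ?_
    rw [Finset.mem_Ico] at hn
    rw [moebius_sq_eq_sum (by omega : 1 ≤ N - n) (Nat.sub_le N n), Finset.sum_filter,
      Finset.sum_filter, mul_assoc, Finset.sum_mul, Finset.mul_sum]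
    refine Finset.sum_congr rfl fun e _ => ?_
    rw [Finset.mul_sum, Finset.mul_sum]
    refine Finset.sum_congr rfl fun d _ => ?_
    by_cases h1 : d ∣ N - n <;> by_cases h2 : e ^ 2 ∣ N - n <;> simp only [h1, h2, if_true,
      if_false, and_true, and_false, mul_zero, zero_mul, and_self]
    ring
  rw [h1, Finset.sum_comm]
  refine Finset.sum_congr rfl fun e _ => ?_
  rw [squareDivisorSum, Finset.sum_comm, Finset.mul_sum]
  refine Finset.sum_congr rfl fun d _ => ?_
  rw [Finset.sum_filter, Finset.mul_sum, Finset.mul_sum]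

/-- With `d₁ = gcd(d, e)`, the condition `d₁ ∣ N - n` is implied by `e² ∣ N - n`. Since `d₂` is
coprime to `e`, only the single modulus `d₂ e²` remains. -/
lemma squareDivisorSum_eq (N D : ℕ) {e : ℕ} (he : e ≠ 0) : squareDivisorSum N D e =
    ∑ d₁ ∈ e.divisors, ∑ d₂ ∈ Finset.Ioc 0 (D / d₁) with d₂.Coprime e,
      (ArithmeticFunction.moebius d₁ : ℝ) * ((ArithmeticFunction.moebius d₂ : ℝ) *
        Real.log ((D : ℝ) / d₁ / d₂) * mangoldtProgression N (d₂ * e ^ 2)) := by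
  rw [squareDivisorSum, sum_Ioc_eq_sum_divisors_coprime (fun d hd => by
    rw [ArithmeticFunction.moebius_eq_zero_of_not_squarefree hd]; simp) D he]
  refine Finset.sum_congr rfl fun d₁ hd₁ => Finset.sum_congr rfl fun d₂ hd₂ => ?_
  have hd₁e := Nat.dvd_of_mem_divisors hd₁
  have hcop := (Finset.mem_filter.1 hd₂).2
  have hcop' : d₁.Coprime d₂ := (hcop.coprime_dvd_right hd₁e).symm
  rw [ArithmeticFunction.isMultiplicative_moebius.map_mul_of_coprime hcop', mangoldtProgression]
  have hset : {n ∈ Finset.Ico 1 N | d₁ * d₂ ∣ N - n ∧ e ^ 2 ∣ N - n} =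
      {n ∈ Finset.Ico 1 N | d₂ * e ^ 2 ∣ N - n} := by
    refine Finset.filter_congr fun n _ => ?_
    constructor
    · rintro ⟨h1, h2⟩
      exact (hcop.pow_right 2).mul_dvd_of_dvd_of_dvd ((dvd_mul_left d₂ d₁).trans h1) h2
    · intro h
      have h2 : e ^ 2 ∣ N - n := (dvd_mul_left _ _).trans h
      refine ⟨?_, h2⟩
      exact hcop'.mul_dvd_of_dvd_of_dvd (hd₁e.trans ((dvd_pow_self e two_ne_zero).trans h2))
        ((dvd_mul_right _ _).trans h)
  rw [hset, div_div]
  push_cast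
  ring

/-- The expected main term of `squareDivisorSum`. -/
def squareDivisorMain (N D e : ℕ) : ℝ :=
  if e.Coprime N then ((N : ℝ) - 1) / (e ^ 2).totient *
    ∑ d₁ ∈ e.divisors, (ArithmeticFunction.moebius d₁ : ℝ) * coprimeLogSum (e * N) ((D : ℝ) / d₁)
  else 0

lemma log_div_nonneg_of_mem {D d₁ d₂ : ℕ} (hd₁ : 0 < d₁) (hd₂ : 0 < d₂) (h : d₂ ≤ D / d₁) :
    0 ≤ Real.log ((D : ℝ) / d₁ / d₂) ∧ Real.log ((D : ℝ) / d₁ / d₂) ≤ Real.log D := by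
  have h1 : d₁ * d₂ ≤ D := by
    rw [mul_comm]; exact (Nat.le_div_iff_mul_le hd₁).1 h
  have h1' : (d₁ : ℝ) * d₂ ≤ D := by exact_mod_cast h1
  have h2 : (1 : ℝ) ≤ (d₁ : ℝ) * d₂ := by exact_mod_cast Nat.mul_pos hd₁ hd₂
  rw [div_div]
  constructor
  · exact Real.log_nonneg ((one_le_div (by linarith)).2 h1')
  · refine Real.log_le_log (by apply div_pos <;> linarith) ?_
    exact div_le_self (by linarith) h2

/-- `φ(d₂ e²) = φ(d₂) φ(e²)`, and coprimality of `d₂` to `e` and to `N` merges into coprimality to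
`eN`. This form can be compared term by term with `squareDivisorSum_eq`. -/
lemma squareDivisorMain_eq (N D e : ℕ) : squareDivisorMain N D e =
    ∑ d₁ ∈ e.divisors, ∑ d₂ ∈ Finset.Ioc 0 (D / d₁) with d₂.Coprime e,
      (ArithmeticFunction.moebius d₁ : ℝ) * ((ArithmeticFunction.moebius d₂ : ℝ) *
        Real.log ((D : ℝ) / d₁ / d₂) *
          if (d₂ * e ^ 2).Coprime N then ((N : ℝ) - 1) / (d₂ * e ^ 2).totient else 0) := by
  rw [squareDivisorMain]
  split_ifs with hcop
  · rw [Finset.mul_sum]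
    refine Finset.sum_congr rfl fun d₁ hd₁ => ?_
    rw [coprimeLogSum, Nat.floor_div_natCast, Nat.floor_natCast, Finset.mul_sum, Finset.mul_sum,
      Finset.sum_filter]
    refine Finset.sum_congr rfl fun d₂ hd₂ => ?_
    rw [coprimeMoebiusTotient_apply]
    by_cases h1 : d₂.Coprime e
    · by_cases h2 : d₂.Coprime N
      · rw [if_pos (Nat.Coprime.mul_right h1 h2), if_pos h1,
          if_pos (Nat.Coprime.mul_left h2 (hcop.pow_left 2)), Nat.totient_mul (h1.pow_right 2)]
        push_cast
        rw [div_mul_eq_div_div]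
        ring
      · rw [if_neg fun h => h2 (Nat.coprime_mul_iff_right.1 h).2, if_pos h1,
          if_neg fun h => h2 (Nat.coprime_mul_iff_left.1 h).1]
        ring
    · rw [if_neg fun h => h1 (Nat.coprime_mul_iff_right.1 h).1, if_neg h1]
      ring
  · symm
    refine Finset.sum_eq_zero fun d₁ _ => Finset.sum_eq_zero fun d₂ _ => ?_
    rw [if_neg]
    · ring
    · intro h
      exact hcop ((Nat.coprime_pow_left_iff two_pos _ _).1 (Nat.coprime_mul_iff_left.1 h).2)

lemma abs_squareDivisorSum_sub_main_le {N D : ℕ} (hDN : D ≤ N) {e : ℕ} (he : e ≠ 0) :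
    |squareDivisorSum N D e - squareDivisorMain N D e| ≤
      e * (Real.log N * ∑ d ∈ Finset.Ioc 0 D, progressionError N (d * e ^ 2)) := by
  have hlN : 0 ≤ Real.log N := Real.log_natCast_nonneg N
  rw [squareDivisorSum_eq N D he, squareDivisorMain_eq N D e, ← Finset.sum_sub_distrib]
  calc _ ≤ ∑ d₁ ∈ e.divisors, (Real.log N * ∑ d ∈ Finset.Ioc 0 D, progressionError N (d * e ^ 2)) := by
        refine (Finset.abs_sum_le_sum_abs _ _).trans (Finset.sum_le_sum fun d₁ hd₁ => ?_)
        rw [← Finset.sum_sub_distrib]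
        refine (Finset.abs_sum_le_sum_abs _ _).trans ?_
        have hd₁0 := Nat.pos_of_mem_divisors hd₁
        calc _ ≤ ∑ d₂ ∈ Finset.Ioc 0 (D / d₁) with d₂.Coprime e,
              Real.log N * progressionError N (d₂ * e ^ 2) := by
              refine Finset.sum_le_sum fun d₂ hd₂ => ?_
              rw [Finset.mem_filter, Finset.mem_Ioc] at hd₂
              obtain ⟨h1, h2⟩ := log_div_nonneg_of_mem hd₁0 hd₂.1.1 hd₂.1.2
              have hD0 : 0 < D := by
                have := hd₂.1.1.trans_le (hd₂.1.2.trans (Nat.div_le_self D d₁)); exact this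
              have h3 : Real.log D ≤ Real.log N :=
                Real.log_le_log (by exact_mod_cast hD0) (by exact_mod_cast hDN)
              rw [← mul_sub, ← mul_sub, abs_mul, abs_mul, abs_mul, abs_of_nonneg h1]
              calc _ ≤ 1 * (1 * Real.log N * progressionError N (d₂ * e ^ 2)) := by
                    have h4 := h2.trans h3
                    rw [progressionError]
                    exact mul_le_mul (abs_moebius_real_le d₁) (mul_le_mul_of_nonneg_right
                      (mul_le_mul (abs_moebius_real_le d₂) h4 h1 zero_le_one) (abs_nonneg _))
                      (by positivity) zero_le_one
                _ = _ := by ring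
          _ ≤ ∑ d₂ ∈ Finset.Ioc 0 D, Real.log N * progressionError N (d₂ * e ^ 2) := by
              refine Finset.sum_le_sum_of_subset_of_nonneg ?_
                fun _ _ _ => mul_nonneg hlN (abs_nonneg _)
              exact (Finset.filter_subset _ _).trans
                (Finset.Ioc_subset_Ioc_right (Nat.div_le_self D d₁))
          _ = _ := by rw [Finset.mul_sum]
    _ = e.divisors.card * (Real.log N * ∑ d ∈ Finset.Ioc 0 D, progressionError N (d * e ^ 2)) := by
        rw [Finset.sum_const, nsmul_eq_mul]
    _ ≤ _ := by
        have : 0 ≤ Real.log N * ∑ d ∈ Finset.Ioc 0 D, progressionError N (d * e ^ 2) :=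
          mul_nonneg hlN (Finset.sum_nonneg fun _ _ => abs_nonneg _)
        gcongr
        exact Nat.card_divisors_le_self e

lemma mangoldtProgression_le (N q : ℕ) :
    mangoldtProgression N q ≤ Real.log N * (N / q) := by
  have hlN : 0 ≤ Real.log N := Real.log_natCast_nonneg N
  have hcard : ({n ∈ Finset.Ico 1 N | q ∣ N - n}.card : ℝ) ≤ N / q := by
    have h1 : {n ∈ Finset.Ico 1 N | q ∣ N - n}.card ≤ {m ∈ Finset.Ioc 0 N | q ∣ m}.card := by
      refine Finset.card_le_card_of_injOn (fun n => N - n) ?_ ?_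
      · intro n hn
        simp only [Finset.coe_filter, Finset.mem_Ico, Finset.mem_Ioc, Set.mem_ofPred_eq] at hn ⊢
        exact ⟨by omega, hn.2⟩
      · intro a ha b hb hab
        simp only [Finset.coe_filter, Finset.mem_Ico, Set.mem_ofPred_eq] at ha hb hab
        omega
    rw [Nat.Ioc_filter_dvd_card_eq_div] at h1
    calc _ ≤ ((N / q : ℕ) : ℝ) := by exact_mod_cast h1
      _ ≤ _ := Nat.cast_div_le
  calc mangoldtProgression N q ≤ ∑ n ∈ Finset.Ico 1 N with q ∣ N - n, Real.log N := by
        refine Finset.sum_le_sum fun n hn => ?_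
        rw [Finset.mem_filter, Finset.mem_Ico] at hn
        exact ArithmeticFunction.vonMangoldt_le_log.trans
          (Real.log_le_log (by exact_mod_cast hn.1.1) (by exact_mod_cast hn.1.2.le))
    _ = {n ∈ Finset.Ico 1 N | q ∣ N - n}.card * Real.log N := by
        rw [Finset.sum_const, nsmul_eq_mul]
    _ ≤ N / q * Real.log N := by gcongr
    _ = _ := mul_comm _ _

/-- A bound without equidistribution, for `e` beyond the cutoff; it loses logarithms but decays like
`τ(e) / e²`. -/
lemma abs_squareDivisorSum_le {N D : ℕ} (hDN : D ≤ N) {e : ℕ} (he : e ≠ 0) :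
    |squareDivisorSum N D e| ≤
      e.divisors.card / (e : ℝ) ^ 2 * (N * Real.log N ^ 2 * (1 + Real.log N)) := by
  have hlN : 0 ≤ Real.log N := Real.log_natCast_nonneg N
  have he0 : (0 : ℝ) < e := by positivity
  rw [squareDivisorSum_eq N D he]
  calc _ ≤ ∑ d₁ ∈ e.divisors, N * Real.log N ^ 2 / (e : ℝ) ^ 2 * (1 + Real.log N) := by
        refine (Finset.abs_sum_le_sum_abs _ _).trans (Finset.sum_le_sum fun d₁ hd₁ => ?_)
        refine (Finset.abs_sum_le_sum_abs _ _).trans ?_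
        have hd₁0 := Nat.pos_of_mem_divisors hd₁
        calc _ ≤ ∑ d₂ ∈ Finset.Ioc 0 (D / d₁) with d₂.Coprime e,
              N * Real.log N ^ 2 / (e : ℝ) ^ 2 * (1 / d₂) := by
              refine Finset.sum_le_sum fun d₂ hd₂ => ?_
              rw [Finset.mem_filter, Finset.mem_Ioc] at hd₂
              obtain ⟨h1, h2⟩ := log_div_nonneg_of_mem hd₁0 hd₂.1.1 hd₂.1.2
              have hD0 : 0 < D := hd₂.1.1.trans_le (hd₂.1.2.trans (Nat.div_le_self D d₁))
              have h3 : Real.log D ≤ Real.log N :=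
                Real.log_le_log (by exact_mod_cast hD0) (by exact_mod_cast hDN)
              have h4 := h2.trans h3
              have h5 := mangoldtProgression_le N (d₂ * e ^ 2)
              have h6 := mangoldtProgression_nonneg N (d₂ * e ^ 2)
              rw [abs_mul, abs_mul, abs_mul, abs_of_nonneg h1, abs_of_nonneg h6]
              calc _ ≤ 1 * (1 * Real.log N * (Real.log N * (N / (d₂ * e ^ 2 : ℕ)))) :=
                    mul_le_mul (abs_moebius_real_le d₁) (mul_le_mul
                      (mul_le_mul (abs_moebius_real_le d₂) h4 h1 zero_le_one) h5 h6
                      (by positivity)) (by positivity) zero_le_one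
                _ = _ := by
                  have : (d₂ : ℝ) ≠ 0 := by have := hd₂.1.1; positivity
                  push_cast
                  field_simp
          _ ≤ ∑ d₂ ∈ Finset.Ioc 0 N, N * Real.log N ^ 2 / (e : ℝ) ^ 2 * (1 / d₂) := by
              refine Finset.sum_le_sum_of_subset_of_nonneg ?_ fun _ _ _ => by positivity
              exact (Finset.filter_subset _ _).trans
                (Finset.Ioc_subset_Ioc_right ((Nat.div_le_self D d₁).trans hDN))
          _ ≤ _ := by
              rw [← Finset.mul_sum]
              exact mul_le_mul_of_nonneg_left (sum_Ioc_inv_le N) (by positivity)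
    _ = _ := by
        rw [Finset.sum_const, nsmul_eq_mul]
        field_simp

/-- Write `e = ab` with `b > ⌊E / a⌋`; the tail of `∑ 1 / b²` is at most `2 / (⌊E / a⌋ + 1)`, and `a
(⌊E / a⌋ + 1) > E` whether or not `a ≤ E`. -/
lemma sum_Ioc_dvd_inv_sq_le {E : ℕ} (hE : 1 ≤ E) (N : ℕ) {a : ℕ} (ha : 0 < a) :
    ∑ e ∈ Finset.Ioc E N with a ∣ e, 1 / (e : ℝ) ^ 2 ≤ 2 / (E : ℝ) * (1 / a) := by
  have ha0 : (0 : ℝ) < a := by exact_mod_cast ha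
  have hE0 : (0 : ℝ) < E := by exact_mod_cast hE
  have hsub : {e ∈ Finset.Ioc E N | a ∣ e} ⊆ (Finset.Ioo (E / a) (N + 1)).image (a * ·) := by
    intro e he
    rw [Finset.mem_filter, Finset.mem_Ioc] at he
    obtain ⟨⟨h1, h2⟩, b, rfl⟩ := he
    refine Finset.mem_image.2 ⟨b, Finset.mem_Ioo.2 ⟨?_, ?_⟩, rfl⟩
    · rw [Nat.div_lt_iff_lt_mul ha, mul_comm]
      exact h1
    · have := Nat.le_mul_of_pos_left b ha
      omega
  have hlt : (E : ℝ) < a * ((E / a : ℕ) + 1) := by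
    have := Nat.lt_mul_div_succ E ha
    exact_mod_cast this
  calc _ ≤ ∑ e ∈ (Finset.Ioo (E / a) (N + 1)).image (a * ·), 1 / (e : ℝ) ^ 2 :=
        Finset.sum_le_sum_of_subset_of_nonneg hsub fun _ _ _ => by positivity
    _ = 1 / (a : ℝ) ^ 2 * ∑ b ∈ Finset.Ioo (E / a) (N + 1), ((b : ℝ) ^ 2)⁻¹ := by
        rw [Finset.sum_image fun x _ y _ h => Nat.eq_of_mul_eq_mul_left ha h, Finset.mul_sum]
        refine Finset.sum_congr rfl fun b _ => ?_
        push_cast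
        rw [mul_pow, one_div, one_div, mul_inv]
    _ ≤ 1 / (a : ℝ) ^ 2 * (2 / ((E / a : ℕ) + 1)) := by
        gcongr
        exact sum_Ioo_inv_sq_le _ _
    _ ≤ _ := by
        rw [div_mul_div_comm, div_mul_div_comm, div_le_div_iff₀ (by positivity) (by positivity)]
        nlinarith

lemma sum_card_divisors_div_sq_le {E : ℕ} (hE : 1 ≤ E) (N : ℕ) :
    ∑ e ∈ Finset.Ioc E N, (e.divisors.card : ℝ) / (e : ℝ) ^ 2 ≤ 2 / (E : ℝ) * (1 + Real.log N) := by
  have h1 : ∀ e ∈ Finset.Ioc E N, (e.divisors.card : ℝ) / (e : ℝ) ^ 2 =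
      ∑ a ∈ Finset.Ioc 0 N, if a ∣ e then 1 / (e : ℝ) ^ 2 else 0 := by
    intro e he
    rw [Finset.mem_Ioc] at he
    have hset : {a ∈ Finset.Ioc 0 N | a ∣ e} = e.divisors := by
      ext a
      rw [Finset.mem_filter, Finset.mem_Ioc, Nat.mem_divisors]
      constructor
      · rintro ⟨-, h⟩
        exact ⟨h, by omega⟩
      · rintro ⟨h, h0⟩
        exact ⟨⟨Nat.pos_of_dvd_of_pos h (by omega),
          (Nat.le_of_dvd (by omega) h).trans he.2⟩, h⟩
    rw [← Finset.sum_filter, hset, Finset.sum_const, nsmul_eq_mul, mul_one_div]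
  rw [Finset.sum_congr rfl h1, Finset.sum_comm]
  calc _ ≤ ∑ a ∈ Finset.Ioc 0 N, 2 / (E : ℝ) * (1 / a) := by
        refine Finset.sum_le_sum fun a ha => ?_
        rw [← Finset.sum_filter]
        exact sum_Ioc_dvd_inv_sq_le hE N (Finset.mem_Ioc.1 ha).1
    _ ≤ _ := by
        rw [← Finset.mul_sum]
        exact mul_le_mul_of_nonneg_left (sum_Ioc_inv_le N) (by positivity)

/-- The limit `𝔖(eN)` is the same for all `d₁ ∣ e`, so `∑ μ(d₁)` cancels it unless `e = 1`. Only the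
errors `B` survive, one for each divisor. -/
lemma abs_squareDivisorMain_sub_le {N D e : ℕ} (hN : 1 ≤ N) (he : e ≠ 0) {B : ℝ}
    (hB : ∀ d ∈ e.divisors, |coprimeLogSum (e * N) ((D : ℝ) / d) - singularSeries (e * N)| ≤ B) :
    |squareDivisorMain N D e - if e = 1 then singularSeries N * ((N : ℝ) - 1) else 0| ≤
      N * (e * B) := by
  have hN1 : (1 : ℝ) ≤ N := by exact_mod_cast hN
  have hB0 : 0 ≤ B := (abs_nonneg _).trans (hB 1 (Nat.one_mem_divisors.2 he))
  have hmu : ∑ d ∈ e.divisors, (ArithmeticFunction.moebius d : ℝ) = if e = 1 then 1 else 0 := by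
    have h := ArithmeticFunction.coe_mul_zeta_apply (f := ArithmeticFunction.moebius) (x := e)
    rw [ArithmeticFunction.moebius_mul_coe_zeta, ArithmeticFunction.one_apply] at h
    rw [← Int.cast_sum, ← h]
    split_ifs <;> simp
  rw [squareDivisorMain]
  by_cases hcop : e.Coprime N
  · have h1 : ((N : ℝ) - 1) / (e ^ 2).totient * ∑ d₁ ∈ e.divisors,
          (ArithmeticFunction.moebius d₁ : ℝ) * coprimeLogSum (e * N) ((D : ℝ) / d₁) -
        (if e = 1 then singularSeries N * ((N : ℝ) - 1) else 0) =
        ((N : ℝ) - 1) / (e ^ 2).totient * ∑ d₁ ∈ e.divisors,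
          (ArithmeticFunction.moebius d₁ : ℝ) *
            (coprimeLogSum (e * N) ((D : ℝ) / d₁) - singularSeries (e * N)) := by
      simp only [mul_sub]
      rw [Finset.sum_sub_distrib, ← Finset.sum_mul, hmu]
      split_ifs with h
      · subst h
        simp
        ring
      · ring
    rw [if_pos hcop, h1, abs_mul]
    have htot : (1 : ℝ) ≤ (e ^ 2).totient := by
      exact_mod_cast Nat.totient_pos.2 (by positivity)
    have h2 : |((N : ℝ) - 1) / (e ^ 2).totient| ≤ N := by
      rw [abs_of_nonneg (div_nonneg (by linarith) (by linarith))]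
      exact (div_le_self (by linarith) htot).trans (by linarith)
    have h3 : |∑ d₁ ∈ e.divisors, (ArithmeticFunction.moebius d₁ : ℝ) *
            (coprimeLogSum (e * N) ((D : ℝ) / d₁) - singularSeries (e * N))| ≤ e * B := by
      calc _ ≤ ∑ d₁ ∈ e.divisors, B := by
            refine (Finset.abs_sum_le_sum_abs _ _).trans (Finset.sum_le_sum fun d hd => ?_)
            rw [abs_mul]
            calc _ ≤ 1 * B := mul_le_mul (abs_moebius_real_le d) (hB d hd) (abs_nonneg _)
                  zero_le_one
              _ = B := one_mul B
        _ = e.divisors.card * B := by rw [Finset.sum_const, nsmul_eq_mul]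
        _ ≤ _ := by
            gcongr
            exact Nat.card_divisors_le_self e
    exact mul_le_mul h2 h3 (abs_nonneg _) (by linarith)
  · have he1 : e ≠ 1 := fun h => hcop (h ▸ Nat.coprime_one_left N)
    rw [if_neg hcop, if_neg he1]
    simp
    positivity

/-- Equidistribution is used for `e ≤ E`, the trivial bound beyond. The factor `E²` is the number of
`e` times the crude bound `τ(e) ≤ E`; it is only a power of the logarithm in the application. -/
theorem abs_smallDivisorSum_sub_le {N D E Q : ℕ} (hDN : D ≤ N) (hE : 1 ≤ E) (hEN : E ≤ N)
    (hQ : D * E ^ 2 ≤ Q) {B : ℝ}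
    (hB : ∀ e ∈ Finset.Ioc 0 E, ∀ d ∈ e.divisors,
      |coprimeLogSum (e * N) ((D : ℝ) / d) - singularSeries (e * N)| ≤ B) :
    |smallDivisorSum N D - singularSeries N * ((N : ℝ) - 1)| ≤
      (E : ℝ) ^ 2 * (Real.log N * ∑ q ∈ Finset.Icc 1 Q, progressionError N q) +
        N * ((E : ℝ) ^ 2 * B) + 2 / E * (N * Real.log N ^ 2 * (1 + Real.log N) ^ 2) := by
  have hlN : 0 ≤ Real.log N := Real.log_natCast_nonneg N
  have hE1 : (1 : ℝ) ≤ E := by exact_mod_cast hE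
  have hN : 1 ≤ N := hE.trans hEN
  have hB0 : 0 ≤ B := (abs_nonneg _).trans
    (hB 1 (Finset.mem_Ioc.2 ⟨one_pos, hE⟩) 1 (Nat.one_mem_divisors.2 one_ne_zero))
  set ρ := ∑ q ∈ Finset.Icc 1 Q, progressionError N q with hρ
  have hρ0 : 0 ≤ ρ := Finset.sum_nonneg fun _ _ => abs_nonneg _
  have hone : singularSeries N * ((N : ℝ) - 1) = ∑ e ∈ Finset.Ioc 0 E,
      (ArithmeticFunction.moebius e : ℝ) * if e = 1 then singularSeries N * ((N : ℝ) - 1) else 0 := by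
    rw [Finset.sum_eq_single 1]
    · simp
    · intro e _ he
      rw [if_neg he, mul_zero]
    · intro h
      exact absurd (Finset.mem_Ioc.2 ⟨one_pos, hE⟩) h
  have hhead : ∀ e ∈ Finset.Ioc 0 E, |(ArithmeticFunction.moebius e : ℝ) * squareDivisorSum N D e -
      (ArithmeticFunction.moebius e : ℝ) *
        if e = 1 then singularSeries N * ((N : ℝ) - 1) else 0| ≤
      E * (Real.log N * ρ) + N * (E * B) := by
    intro e he
    obtain ⟨he1, he2⟩ := Finset.mem_Ioc.1 he
    have h1 := abs_squareDivisorSum_sub_main_le hDN (e := e) (by omega)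
    have h2 := abs_squareDivisorMain_sub_le hN (by omega) (hB e he)
    have heE : (e : ℝ) ≤ E := by exact_mod_cast he2
    -- For fixed `e` the moduli `d e²` are distinct and at most `D E² ≤ Q`, so no modulus is counted
    -- twice.
    have h3 : ∑ d ∈ Finset.Ioc 0 D, progressionError N (d * e ^ 2) ≤ ρ := by
      rw [← Finset.sum_image (f := progressionError N) (g := fun d => d * e ^ 2)
        fun x _ y _ h => Nat.eq_of_mul_eq_mul_right (by positivity) h]
      refine Finset.sum_le_sum_of_subset_of_nonneg ?_ fun _ _ _ => abs_nonneg _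
      intro q hq
      obtain ⟨d, hd, rfl⟩ := Finset.mem_image.1 hq
      obtain ⟨hd0, hdD⟩ := Finset.mem_Ioc.1 hd
      refine Finset.mem_Icc.2 ⟨Nat.mul_pos hd0 (by positivity), le_trans ?_ hQ⟩
      gcongr
    rw [← mul_sub, abs_mul]
    calc _ ≤ 1 * |squareDivisorSum N D e -
            if e = 1 then singularSeries N * ((N : ℝ) - 1) else 0| :=
          mul_le_mul_of_nonneg_right (abs_moebius_real_le e) (abs_nonneg _)
      _ ≤ e * (Real.log N * ∑ d ∈ Finset.Ioc 0 D, progressionError N (d * e ^ 2)) +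
            N * (e * B) := by
          rw [one_mul]
          exact (abs_sub_le _ _ _).trans (add_le_add h1 h2)
      _ ≤ _ := by
          have := mul_nonneg hlN hρ0
          exact add_le_add (mul_le_mul heE (mul_le_mul_of_nonneg_left h3 hlN)
            (mul_nonneg hlN (Finset.sum_nonneg fun _ _ => abs_nonneg _)) (by linarith)) (by gcongr)
  have htail : |∑ e ∈ Finset.Ioc E N,
      (ArithmeticFunction.moebius e : ℝ) * squareDivisorSum N D e| ≤
      2 / E * (N * Real.log N ^ 2 * (1 + Real.log N) ^ 2) := by
    calc _ ≤ ∑ e ∈ Finset.Ioc E N, (e.divisors.card : ℝ) / (e : ℝ) ^ 2 *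
          (N * Real.log N ^ 2 * (1 + Real.log N)) := by
          refine (Finset.abs_sum_le_sum_abs _ _).trans (Finset.sum_le_sum fun e he => ?_)
          have he0 := (Finset.mem_Ioc.1 he).1
          rw [abs_mul]
          calc _ ≤ 1 * |squareDivisorSum N D e| :=
                mul_le_mul_of_nonneg_right (abs_moebius_real_le e) (abs_nonneg _)
            _ ≤ _ := by
                rw [one_mul]
                exact abs_squareDivisorSum_le hDN (by omega)
      _ ≤ 2 / E * (1 + Real.log N) * (N * Real.log N ^ 2 * (1 + Real.log N)) := by
          rw [← Finset.sum_mul]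
          exact mul_le_mul_of_nonneg_right (sum_card_divisors_div_sq_le hE N) (by positivity)
      _ = _ := by ring
  rw [smallDivisorSum_eq, ← Finset.sum_Ioc_consecutive _ (Nat.zero_le E) hEN, hone,
    add_sub_right_comm, ← Finset.sum_sub_distrib]
  refine (abs_add_le _ _).trans (add_le_add ?_ htail)
  calc _ ≤ ∑ e ∈ Finset.Ioc 0 E, (E * (Real.log N * ρ) + N * (E * B)) :=
        (Finset.abs_sum_le_sum_abs _ _).trans (Finset.sum_le_sum hhead)
    _ = _ := by
        rw [Finset.sum_const, Nat.card_Ioc, nsmul_eq_mul, Nat.sub_zero]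
        ring

/-! ### Splitting the Goldbach sum, and the large divisors -/

/-- The part of the squarefree Goldbach sum that comes from the divisors beyond `D`. -/
def largeDivisorSum (N D : ℕ) : ℝ :=
  ∑ n ∈ Finset.Ico 1 N, ArithmeticFunction.vonMangoldt n *
    (ArithmeticFunction.moebius (N - n) : ℝ) ^ 2 *
      ∑ d ∈ (N - n).divisors with D < d, (ArithmeticFunction.moebius d : ℝ) * Real.log (d / D)

/-- Since `log (d / D) = -log (D / d)`, the left side is `∑_{d ∣ m} μ(d) (log D - log d)`; the `log
D` part vanishes unless `m = 1`. -/
lemma sum_moebius_mul_log_div {m D : ℕ} (hm : m ≠ 0) (hD : D ≠ 0) :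
    (∑ d ∈ Finset.Ioc 0 D with d ∣ m, (ArithmeticFunction.moebius d : ℝ) * Real.log (D / d)) -
      ∑ d ∈ m.divisors with D < d, (ArithmeticFunction.moebius d : ℝ) * Real.log (d / D) =
    ArithmeticFunction.vonMangoldt m + if m = 1 then Real.log D else 0 := by
  have hD0 : (D : ℝ) ≠ 0 := by positivity
  have hset : {d ∈ Finset.Ioc 0 D | d ∣ m} = {d ∈ m.divisors | ¬ D < d} := by
    ext d
    rw [Finset.mem_filter, Finset.mem_filter, Finset.mem_Ioc, Nat.mem_divisors, not_lt]
    constructor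
    · rintro ⟨⟨-, h1⟩, h2⟩
      exact ⟨⟨h2, hm⟩, h1⟩
    · rintro ⟨⟨h2, -⟩, h1⟩
      exact ⟨⟨Nat.pos_of_dvd_of_pos h2 (by omega), h1⟩, h2⟩
  have hmu : ∑ d ∈ m.divisors, (ArithmeticFunction.moebius d : ℝ) = if m = 1 then 1 else 0 := by
    have h := ArithmeticFunction.coe_mul_zeta_apply (f := ArithmeticFunction.moebius) (x := m)
    rw [ArithmeticFunction.moebius_mul_coe_zeta, ArithmeticFunction.one_apply] at h
    rw [← Int.cast_sum, ← h]
    split_ifs <;> simp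
  have hneg : ∑ d ∈ m.divisors with D < d, (ArithmeticFunction.moebius d : ℝ) * Real.log (d / D) =
      - ∑ d ∈ m.divisors with D < d, (ArithmeticFunction.moebius d : ℝ) * Real.log (D / d) := by
    rw [← Finset.sum_neg_distrib]
    refine Finset.sum_congr rfl fun d _ => ?_
    rw [← inv_div, Real.log_inv]
    ring
  rw [hset, hneg, sub_neg_eq_add, add_comm, Finset.sum_filter_add_sum_filter_not]
  have h1 : ∀ d ∈ m.divisors, (ArithmeticFunction.moebius d : ℝ) * Real.log (D / d) =
      (ArithmeticFunction.moebius d : ℝ) * Real.log D -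
        (ArithmeticFunction.moebius d : ℝ) * Real.log d := by
    intro d hd
    have : (d : ℝ) ≠ 0 := by exact_mod_cast (Nat.pos_of_mem_divisors hd).ne'
    rw [Real.log_div hD0 this]
    ring
  have h2 := ArithmeticFunction.sum_moebius_mul_log_eq (n := m)
  simp only [ArithmeticFunction.log_apply] at h2
  rw [Finset.sum_congr rfl h1, Finset.sum_sub_distrib, ← Finset.sum_mul, hmu, h2]
  split_ifs <;> ring

/-- The summand vanishes at primes, so the sum is at most Chebyshev's `ψ(N) - θ(N)`. -/
lemma sum_vonMangoldt_not_squarefree_le {N : ℕ} (hN : 1 ≤ N) :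
    ∑ m ∈ Finset.Ioc 0 N, ArithmeticFunction.vonMangoldt m *
      (1 - (ArithmeticFunction.moebius m : ℝ) ^ 2) ≤ 2 * √N * Real.log N := by
  have h := Chebyshev.psi_sub_theta_le (x := N) (by exact_mod_cast hN)
  rw [Chebyshev.psi_sub_theta_eq_sum_not_prime, Nat.floor_natCast, Finset.sum_filter] at h
  refine le_trans (Finset.sum_le_sum fun m _ => ?_) h
  have hL : 0 ≤ ArithmeticFunction.vonMangoldt m := ArithmeticFunction.vonMangoldt_nonneg
  by_cases hp : m.Prime
  · rw [ArithmeticFunction.moebius_apply_prime hp]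
    simp [hp]
  · rw [if_pos hp]
    nlinarith [sq_nonneg (ArithmeticFunction.moebius m : ℝ)]

/-- Two errors of opposite sign: the proper prime powers `N - n` killed by `μ²`, and the extra `log
D` at `n = N - 1`. -/
lemma abs_goldbachSum_sub_le {N D : ℕ} (hD : 1 ≤ D) (hDN : D ≤ N) :
    |goldbachSum N - (smallDivisorSum N D - largeDivisorSum N D)| ≤
      2 * √N * Real.log N ^ 2 + Real.log N ^ 2 := by
  have hN : 1 ≤ N := hD.trans hDN
  have hlN : 0 ≤ Real.log N := Real.log_natCast_nonneg N
  have hL : ∀ n, 0 ≤ ArithmeticFunction.vonMangoldt n := fun n =>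
    ArithmeticFunction.vonMangoldt_nonneg
  have hLl : ∀ n ∈ Finset.Ico 1 N, ArithmeticFunction.vonMangoldt n ≤ Real.log N := by
    intro n hn
    rw [Finset.mem_Ico] at hn
    exact ArithmeticFunction.vonMangoldt_le_log.trans
      (Real.log_le_log (by exact_mod_cast hn.1) (by exact_mod_cast hn.2.le))
  have hlD : 0 ≤ Real.log D := Real.log_natCast_nonneg D
  have hlDN : Real.log D ≤ Real.log N :=
    Real.log_le_log (by exact_mod_cast hD) (by exact_mod_cast hDN)
  have hdecomp : goldbachSum N - (smallDivisorSum N D - largeDivisorSum N D) =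
      (∑ n ∈ Finset.Ico 1 N, ArithmeticFunction.vonMangoldt n *
        (ArithmeticFunction.vonMangoldt (N - n) *
          (1 - (ArithmeticFunction.moebius (N - n) : ℝ) ^ 2))) -
      ∑ n ∈ Finset.Ico 1 N, ArithmeticFunction.vonMangoldt n *
        if N - n = 1 then Real.log D else 0 := by
    rw [goldbachSum, smallDivisorSum, largeDivisorSum, ← Finset.sum_sub_distrib,
      ← Finset.sum_sub_distrib, ← Finset.sum_sub_distrib]
    refine Finset.sum_congr rfl fun n hn => ?_
    rw [Finset.mem_Ico] at hn
    rw [← mul_sub, sum_moebius_mul_log_div (by omega) (by omega)]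
    by_cases h1 : N - n = 1
    · rw [if_pos h1, h1]
      simp
    · rw [if_neg h1]
      ring
  have hsq : ∀ m : ℕ, 0 ≤ ArithmeticFunction.vonMangoldt m *
      (1 - (ArithmeticFunction.moebius m : ℝ) ^ 2) := by
    intro m
    refine mul_nonneg (hL m) ?_
    have := abs_moebius_real_le m
    rw [sub_nonneg]
    exact (sq_le_one_iff_abs_le_one _).2 this
  have h1 : 0 ≤ ∑ n ∈ Finset.Ico 1 N, ArithmeticFunction.vonMangoldt n *
        (ArithmeticFunction.vonMangoldt (N - n) *
          (1 - (ArithmeticFunction.moebius (N - n) : ℝ) ^ 2)) :=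
    Finset.sum_nonneg fun n _ => mul_nonneg (hL n) (hsq _)
  have h2 : ∑ n ∈ Finset.Ico 1 N, ArithmeticFunction.vonMangoldt n *
        (ArithmeticFunction.vonMangoldt (N - n) *
          (1 - (ArithmeticFunction.moebius (N - n) : ℝ) ^ 2)) ≤ 2 * √N * Real.log N ^ 2 := by
    calc _ ≤ ∑ n ∈ Finset.Ico 1 N, Real.log N * (ArithmeticFunction.vonMangoldt (N - n) *
          (1 - (ArithmeticFunction.moebius (N - n) : ℝ) ^ 2)) :=
          Finset.sum_le_sum fun n hn => mul_le_mul_of_nonneg_right (hLl n hn) (hsq _)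
      _ = Real.log N * ∑ m ∈ (Finset.Ico 1 N).image (N - ·), ArithmeticFunction.vonMangoldt m *
          (1 - (ArithmeticFunction.moebius m : ℝ) ^ 2) := by
          rw [← Finset.mul_sum, Finset.sum_image]
          intro a ha b hb hab
          simp only [Finset.coe_Ico, Set.mem_Ico] at ha hb hab
          omega
      _ ≤ Real.log N * ∑ m ∈ Finset.Ioc 0 N, ArithmeticFunction.vonMangoldt m *
          (1 - (ArithmeticFunction.moebius m : ℝ) ^ 2) := by
          refine mul_le_mul_of_nonneg_left (Finset.sum_le_sum_of_subset_of_nonneg ?_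
            fun m _ _ => hsq m) hlN
          intro m hm
          obtain ⟨n, hn, rfl⟩ := Finset.mem_image.1 hm
          rw [Finset.mem_Ico] at hn
          exact Finset.mem_Ioc.2 ⟨by omega, by omega⟩
      _ ≤ Real.log N * (2 * √N * Real.log N) :=
          mul_le_mul_of_nonneg_left (sum_vonMangoldt_not_squarefree_le hN) hlN
      _ = _ := by ring
  have h3 : 0 ≤ ∑ n ∈ Finset.Ico 1 N, ArithmeticFunction.vonMangoldt n *
        if N - n = 1 then Real.log D else 0 :=
    Finset.sum_nonneg fun n _ => mul_nonneg (hL n) (by split_ifs <;> simp [hlD])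
  have h4 : ∑ n ∈ Finset.Ico 1 N, (ArithmeticFunction.vonMangoldt n *
        if N - n = 1 then Real.log D else 0) ≤ Real.log N ^ 2 := by
    calc _ ≤ ∑ n ∈ Finset.Ico 1 N, if n = N - 1 then Real.log N ^ 2 else 0 := by
          refine Finset.sum_le_sum fun n hn => ?_
          have := hLl n hn
          rw [Finset.mem_Ico] at hn
          by_cases h : N - n = 1
          · rw [if_pos h, if_pos (by omega), sq]
            exact mul_le_mul this hlDN hlD hlN
          · rw [if_neg h, if_neg (by omega), mul_zero]
      _ ≤ _ := by
          rw [Finset.sum_ite_eq']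
          split_ifs
          · exact le_rfl
          · positivity
  rw [hdecomp, abs_le]
  constructor <;> linarith [mul_nonneg (mul_nonneg zero_le_two (Real.sqrt_nonneg N)) (sq_nonneg (Real.log N)), sq_nonneg (Real.log N)]

/-- Switching a divisor of a squarefree number to the complementary divisor. -/
lemma moebius_sq_mul_sum_large_divisors {m D T : ℕ} (hm : m ≠ 0) (hD : D ≠ 0)
    (hT : ∀ k, k * D < m → k ≤ T) :
    (ArithmeticFunction.moebius m : ℝ) ^ 2 * ∑ d ∈ m.divisors with D < d,
      (ArithmeticFunction.moebius d : ℝ) * Real.log (d / D) =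
    ∑ k ∈ Finset.Ioc 0 T with k ∣ m ∧ k * D < m, (ArithmeticFunction.moebius m : ℝ) *
      ((ArithmeticFunction.moebius k : ℝ) * Real.log ((m : ℝ) / (k * D))) := by
  by_cases hsq : Squarefree m
  -- One factor `μ(m)` is common to both sides. With `m = dk` the other is `μ(d) μ(k)`, and `μ(d)² =
  -- 1` leaves `μ(k)`.
  · rw [← Finset.mul_sum, sq, mul_assoc, Finset.mul_sum]
    congr 1
    have hD0 : (D : ℝ) ≠ 0 := by positivity
    refine Finset.sum_bij' (fun d _ => m / d) (fun k _ => m / k) ?_ ?_ ?_ ?_ ?_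
    · intro d hd
      rw [Finset.mem_filter, Nat.mem_divisors] at hd
      obtain ⟨⟨hdm, -⟩, hDd⟩ := hd
      obtain ⟨k, rfl⟩ := hdm
      have hd0 : 0 < d := by omega
      have hk0 : 0 < k := Nat.pos_of_ne_zero (right_ne_zero_of_mul hm)
      rw [Nat.mul_div_cancel_left k hd0, Finset.mem_filter, Finset.mem_Ioc]
      have hlt : k * D < d * k := by
        rw [mul_comm d]
        exact Nat.mul_lt_mul_of_pos_left hDd hk0
      exact ⟨⟨hk0, hT k hlt⟩, dvd_mul_left k d, hlt⟩
    · intro k hk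
      rw [Finset.mem_filter, Finset.mem_Ioc] at hk
      obtain ⟨⟨hk0, -⟩, hkm, hlt⟩ := hk
      obtain ⟨d, rfl⟩ := hkm
      rw [Nat.mul_div_cancel_left d hk0, Finset.mem_filter, Nat.mem_divisors]
      exact ⟨⟨dvd_mul_left d k, hm⟩, Nat.lt_of_mul_lt_mul_left hlt⟩
    · intro d hd
      rw [Finset.mem_filter, Nat.mem_divisors] at hd
      exact Nat.div_div_self hd.1.1 hm
    · intro k hk
      rw [Finset.mem_filter] at hk
      exact Nat.div_div_self hk.2.1 hm
    · intro d hd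
      rw [Finset.mem_filter, Nat.mem_divisors] at hd
      obtain ⟨⟨hdm, -⟩, hDd⟩ := hd
      obtain ⟨k, rfl⟩ := hdm
      have hd0 : 0 < d := by omega
      have hk0 : 0 < k := Nat.pos_of_ne_zero (right_ne_zero_of_mul hm)
      rw [Nat.mul_div_cancel_left k hd0]
      have hcop := Nat.coprime_of_squarefree_mul hsq
      have hdsq : Squarefree d := hsq.squarefree_of_dvd (dvd_mul_right d k)
      have hmud : (ArithmeticFunction.moebius d : ℝ) ^ 2 = 1 := by
        exact_mod_cast ArithmeticFunction.moebius_sq_eq_one_of_squarefree hdsq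
      have hlog : ((d * k : ℕ) : ℝ) / (k * D) = d / D := by
        have : (k : ℝ) ≠ 0 := by positivity
        push_cast
        field_simp
      rw [hlog, ArithmeticFunction.isMultiplicative_moebius.map_mul_of_coprime hcop]
      push_cast
      linear_combination ((ArithmeticFunction.moebius k : ℝ) * Real.log (d / D)) * hmud
  · rw [ArithmeticFunction.moebius_eq_zero_of_not_squarefree hsq]
    simp

lemma largeDivisorSum_eq {N D T : ℕ} (hD : D ≠ 0) (hT : ∀ k, k * D < N → k ≤ T) :
    largeDivisorSum N D = ∑ k ∈ Finset.Ioc 0 T, (ArithmeticFunction.moebius k : ℝ) *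
      ∑ n ∈ Finset.Ico 1 N with k * D < N - n, (if k ∣ N - n then
        ArithmeticFunction.vonMangoldt n * (ArithmeticFunction.moebius (N - n) : ℝ) else 0) *
          Real.log (((N : ℝ) - n) / (k * D)) := by
  have h1 : largeDivisorSum N D = ∑ n ∈ Finset.Ico 1 N, ∑ k ∈ Finset.Ioc 0 T,
      (ArithmeticFunction.moebius k : ℝ) * if k * D < N - n then (if k ∣ N - n then
        ArithmeticFunction.vonMangoldt n * (ArithmeticFunction.moebius (N - n) : ℝ) else 0) *
          Real.log (((N : ℝ) - n) / (k * D)) else 0 := by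
    refine Finset.sum_congr rfl fun n hn => ?_
    rw [Finset.mem_Ico] at hn
    rw [mul_assoc, moebius_sq_mul_sum_large_divisors (by omega) hD
      (fun k hk => hT k (by omega)), Finset.sum_filter, Finset.mul_sum, Nat.cast_sub hn.2.le]
    refine Finset.sum_congr rfl fun k _ => ?_
    by_cases h1 : k ∣ N - n <;> by_cases h2 : k * D < N - n <;> simp only [h1, h2, if_true,
      if_false, and_true, and_false, and_self, mul_zero, zero_mul]
    ring
  rw [h1, Finset.sum_comm]
  refine Finset.sum_congr rfl fun k _ => ?_
  rw [Finset.sum_filter, Finset.mul_sum]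

/-- The expected main term of `largeDivisorSum`. -/
def largeDivisorMain (N D : ℕ) : ℝ :=
  ∑ n ∈ Finset.Ico 1 N, ArithmeticFunction.vonMangoldt n *
    (ArithmeticFunction.moebius (N - n) : ℝ) * coprimeLogSum N (((N : ℝ) - n) / D)

lemma largeDivisorMain_eq {N D T : ℕ} (hD : D ≠ 0) (hT : ∀ k, k * D < N → k ≤ T) :
    largeDivisorMain N D = ∑ k ∈ Finset.Ioc 0 T, (ArithmeticFunction.moebius k : ℝ) *
      ∑ n ∈ Finset.Ico 1 N with k * D < N - n, ((if k.Coprime N then 1 / (k.totient : ℝ) else 0) *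
        (ArithmeticFunction.vonMangoldt n * (ArithmeticFunction.moebius (N - n) : ℝ))) *
          Real.log (((N : ℝ) - n) / (k * D)) := by
  have hD0 : (0 : ℝ) < D := by positivity
  have h1 : largeDivisorMain N D = ∑ n ∈ Finset.Ico 1 N, ∑ k ∈ Finset.Ioc 0 T,
      (ArithmeticFunction.moebius k : ℝ) * if k * D < N - n then
        ((if k.Coprime N then 1 / (k.totient : ℝ) else 0) *
        (ArithmeticFunction.vonMangoldt n * (ArithmeticFunction.moebius (N - n) : ℝ))) *
          Real.log (((N : ℝ) - n) / (k * D)) else 0 := by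
    refine Finset.sum_congr rfl fun n hn => ?_
    rw [Finset.mem_Ico] at hn
    have hcast : ((N - n : ℕ) : ℝ) = (N : ℝ) - n := Nat.cast_sub hn.2.le
    have hsub : {k ∈ Finset.Ioc 0 T | k * D < N - n} ⊆ Finset.Ioc 0 ⌊((N : ℝ) - n) / D⌋₊ := by
      intro k hk
      rw [Finset.mem_filter, Finset.mem_Ioc] at hk
      refine Finset.mem_Ioc.2 ⟨hk.1.1, Nat.le_floor ?_⟩
      rw [le_div_iff₀ hD0, ← hcast]
      exact_mod_cast hk.2.le
    rw [coprimeLogSum, ← Finset.sum_subset hsub, Finset.sum_filter, Finset.mul_sum]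
    · refine Finset.sum_congr rfl fun k _ => ?_
      rw [coprimeMoebiusTotient_apply, div_div, mul_comm (D : ℝ)]
      split_ifs <;> ring
    -- The leftover indices have `kD = N - n` exactly, where the logarithm is 0. This reconciles the
    -- strict inequality with the floor.
    · intro k hk hk'
      obtain ⟨hk0, hkf⟩ := Finset.mem_Ioc.1 hk
      have hk0' : (0 : ℝ) < k := by exact_mod_cast hk0
      have h2 : k * D ≤ N - n := by
        have := (Nat.le_floor_iff' hk0.ne').1 hkf
        rw [le_div_iff₀ hD0, ← hcast] at this
        exact_mod_cast this
      have h3 : ¬ k * D < N - n := by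
        intro h
        refine hk' (Finset.mem_filter.2 ⟨Finset.mem_Ioc.2 ⟨hk0, hT k (by omega)⟩, h⟩)
      have h4 : (N : ℝ) - n = k * D := by
        rw [← hcast, ← Nat.cast_mul, (by omega : N - n = k * D)]
      rw [h4, mul_div_assoc, div_self hD0.ne', mul_one, div_self hk0'.ne', Real.log_one, mul_zero]
  rw [h1, Finset.sum_comm]
  refine Finset.sum_congr rfl fun k _ => ?_
  rw [Finset.sum_filter, Finset.mul_sum]

/-- For fixed `k` the weight `log ((N - n) / (kD))` is nonnegative, decreasing in `n` and at most
`log N`, so Abel's inequality needs only bounds for partial sums that are uniform in `y`. -/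
lemma abs_largeDivisorSum_sub_main_le {N D T : ℕ} (hD : D ≠ 0) (hT : ∀ k, k * D < N → k ≤ T)
    {R : ℕ → ℝ} (hR : ∀ k, 1 ≤ k → ∀ y < N, |(∑ n ∈ Finset.Ioc 0 y with k ∣ N - n,
        ArithmeticFunction.vonMangoldt n * (ArithmeticFunction.moebius (N - n) : ℝ)) -
      (if k.Coprime N then 1 / (k.totient : ℝ) else 0) * ∑ n ∈ Finset.Ioc 0 y,
        ArithmeticFunction.vonMangoldt n * (ArithmeticFunction.moebius (N - n) : ℝ)| ≤ R k) :
    |largeDivisorSum N D - largeDivisorMain N D| ≤ Real.log N * ∑ k ∈ Finset.Icc 1 T, R k := by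
  have hlN : 0 ≤ Real.log N := Real.log_natCast_nonneg N
  rcases Nat.eq_zero_or_pos N with rfl | hN
  · simp [largeDivisorSum, largeDivisorMain]
  have hIoc : Finset.Icc 1 T = Finset.Ioc 0 T := by ext; simp; omega
  rw [largeDivisorSum_eq hD hT, largeDivisorMain_eq hD hT, ← Finset.sum_sub_distrib, hIoc,
    Finset.mul_sum]
  refine (Finset.abs_sum_le_sum_abs _ _).trans (Finset.sum_le_sum fun k hk => ?_)
  have hk0 := (Finset.mem_Ioc.1 hk).1
  have hR0 : 0 ≤ R k := (abs_nonneg _).trans (hR k hk0 0 hN)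
  rw [← mul_sub, abs_mul, ← Finset.sum_sub_distrib]
  simp only [← sub_mul]
  -- An initial interval, as summation by parts requires; truncated subtraction makes it empty when
  -- `kD ≥ N`.
  have hset : {n ∈ Finset.Ico 1 N | k * D < N - n} = Finset.Ioc 0 (N - k * D - 1) := by
    ext n
    rw [Finset.mem_filter, Finset.mem_Ico, Finset.mem_Ioc]
    omega
  rw [hset]
  have hmain : |∑ n ∈ Finset.Ioc 0 (N - k * D - 1), ((if k ∣ N - n then
        ArithmeticFunction.vonMangoldt n * (ArithmeticFunction.moebius (N - n) : ℝ) else 0) -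
        (if k.Coprime N then 1 / (k.totient : ℝ) else 0) *
        (ArithmeticFunction.vonMangoldt n * (ArithmeticFunction.moebius (N - n) : ℝ))) *
          Real.log (((N : ℝ) - n) / (k * D))| ≤ R k * Real.log N := by
    by_cases hkD : k * D < N
    · have hkD1 : 1 ≤ k * D := Nat.mul_pos hk0 (by omega)
      have hkD1' : (1 : ℝ) ≤ (k : ℝ) * D := by exact_mod_cast hkD1
      refine abs_sum_Ioc_mul_le (w := fun n => Real.log (((N : ℝ) - n) / (k * D)))
        (Nat.zero_le _) ?_ ?_ ?_ ?_
      · intro j _ hj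
        rw [Finset.sum_sub_distrib, ← Finset.sum_filter, ← Finset.mul_sum]
        exact hR k hk0 j (by omega)
      · intro j _ hj
        have h1 : j + 1 < N := by omega
        have h2 : ((j + 1 : ℕ) : ℝ) < N := by exact_mod_cast h1
        refine Real.log_le_log (div_pos (by linarith) (by linarith)) ?_
        gcongr
        omega
      · refine Real.log_nonneg ((one_le_div (by linarith)).2 ?_)
        rw [← Nat.cast_sub (by omega)]
        have : k * D ≤ N - (N - k * D - 1) := by omega
        exact_mod_cast this
      · rw [Nat.cast_zero, sub_zero]
        have hN0 : (0 : ℝ) < N := by exact_mod_cast hN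
        exact Real.log_le_log (by positivity) (div_le_self hN0.le hkD1')
    · rw [(by omega : N - k * D - 1 = 0)]
      simpa using mul_nonneg hR0 hlN
  calc _ ≤ 1 * (R k * Real.log N) :=
        mul_le_mul (abs_moebius_real_le k) hmain (abs_nonneg _) zero_le_one
    _ = _ := by ring

lemma abs_coprimeLogSum_le (M : ℕ) {x : ℝ} (hx : 0 ≤ x) :
    |coprimeLogSum M x| ≤ x * |Real.log x| := by
  rw [coprimeLogSum]
  calc _ ≤ ∑ k ∈ Finset.Ioc 0 ⌊x⌋₊, |Real.log x| := by
        refine (Finset.abs_sum_le_sum_abs _ _).trans (Finset.sum_le_sum fun k hk => ?_)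
        obtain ⟨hk0, hkx⟩ := Finset.mem_Ioc.1 hk
        have hk1 : (1 : ℝ) ≤ k := by exact_mod_cast hk0
        have hkx' : (k : ℝ) ≤ x := (Nat.le_floor_iff' hk0.ne').1 hkx
        have hg : |coprimeMoebiusTotient M k| ≤ 1 := by
          rw [coprimeMoebiusTotient_apply]
          split_ifs
          · have htot : (1 : ℝ) ≤ k.totient := by exact_mod_cast Nat.totient_pos.2 hk0
            rw [abs_div, abs_of_nonneg (by linarith : (0 : ℝ) ≤ k.totient)]
            exact (div_le_one (by linarith)).2 ((abs_moebius_real_le k).trans htot)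
          · simp
        have h1 : 0 ≤ Real.log (x / k) :=
          Real.log_nonneg ((one_le_div (by linarith)).2 hkx')
        have h2 : Real.log (x / k) ≤ |Real.log x| :=
          (Real.log_le_log (div_pos (by linarith) (by linarith)) (div_le_self hx hk1)).trans
            (le_abs_self _)
        rw [abs_mul, abs_of_nonneg h1]
        calc _ ≤ 1 * |Real.log x| := mul_le_mul hg h2 h1 zero_le_one
          _ = _ := one_mul _
    _ = ⌊x⌋₊ * |Real.log x| := by rw [Finset.sum_const, Nat.card_Ioc, nsmul_eq_mul, Nat.sub_zero]
    _ ≤ _ := mul_le_mul_of_nonneg_right (Nat.floor_le hx) (abs_nonneg _)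

/-- The limit is usable when `(N - n) / D ≥ P`. The exceptional `n` have `N - n < DP`, so they
number at most `DP`, and there `coprimeLogSum` is bounded trivially. -/
lemma abs_largeDivisorMain_sub_le {N D : ℕ} (hD : 1 ≤ D) (hDN : D ≤ N) {B P : ℝ} (hP : 0 ≤ P)
    (hS : 0 ≤ singularSeries N)
    (hB : ∀ x : ℝ, P ≤ x → x ≤ N → |coprimeLogSum N x - singularSeries N| ≤ B) (hB0 : 0 ≤ B) :
    |largeDivisorMain N D - singularSeries N * moebiusTwistedSum N| ≤
      N * Real.log N * B + D * P * (Real.log N * (P * Real.log N + singularSeries N)) := by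
  have hlN : 0 ≤ Real.log N := Real.log_natCast_nonneg N
  have hD1 : (1 : ℝ) ≤ D := by exact_mod_cast hD
  have hterm : ∀ n ∈ Finset.Ico 1 N, |coprimeLogSum N (((N : ℝ) - n) / D) - singularSeries N| ≤
      B + if ((N : ℝ) - n) < D * P then P * Real.log N + singularSeries N else 0 := by
    intro n hn
    rw [Finset.mem_Ico] at hn
    have hn1 : (1 : ℝ) ≤ n := by exact_mod_cast hn.1
    have hm1 : (1 : ℝ) ≤ (N : ℝ) - n := by
      rw [← Nat.cast_sub hn.2.le]
      have : 1 ≤ N - n := by omega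
      exact_mod_cast this
    have hx0 : 0 < ((N : ℝ) - n) / D := div_pos (by linarith) (by linarith)
    have hxN : ((N : ℝ) - n) / D ≤ N := (div_le_self (by linarith) hD1).trans (by linarith)
    split_ifs with h
    · have hxP : ((N : ℝ) - n) / D ≤ P := by
        rw [div_le_iff₀ (by linarith), mul_comm]
        exact h.le
      have hlog : |Real.log (((N : ℝ) - n) / D)| ≤ Real.log N := by
        rw [abs_le]
        constructor
        · have hN0 : (0 : ℝ) < N := by linarith
          rw [← Real.log_inv]
          refine Real.log_le_log (by positivity) ?_
          rw [le_div_iff₀ (by linarith)]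
          have hDN' : (D : ℝ) ≤ N := by exact_mod_cast hDN
          calc (N : ℝ)⁻¹ * D ≤ (N : ℝ)⁻¹ * N := by gcongr
            _ = 1 := inv_mul_cancel₀ hN0.ne'
            _ ≤ _ := hm1
        · exact Real.log_le_log hx0 hxN
      calc _ ≤ |coprimeLogSum N (((N : ℝ) - n) / D)| + |singularSeries N| := abs_sub _ _
        _ ≤ P * Real.log N + singularSeries N := by
            rw [abs_of_nonneg hS]
            gcongr
            exact (abs_coprimeLogSum_le N hx0.le).trans
              (mul_le_mul hxP hlog (abs_nonneg _) hP)
        _ ≤ _ := by linarith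
    · rw [add_zero]
      refine hB _ ?_ hxN
      rw [le_div_iff₀ (by linarith), mul_comm]
      exact not_lt.1 h
  have hQ0 : 0 ≤ P * Real.log N + singularSeries N := by positivity
  have hcard : (((Finset.Ico 1 N).filter fun n : ℕ => ((N : ℝ) - n) < D * P).card : ℝ) ≤ D * P := by
    have h1 : ((Finset.Ico 1 N).filter fun n : ℕ => ((N : ℝ) - n) < D * P).card ≤ (Finset.Ioc 0 ⌊D * P⌋₊).card := by
      refine Finset.card_le_card_of_injOn (fun n => N - n) ?_ ?_
      · intro n hn
        simp only [Finset.coe_filter, Finset.mem_Ico, Set.mem_ofPred_eq, Finset.coe_Ioc,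
          Set.mem_Ioc] at hn ⊢
        refine ⟨by omega, Nat.le_floor ?_⟩
        rw [Nat.cast_sub hn.1.2.le]
        exact hn.2.le
      · intro a ha b hb hab
        simp only [Finset.coe_filter, Finset.mem_Ico, Set.mem_ofPred_eq] at ha hb hab
        omega
    rw [Nat.card_Ioc, Nat.sub_zero] at h1
    calc _ ≤ (⌊D * P⌋₊ : ℝ) := by exact_mod_cast h1
      _ ≤ _ := Nat.floor_le (by positivity)
  have hdiff : largeDivisorMain N D - singularSeries N * moebiusTwistedSum N =
      ∑ n ∈ Finset.Ico 1 N, ArithmeticFunction.vonMangoldt n *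
        (ArithmeticFunction.moebius (N - n) : ℝ) *
          (coprimeLogSum N (((N : ℝ) - n) / D) - singularSeries N) := by
    rw [largeDivisorMain, moebiusTwistedSum, Finset.mul_sum, ← Finset.sum_sub_distrib]
    refine Finset.sum_congr rfl fun n _ => ?_
    ring
  rw [hdiff]
  calc _ ≤ ∑ n ∈ Finset.Ico 1 N, Real.log N *
        (B + if ((N : ℝ) - n) < D * P then P * Real.log N + singularSeries N else 0) := by
        refine (Finset.abs_sum_le_sum_abs _ _).trans (Finset.sum_le_sum fun n hn => ?_)
        have hL0 : 0 ≤ ArithmeticFunction.vonMangoldt n := ArithmeticFunction.vonMangoldt_nonneg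
        have h2 := hterm n hn
        rw [Finset.mem_Ico] at hn
        have hL : ArithmeticFunction.vonMangoldt n ≤ Real.log N :=
          ArithmeticFunction.vonMangoldt_le_log.trans
            (Real.log_le_log (by exact_mod_cast hn.1) (by exact_mod_cast hn.2.le))
        rw [abs_mul, abs_mul, abs_of_nonneg hL0]
        calc _ ≤ Real.log N * 1 * _ := mul_le_mul (mul_le_mul hL (abs_moebius_real_le _)
              (abs_nonneg _) hlN) h2 (abs_nonneg _) (by linarith)
          _ = _ := by rw [mul_one]
    _ = Real.log N * (((N - 1 : ℕ) : ℝ) * B + (((Finset.Ico 1 N).filter fun n : ℕ => ((N : ℝ) - n) < D * P).card : ℝ) *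
          (P * Real.log N + singularSeries N)) := by
        rw [← Finset.mul_sum, Finset.sum_add_distrib, ← Finset.sum_filter, Finset.sum_const,
          Finset.sum_const, Nat.card_Ico, nsmul_eq_mul, nsmul_eq_mul]
    _ ≤ Real.log N * ((N : ℝ) * B + D * P * (P * Real.log N + singularSeries N)) := by
        gcongr
        omega
    _ = _ := by ring

/-! ### Primes with squarefree complement -/

/-- The sum of `Λ(n)` over the `n < N` such that `N - n` is squarefree. -/
def squarefreeSum (N : ℕ) : ℝ :=
  ∑ n ∈ Finset.Ico 1 N, ArithmeticFunction.vonMangoldt n *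
    (ArithmeticFunction.moebius (N - n) : ℝ) ^ 2

/-- From `μ ≤ μ²`: this is the inequality that turns the asymptotic formula into the
unconditional-sign lower bound with `1 - 𝒜(N)`. -/
lemma moebiusTwistedSum_le_squarefreeSum (N : ℕ) : moebiusTwistedSum N ≤ squarefreeSum N := by
  refine Finset.sum_le_sum fun n _ =>
    mul_le_mul_of_nonneg_left ?_ ArithmeticFunction.vonMangoldt_nonneg
  have h : ArithmeticFunction.moebius (N - n) ≤ ArithmeticFunction.moebius (N - n) ^ 2 :=
    Int.le_self_sq _
  exact_mod_cast h

lemma squarefreeSum_eq (N : ℕ) : squarefreeSum N = ∑ e ∈ Finset.Ioc 0 N,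
    (ArithmeticFunction.moebius e : ℝ) * mangoldtProgression N (e ^ 2) := by
  have h1 : squarefreeSum N = ∑ n ∈ Finset.Ico 1 N, ∑ e ∈ Finset.Ioc 0 N,
      (ArithmeticFunction.moebius e : ℝ) *
        if e ^ 2 ∣ N - n then ArithmeticFunction.vonMangoldt n else 0 := by
    refine Finset.sum_congr rfl fun n hn => ?_
    rw [Finset.mem_Ico] at hn
    rw [moebius_sq_eq_sum (by omega : 1 ≤ N - n) (Nat.sub_le N n), Finset.sum_filter,
      Finset.mul_sum]
    refine Finset.sum_congr rfl fun e _ => ?_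
    split_ifs <;> ring
  rw [h1, Finset.sum_comm]
  refine Finset.sum_congr rfl fun e _ => ?_
  rw [mangoldtProgression, Finset.sum_filter, Finset.mul_sum]

/-- Equidistribution modulo `e²` for `e ≤ E`, a trivial count beyond, and the tail of the series for
`𝒜(N)`. The final `E` pays for replacing `N - 1` by `N`. -/
lemma abs_squarefreeSum_sub_le {N E Q : ℕ} (hN : Even N) (hE : 1 ≤ E) (hEN : E ≤ N)
    (hQ : E ^ 2 ≤ Q) :
    |squarefreeSum N - artinFactor N * N| ≤ ∑ q ∈ Finset.Icc 1 Q, progressionError N q +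
      2 / E * (Real.log N * N) + (5 + 2 * Real.log E) / E * N + E := by
  have hlN : 0 ≤ Real.log N := Real.log_natCast_nonneg N
  have hE0 : (0 : ℝ) < E := by exact_mod_cast hE
  have hhead : |∑ e ∈ Finset.Ioc 0 E, (ArithmeticFunction.moebius e : ℝ) *
      mangoldtProgression N (e ^ 2) - (∑ e ∈ Finset.Ioc 0 E, artinWeight N e) * ((N : ℝ) - 1)| ≤
      ∑ q ∈ Finset.Icc 1 Q, progressionError N q := by
    rw [Finset.sum_mul, ← Finset.sum_sub_distrib]
    calc _ ≤ ∑ e ∈ Finset.Ioc 0 E, progressionError N (e ^ 2) := by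
          refine (Finset.abs_sum_le_sum_abs _ _).trans (Finset.sum_le_sum fun e _ => ?_)
          have h1 : (ArithmeticFunction.moebius e : ℝ) * mangoldtProgression N (e ^ 2) -
              artinWeight N e * ((N : ℝ) - 1) = (ArithmeticFunction.moebius e : ℝ) *
              (mangoldtProgression N (e ^ 2) -
                if (e ^ 2).Coprime N then ((N : ℝ) - 1) / (e ^ 2).totient else 0) := by
            rw [artinWeight]
            simp only [Nat.coprime_pow_left_iff two_pos]
            split_ifs <;> ring
          rw [h1, abs_mul]
          calc _ ≤ 1 * progressionError N (e ^ 2) :=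
                mul_le_mul_of_nonneg_right (abs_moebius_real_le e) (abs_nonneg _)
            _ = _ := one_mul _
      _ = ∑ q ∈ (Finset.Ioc 0 E).image (· ^ 2), progressionError N q := by
          rw [Finset.sum_image fun a _ b _ h => Nat.pow_left_injective two_ne_zero h]
      _ ≤ _ := by
          refine Finset.sum_le_sum_of_subset_of_nonneg ?_ fun _ _ _ => abs_nonneg _
          intro q hq
          obtain ⟨e, he, rfl⟩ := Finset.mem_image.1 hq
          obtain ⟨he0, heE⟩ := Finset.mem_Ioc.1 he
          exact Finset.mem_Icc.2 ⟨Nat.pow_pos he0, (Nat.pow_le_pow_left heE 2).trans hQ⟩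
  have htail : |∑ e ∈ Finset.Ioc E N, (ArithmeticFunction.moebius e : ℝ) *
      mangoldtProgression N (e ^ 2)| ≤ 2 / E * (Real.log N * N) := by
    calc _ ≤ ∑ e ∈ Finset.Ioc E N, ((e : ℝ) ^ 2)⁻¹ * (Real.log N * N) := by
          refine (Finset.abs_sum_le_sum_abs _ _).trans (Finset.sum_le_sum fun e _ => ?_)
          rw [abs_mul, abs_of_nonneg (mangoldtProgression_nonneg N _)]
          calc _ ≤ 1 * (Real.log N * (N / (e ^ 2 : ℕ))) :=
                mul_le_mul (abs_moebius_real_le e) (mangoldtProgression_le N _)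
                  (mangoldtProgression_nonneg N _) zero_le_one
            _ = _ := by push_cast; ring
      _ = (∑ e ∈ Finset.Ioo E (N + 1), ((e : ℝ) ^ 2)⁻¹) * (Real.log N * N) := by
          rw [Finset.sum_mul]
          refine Finset.sum_congr ?_ fun _ _ => rfl
          ext e
          rw [Finset.mem_Ioc, Finset.mem_Ioo]
          omega
      _ ≤ 2 / ((E : ℝ) + 1) * (Real.log N * N) := by
          gcongr
          exact sum_Ioo_inv_sq_le _ _
      _ ≤ _ := by
          gcongr
          linarith
  have hone : |∑ e ∈ Finset.Ioc 0 E, artinWeight N e| ≤ E := by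
    calc _ ≤ ∑ e ∈ Finset.Ioc 0 E, (1 : ℝ) := by
          refine (Finset.abs_sum_le_sum_abs _ _).trans (Finset.sum_le_sum fun e he => ?_)
          have he0 := (Finset.mem_Ioc.1 he).1
          have htot : (1 : ℝ) ≤ (e ^ 2).totient := by
            exact_mod_cast Nat.totient_pos.2 (by positivity)
          refine (abs_artinWeight_le N e).trans ?_
          exact (div_le_one (by linarith)).2 htot
      _ = E := by simp
  have hart := abs_artinFactor_sub_sum_le hN hE
  rw [squarefreeSum_eq, ← Finset.sum_Ioc_consecutive _ (Nat.zero_le E) hEN]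
  set H := ∑ e ∈ Finset.Ioc 0 E, (ArithmeticFunction.moebius e : ℝ) *
      mangoldtProgression N (e ^ 2)
  set T := ∑ e ∈ Finset.Ioc E N, (ArithmeticFunction.moebius e : ℝ) *
      mangoldtProgression N (e ^ 2)
  set W := ∑ e ∈ Finset.Ioc 0 E, artinWeight N e
  have hart' : |(artinFactor N - W) * N| ≤ (5 + 2 * Real.log E) / E * N := by
    rw [abs_mul, Nat.abs_cast]
    gcongr
  have hsplit : H + T - artinFactor N * N =
      (H - W * ((N : ℝ) - 1)) + T - (artinFactor N - W) * N - W := by ring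
  rw [hsplit]
  calc _ ≤ |H - W * ((N : ℝ) - 1)| + |T| + |(artinFactor N - W) * N| + |W| :=
        (abs_sub _ _).trans (add_le_add_left ((abs_sub _ _).trans
          (add_le_add_left (abs_add_le _ _) _)) _)
    _ ≤ _ := by gcongr

/-! ### Choice of parameters and conclusion -/

lemma rpow_div_pow_le {l a b : ℝ} {j : ℕ} (hl : 1 ≤ l) (h : b + a ≤ j) :
    l ^ b / l ^ j ≤ 1 / l ^ a := by
  have hl0 : 0 < l := by linarith
  rw [div_le_div_iff₀ (by positivity) (by positivity), one_mul, ← Real.rpow_add hl0,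
    ← Real.rpow_natCast]
  exact Real.rpow_le_rpow_of_exponent_le hl h

/-- A bound for all large even `N` extends to all even `N ≥ 2`. -/
lemma exists_bound_of_eventually {f g : ℕ → ℝ} (hg : ∀ N, 2 ≤ N → 0 < g N) {K : ℝ}
    (h : ∀ᶠ N in atTop, Even N → |f N| ≤ K * g N) :
    ∃ K : ℝ, 0 ≤ K ∧ ∀ N, 2 ≤ N → Even N → |f N| ≤ K * g N := by
  obtain ⟨N₀, hN₀⟩ := eventually_atTop.1 h
  refine ⟨|K| + ∑ n ∈ Finset.range N₀, |f n| / |g n|, ?_, fun N hN hE => ?_⟩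
  · exact add_nonneg (abs_nonneg _) (Finset.sum_nonneg fun _ _ => by positivity)
  have hgN := hg N hN
  have h0 : 0 ≤ ∑ n ∈ Finset.range N₀, |f n| / |g n| :=
    Finset.sum_nonneg fun _ _ => by positivity
  rcases le_or_gt N₀ N with hle | hlt
  · refine (hN₀ N hle hE).trans (mul_le_mul_of_nonneg_right ?_ hgN.le)
    linarith [le_abs_self K]
  · have h1 : |f N| / |g N| ≤ ∑ n ∈ Finset.range N₀, |f n| / |g n| :=
      Finset.single_le_sum (f := fun n => |f n| / |g n|) (fun _ _ => by positivity)
        (Finset.mem_range.2 hlt)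
    rw [abs_of_pos hgN, div_le_iff₀ hgN] at h1
    refine h1.trans (mul_le_mul_of_nonneg_right ?_ hgN.le)
    linarith [abs_nonneg K]

lemma eventually_log_rpow_le (b : ℝ) {s : ℝ} (hs : 0 < s) :
    ∀ᶠ N : ℕ in atTop, Real.log N ^ b ≤ (N : ℝ) ^ s := by
  have h := ((isLittleO_log_rpow_rpow_atTop b hs).comp_tendsto tendsto_natCast_atTop_atTop).bound
    one_pos
  filter_upwards [h] with N hN
  simp only [Function.comp_apply, one_mul, Real.norm_eq_abs] at hN
  rw [abs_of_nonneg (Real.rpow_nonneg (Real.log_natCast_nonneg N) _),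
    abs_of_nonneg (by positivity)] at hN
  exact hN

lemma eventually_le_log_natCast (b : ℝ) : ∀ᶠ N : ℕ in atTop, b ≤ Real.log N :=
  (Real.tendsto_log_atTop.comp tendsto_natCast_atTop_atTop).eventually_ge_atTop b

/-- The truncation parameter for the square divisors, about `(log N) ^ b`. -/
def squareCutoff (b : ℝ) (N : ℕ) : ℕ := ⌊Real.log N ^ b / 2⌋₊

lemma squareCutoff_le (b : ℝ) (N : ℕ) : (squareCutoff b N : ℝ) ≤ Real.log N ^ b / 2 :=
  Nat.floor_le (div_nonneg (Real.rpow_nonneg (Real.log_natCast_nonneg N) _) zero_le_two)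

lemma le_squareCutoff {b : ℝ} {N : ℕ} (h : 4 ≤ Real.log N ^ b) :
    Real.log N ^ b / 4 ≤ squareCutoff b N := by
  have := Nat.lt_floor_add_one (Real.log N ^ b / 2)
  rw [squareCutoff]
  linarith

lemma sq_squareCutoff_le {b : ℝ} {N : ℕ} (hN : 1 < Real.log N) :
    (squareCutoff b N : ℝ) ^ 2 ≤ Real.log N ^ (2 * b) / 4 := by
  have h := squareCutoff_le b N
  have h2 : (Real.log N ^ b) ^ 2 = Real.log N ^ (2 * b) := by
    rw [← Real.rpow_mul_natCast (by linarith)]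
    congr 1
    push_cast
    ring
  calc (squareCutoff b N : ℝ) ^ 2 ≤ (Real.log N ^ b / 2) ^ 2 := by gcongr
    _ = _ := by rw [div_pow, h2]; norm_num

/-- The exponent is `A + 1` because the error will be multiplied by `𝔖(N) = O(log N)`. The cutoff `E
≍ (log N) ^ (A + 4)` keeps `E²` within the range of moduli. -/
theorem squarefreeSum_sub_artinFactor_bound {A θ : ℝ} (hA : 0 < A) (hθ₀ : 0 < θ) (hθ₁ : θ < 1)
    (h : ElliottHalberstam θ (2 * A + 8)) :
    ∃ K : ℝ, 0 ≤ K ∧ ∀ N : ℕ, 2 ≤ N → Even N →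
      |squarefreeSum N - artinFactor N * N| ≤ K * ((N : ℝ) / Real.log N ^ (A + 1)) := by
  obtain ⟨j, hj⟩ := exists_nat_ge (A + 1)
  obtain ⟨K₁, hK₁, h₁⟩ := sum_progressionError_bound hθ₁ h j
  obtain ⟨K₂, hK₂, h₂⟩ := rpow_mul_log_pow_le 0 j (a := 1 / 2) (by norm_num)
  refine exists_bound_of_eventually (K := K₁ + 8 + 28 + K₂) (fun N hN => ?_) ?_
  · have hl := half_lt_log hN
    have : (0 : ℝ) < N := by exact_mod_cast (by omega : 0 < N)
    have : 0 < Real.log N := by linarith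
    positivity
  filter_upwards [eventually_ge_atTop 2, eventually_le_log_natCast 4,
    eventually_log_rpow_le (A + 4) (s := 1 / 2) (by norm_num)] with N hN hl hsqrt hEven
  have hN2 : (2 : ℝ) ≤ N := by exact_mod_cast hN
  have hl1 : 1 ≤ Real.log N := by linarith
  have hl0 : 0 < Real.log N := by linarith
  have h4 : 4 ≤ Real.log N ^ (A + 4) := by
    calc (4 : ℝ) ≤ Real.log N ^ (1 : ℝ) := by rwa [Real.rpow_one]
      _ ≤ _ := Real.rpow_le_rpow_of_exponent_le hl1 (by linarith)
  set E := squareCutoff (A + 4) N with hE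
  have hE1 := le_squareCutoff h4
  have hE2 := squareCutoff_le (A + 4) N
  rw [← hE] at hE1 hE2
  have hEpos : 1 ≤ E := by
    have : (1 : ℝ) ≤ E := by linarith
    exact_mod_cast this
  have hE0 : (0 : ℝ) < E := by linarith
  have hsqrtN : (N : ℝ) ^ (1 / 2 : ℝ) ≤ N := by
    calc _ ≤ (N : ℝ) ^ (1 : ℝ) := Real.rpow_le_rpow_of_exponent_le (by linarith) (by norm_num)
      _ = _ := Real.rpow_one _
  have hEN' : (E : ℝ) ≤ N := by linarith
  have hEN : E ≤ N := by exact_mod_cast hEN'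
  have hQ : E ^ 2 ≤ ⌊(N : ℝ) ^ θ * Real.log N ^ (2 * A + 8)⌋₊ := by
    refine Nat.le_floor ?_
    have h3 := sq_squareCutoff_le (b := A + 4) (N := N) (by linarith)
    rw [← hE, (by ring : 2 * (A + 4) = 2 * A + 8)] at h3
    have h5 : 1 ≤ (N : ℝ) ^ θ := Real.one_le_rpow (by linarith) hθ₀.le
    have h6 : 0 < Real.log N ^ (2 * A + 8) := Real.rpow_pos_of_pos hl0 _
    push_cast
    nlinarith
  have hmain := abs_squarefreeSum_sub_le hEven hEpos hEN hQ
  set X := (N : ℝ) / Real.log N ^ (A + 1) with hX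
  have hX0 : 0 < X := by positivity
  have hjX : (N : ℝ) / Real.log N ^ j ≤ X := by
    rw [hX, ← Real.rpow_natCast]
    gcongr
  have hEX : 1 / (E : ℝ) * (Real.log N * N) ≤ 4 * X := by
    have h7 : Real.log N ^ (A + 4) = Real.log N ^ (A + 1) * Real.log N ^ 3 := by
      rw [← Real.rpow_natCast, ← Real.rpow_add hl0]
      congr 1
      push_cast
      ring
    calc 1 / (E : ℝ) * (Real.log N * N) ≤ 1 / (Real.log N ^ (A + 4) / 4) * (Real.log N * N) := by
          gcongr
      _ = 4 * X * (1 / Real.log N ^ 2) := by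
          rw [h7, hX]
          field_simp
      _ ≤ 4 * X * 1 := by
          gcongr
          rw [div_le_one (by positivity)]
          exact one_le_pow₀ hl1
      _ = 4 * X := mul_one _
  have e1 : ∑ q ∈ Finset.Icc 1 ⌊(N : ℝ) ^ θ * Real.log N ^ (2 * A + 8)⌋₊, progressionError N q ≤
      K₁ * X := (h₁ N hN).trans (mul_le_mul_of_nonneg_left hjX hK₁)
  have e2 : 2 / (E : ℝ) * (Real.log N * N) ≤ 8 * X := by
    calc _ = 2 * (1 / (E : ℝ) * (Real.log N * N)) := by ring
      _ ≤ _ := by linarith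
  have e3 : (5 + 2 * Real.log E) / E * N ≤ 28 * X := by
    have hlE : Real.log E ≤ Real.log N := Real.log_le_log hE0 hEN'
    calc (5 + 2 * Real.log E) / E * N ≤ (5 * Real.log N + 2 * Real.log N) / E * N := by
          gcongr
          linarith
      _ = 7 * (1 / (E : ℝ) * (Real.log N * N)) := by ring
      _ ≤ _ := by linarith
  have e4 : (E : ℝ) ≤ K₂ * X := by
    have h8 := h₂ N hN2
    rw [pow_zero, mul_one] at h8
    have h9 : 0 ≤ Real.log N ^ (A + 4) := by linarith
    calc (E : ℝ) ≤ (N : ℝ) ^ (1 / 2 : ℝ) := by linarith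
      _ ≤ K₂ * (N / Real.log N ^ j) := h8
      _ ≤ _ := mul_le_mul_of_nonneg_left hjX hK₂.le
  calc _ ≤ _ := hmain
    _ ≤ K₁ * X + 8 * X + 28 * X + K₂ * X := by gcongr
    _ = _ := by ring

theorem goldbachSum_sub_bound {A θ : ℝ} (hA : 0 < A) (hθ₀ : 0 < θ) (hθ₁ : θ < 1)
    (hEH : ElliottHalberstam θ (2 * A + 8)) (hEHμ : ElliottHalberstamMoebius (1 - θ)) :
    ∃ K : ℝ, 0 ≤ K ∧ ∀ N : ℕ, 2 ≤ N → Even N →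
      |goldbachSum N - singularSeries N * ((N : ℝ) - moebiusTwistedSum N)| ≤
        K * ((N : ℝ) / Real.log N ^ A) := by
  -- The largest loss is `E² log N ≤ (log N) ^ (2A + 9)`, and a saving of `(log N) ^ A` must remain.
  obtain ⟨j, hj⟩ := exists_nat_ge (3 * A + 9)
  -- `c ≤ θ / 2` ensures `D / d ≥ N ^ c` for all `d ≤ E ≤ N ^ (θ / 2)`. With `P = N ^ c`, `θ + 2c <
  -- 1` makes the exceptional term, of size about `D P²`, a power smaller than `N`.
  obtain ⟨c, hc0, hcθ, hc1⟩ : ∃ c : ℝ, 0 < c ∧ c ≤ θ / 2 ∧ θ + 2 * c < 1 :=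
    ⟨min (θ / 2) ((1 - θ) / 4), lt_min (by linarith) (by linarith), min_le_left _ _,
      by linarith [min_le_right (θ / 2) ((1 - θ) / 4)]⟩
  have hψ := psiLogPowError_of_elliottHalberstam hθ₀.le (by linarith) hEH
  obtain ⟨K₁, hK₁, h₁⟩ := sum_progressionError_bound hθ₁ hEH j
  obtain ⟨K₂, hK₂, h₂⟩ := coprimeLogSum_sub_singularSeries_bound hψ j hc0
  obtain ⟨K₃, hK₃, h₃⟩ := sum_moebius_progression_bound (by linarith) hEHμ j
  obtain ⟨K₄, hK₄, h₄⟩ := rpow_mul_log_pow_le 2 j (a := 1 / 2) (by norm_num)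
  obtain ⟨K₅, hK₅, h₅⟩ := rpow_mul_log_pow_le 2 j hc1
  refine exists_bound_of_eventually (K := (3 * K₄) + (K₁ + K₂ + 64) + (K₃ + K₂ + 14 * K₅) + 6 * K₄)
    (fun N hN => ?_) ?_
  · have hl := half_lt_log hN
    have : (0 : ℝ) < N := by exact_mod_cast (by omega : 0 < N)
    have : 0 < Real.log N := by linarith
    positivity
  filter_upwards [eventually_ge_atTop 2, eventually_le_log_natCast 4,
    eventually_le_log_natCast (2 / c),
    eventually_log_rpow_le (A + 4) (s := θ / 2) (by linarith)] with N hN hl hlc hpow hEven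
  have hN2 : (2 : ℝ) ≤ N := by exact_mod_cast hN
  have hN0 : (0 : ℝ) < N := by linarith
  have hl1 : 1 ≤ Real.log N := by linarith
  have hl0 : 0 < Real.log N := by linarith
  have hcl : 2 ≤ c * Real.log N := by
    rw [div_le_iff₀ hc0] at hlc
    linarith
  have hrpow : ∀ s t : ℝ, s ≤ t → (N : ℝ) ^ s ≤ (N : ℝ) ^ t := fun s t hst =>
    Real.rpow_le_rpow_of_exponent_le (by linarith) hst
  have hNθ1 : 1 ≤ (N : ℝ) ^ θ := Real.one_le_rpow (by linarith) hθ₀.le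
  have h4 : 4 ≤ Real.log N ^ (A + 4) := by
    calc (4 : ℝ) ≤ Real.log N ^ (1 : ℝ) := by rwa [Real.rpow_one]
      _ ≤ _ := Real.rpow_le_rpow_of_exponent_le hl1 (by linarith)
  set E := squareCutoff (A + 4) N with hE
  have hE1 := le_squareCutoff h4
  have hE2 := squareCutoff_le (A + 4) N
  have hE3 := sq_squareCutoff_le (b := A + 4) (N := N) (by linarith)
  rw [← hE] at hE1 hE2 hE3
  rw [(by ring : 2 * (A + 4) = 2 * A + 8)] at hE3
  have hEpos : 1 ≤ E := by
    have : (1 : ℝ) ≤ E := by linarith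
    exact_mod_cast this
  have hE0 : (0 : ℝ) < E := by linarith
  have hEθ : (E : ℝ) ≤ (N : ℝ) ^ (θ / 2) := by linarith
  have hEN' : (E : ℝ) ≤ N := by
    calc (E : ℝ) ≤ (N : ℝ) ^ (θ / 2) := hEθ
      _ ≤ (N : ℝ) ^ (1 : ℝ) := hrpow _ _ (by linarith)
      _ = _ := Real.rpow_one _
  have hEN : E ≤ N := by exact_mod_cast hEN'
  -- Rounded up, so that `kD < N` implies `k ≤ N ^ (1 - θ)`. The resulting factor 2 in `D ≤ 2 N ^ θ`
  -- is absorbed by the halving in `squareCutoff`, which gives `E² ≤ (log N) ^ (2A + 8) / 4`.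
  set D := ⌈(N : ℝ) ^ θ⌉₊ with hD
  have hD1 : (N : ℝ) ^ θ ≤ D := Nat.le_ceil _
  have hD2 : (D : ℝ) ≤ 2 * (N : ℝ) ^ θ := by
    have := Nat.ceil_lt_add_one (a := (N : ℝ) ^ θ) (by positivity)
    linarith
  have hDpos : 1 ≤ D := Nat.ceil_pos.2 (by linarith)
  have hD0 : (0 : ℝ) < D := by linarith
  have hDN : D ≤ N := by
    refine Nat.ceil_le.2 ?_
    calc (N : ℝ) ^ θ ≤ (N : ℝ) ^ (1 : ℝ) := hrpow _ _ hθ₁.le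
      _ = _ := Real.rpow_one _
  have hDN' : (D : ℝ) ≤ N := by exact_mod_cast hDN
  set Q := ⌊(N : ℝ) ^ θ * Real.log N ^ (2 * A + 8)⌋₊ with hQdef
  have hL8 : 0 < Real.log N ^ (2 * A + 8) := Real.rpow_pos_of_pos hl0 _
  have hQ : D * E ^ 2 ≤ Q := by
    refine Nat.le_floor ?_
    push_cast
    calc (D : ℝ) * (E : ℝ) ^ 2 ≤ (2 * (N : ℝ) ^ θ) * (Real.log N ^ (2 * A + 8) / 4) := by gcongr
      _ ≤ _ := by nlinarith
  set B := K₂ / Real.log N ^ j with hBdef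
  have hB0 : 0 ≤ B := by positivity
  set X := (N : ℝ) / Real.log N ^ A with hX
  have hX0 : 0 < X := by positivity
  have hjX : ∀ b : ℝ, b ≤ 2 * A + 9 → Real.log N ^ b * (N / Real.log N ^ j) ≤ X := by
    intro b hb
    calc _ = N * (Real.log N ^ b / Real.log N ^ j) := by ring
      _ ≤ N * (1 / Real.log N ^ A) := by
          exact mul_le_mul_of_nonneg_left
            (rpow_div_pow_le hl1 ((by linarith : b + A ≤ 3 * A + 9).trans hj)) hN0.le
      _ = X := by rw [hX]; ring
  have hjX0 : (N : ℝ) / Real.log N ^ j ≤ X := by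
    have := hjX 0 (by linarith)
    rwa [Real.rpow_zero, one_mul] at this
  have hjX1 : Real.log N * (N / Real.log N ^ j) ≤ X := by
    have := hjX 1 (by linarith)
    rwa [Real.rpow_one] at this
  have hS1 := one_le_singularSeries hEven
  have hS2 : singularSeries N ≤ 6 * (1 + Real.log N) := by
    have := singularSeries_le hEven (by omega : N ≠ 0)
    linarith
  -- the contribution of the small divisors
  have hsmall : |smallDivisorSum N D - singularSeries N * ((N : ℝ) - 1)| ≤
      (K₁ + K₂ + 64) * X := by
    refine (abs_smallDivisorSum_sub_le (B := B) hDN hEpos hEN hQ ?_).trans ?_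
    · intro e he d hd
      obtain ⟨he0, heE⟩ := Finset.mem_Ioc.1 he
      have hd0 := Nat.pos_of_mem_divisors hd
      have hdE : (d : ℝ) ≤ E := by
        exact_mod_cast (Nat.le_of_dvd he0 (Nat.dvd_of_mem_divisors hd)).trans heE
      have hd1 : (1 : ℝ) ≤ d := by exact_mod_cast hd0
      refine h₂ N hN hcl (e * N) (by positivity) (hEven.mul_left e) ?_ _ ?_ ?_
      · rw [sq]
        exact Nat.mul_le_mul_right N (heE.trans hEN)
      · rw [le_div_iff₀ (by linarith)]
        calc (N : ℝ) ^ c * d ≤ (N : ℝ) ^ (θ / 2) * (N : ℝ) ^ (θ / 2) := by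
              exact mul_le_mul (hrpow _ _ hcθ) (hdE.trans hEθ) (by positivity) (by positivity)
          _ = (N : ℝ) ^ θ := by
              rw [← Real.rpow_add hN0]
              congr 1
              ring
          _ ≤ D := hD1
      · exact (div_le_self hD0.le hd1).trans hDN'
    · have hE3' : (E : ℝ) ^ 2 ≤ Real.log N ^ (2 * A + 8) := by linarith
      have e1 : (E : ℝ) ^ 2 * (Real.log N * ∑ q ∈ Finset.Icc 1 Q, progressionError N q) ≤
          K₁ * X := by
        have h9 : Real.log N ^ (2 * A + 9) = Real.log N ^ (2 * A + 8) * Real.log N := by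
          rw [← Real.rpow_add_one hl0.ne']
          congr 1
          ring
        calc _ ≤ Real.log N ^ (2 * A + 8) * (Real.log N * (K₁ * (N / Real.log N ^ j))) := by
              have := h₁ N hN
              have : 0 ≤ ∑ q ∈ Finset.Icc 1 Q, progressionError N q :=
                Finset.sum_nonneg fun _ _ => abs_nonneg _
              gcongr
          _ = K₁ * (Real.log N ^ (2 * A + 9) * (N / Real.log N ^ j)) := by rw [h9]; ring
          _ ≤ _ := mul_le_mul_of_nonneg_left (hjX _ le_rfl) hK₁
      have e2 : N * ((E : ℝ) ^ 2 * B) ≤ K₂ * X := by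
        calc N * ((E : ℝ) ^ 2 * B) ≤ N * (Real.log N ^ (2 * A + 8) * B) := by gcongr
          _ = K₂ * (Real.log N ^ (2 * A + 8) * (N / Real.log N ^ j)) := by rw [hBdef]; ring
          _ ≤ _ := mul_le_mul_of_nonneg_left (hjX _ (by linarith)) hK₂
      -- The tail over `e > E` loses four logarithms, whence the exponent `A + 4` of the cutoff.
      have e3 : 2 / (E : ℝ) * (N * Real.log N ^ 2 * (1 + Real.log N) ^ 2) ≤ 64 * X := by
        have h7 : Real.log N ^ (A + 4) = Real.log N ^ A * Real.log N ^ 4 := by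
          rw [← Real.rpow_natCast, ← Real.rpow_add hl0]
          norm_num
        calc _ ≤ 2 / (Real.log N ^ (A + 4) / 4) *
              (N * Real.log N ^ 2 * (2 * Real.log N) ^ 2) := by
              gcongr
              linarith
          _ = 32 * X := by
              rw [h7, hX]
              field_simp
              norm_num
          _ ≤ _ := by linarith
      calc _ ≤ K₁ * X + K₂ * X + 64 * X := by gcongr
        _ = _ := by ring
  -- the contribution of the large divisors
  have hlarge : |largeDivisorSum N D - singularSeries N * moebiusTwistedSum N| ≤
      (K₃ + K₂ + 14 * K₅) * X := by
    obtain ⟨R, hR, hRsum⟩ := h₃ N hN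
    have hT : ∀ k, k * D < N → k ≤ ⌊(N : ℝ) ^ (1 - θ)⌋₊ := by
      intro k hk
      refine Nat.le_floor ?_
      have hk' : (k : ℝ) * D < N := by exact_mod_cast hk
      have hsplit : (N : ℝ) ^ (1 - θ) * (N : ℝ) ^ θ = N := by
        rw [← Real.rpow_add hN0]
        simp
      by_contra hlt
      have := mul_le_mul (not_le.1 hlt).le hD1 (by positivity) (by positivity)
      linarith
    have e1 := abs_largeDivisorSum_sub_main_le (by omega) hT hR
    have e2 := abs_largeDivisorMain_sub_le (P := (N : ℝ) ^ c) (B := B) hDpos hDN (by positivity)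
      (by linarith)
      (fun x hx hxN => h₂ N hN hcl N (by omega) hEven (Nat.le_self_pow two_ne_zero N) x hx hxN) hB0
    have e3 : Real.log N * ∑ k ∈ Finset.Icc 1 ⌊(N : ℝ) ^ (1 - θ)⌋₊, R k ≤ K₃ * X := by
      calc _ ≤ Real.log N * (K₃ * (N / Real.log N ^ j)) := by gcongr
        _ = K₃ * (Real.log N * (N / Real.log N ^ j)) := by ring
        _ ≤ _ := mul_le_mul_of_nonneg_left hjX1 hK₃
    have e4 : N * Real.log N * B ≤ K₂ * X := by
      calc _ = K₂ * (Real.log N * (N / Real.log N ^ j)) := by rw [hBdef]; ring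
        _ ≤ _ := mul_le_mul_of_nonneg_left hjX1 hK₂
    have e5 : D * (N : ℝ) ^ c * (Real.log N * ((N : ℝ) ^ c * Real.log N + singularSeries N)) ≤
        14 * K₅ * X := by
      have hNc1 : 1 ≤ (N : ℝ) ^ c := Real.one_le_rpow (by linarith) hc0.le
      have hsplit : (N : ℝ) ^ θ * (N : ℝ) ^ c * (N : ℝ) ^ c = (N : ℝ) ^ (θ + 2 * c) := by
        rw [← Real.rpow_add hN0, ← Real.rpow_add hN0]
        congr 1
        ring
      calc _ ≤ 2 * (N : ℝ) ^ θ * (N : ℝ) ^ c * ((1 + Real.log N) * ((N : ℝ) ^ c * (1 + Real.log N) +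
            (N : ℝ) ^ c * (6 * (1 + Real.log N)))) := by
            gcongr
            · linarith
            · linarith
            · exact hS2.trans (le_mul_of_one_le_left (by positivity) hNc1)
        _ = 14 * ((N : ℝ) ^ (θ + 2 * c) * (1 + Real.log N) ^ 2) := by
            rw [← hsplit]
            ring
        _ ≤ 14 * (K₅ * (N / Real.log N ^ j)) :=
            mul_le_mul_of_nonneg_left (h₅ N hN2) (by norm_num)
        _ ≤ 14 * (K₅ * X) := by gcongr
        _ = _ := by ring
    calc _ ≤ _ := abs_sub_le _ (largeDivisorMain N D) _
      _ ≤ K₃ * X + (K₂ * X + 14 * K₅ * X) := by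
          refine add_le_add (e1.trans e3) (e2.trans ?_)
          gcongr
      _ = _ := by ring
  -- the numbers that are not squarefree, and the difference between `N - 1` and `N`
  have hsq1 : 1 ≤ (N : ℝ) ^ (1 / 2 : ℝ) := Real.one_le_rpow (by linarith) (by norm_num)
  have hpow2 : (N : ℝ) ^ (1 / 2 : ℝ) * (1 + Real.log N) ^ 2 ≤ K₄ * X :=
    (h₄ N hN2).trans (mul_le_mul_of_nonneg_left hjX0 hK₄.le)
  have hlsq : Real.log N ^ 2 ≤ (1 + Real.log N) ^ 2 := by gcongr; linarith
  have hgold : |goldbachSum N - (smallDivisorSum N D - largeDivisorSum N D)| ≤ 3 * K₄ * X := by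
    refine (abs_goldbachSum_sub_le hDpos hDN).trans ?_
    rw [Real.sqrt_eq_rpow]
    have h7 : (N : ℝ) ^ (1 / 2 : ℝ) * Real.log N ^ 2 ≤
        (N : ℝ) ^ (1 / 2 : ℝ) * (1 + Real.log N) ^ 2 := by gcongr
    have h8 : Real.log N ^ 2 ≤ (N : ℝ) ^ (1 / 2 : ℝ) * (1 + Real.log N) ^ 2 :=
      hlsq.trans (le_mul_of_one_le_left (by positivity) hsq1)
    linarith
  have hSX : |singularSeries N| ≤ 6 * K₄ * X := by
    rw [abs_of_nonneg (by linarith)]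
    have h7 : 1 + Real.log N ≤ (N : ℝ) ^ (1 / 2 : ℝ) * (1 + Real.log N) ^ 2 := by
      calc 1 + Real.log N ≤ (1 + Real.log N) ^ 2 := le_self_pow₀ (by linarith) two_ne_zero
        _ ≤ _ := le_mul_of_one_le_left (by positivity) hsq1
    linarith
  have hsplit : goldbachSum N - singularSeries N * ((N : ℝ) - moebiusTwistedSum N) =
      (goldbachSum N - (smallDivisorSum N D - largeDivisorSum N D)) +
      (smallDivisorSum N D - singularSeries N * ((N : ℝ) - 1)) -
      (largeDivisorSum N D - singularSeries N * moebiusTwistedSum N) - singularSeries N := by ring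
  rw [hsplit]
  calc _ ≤ 3 * K₄ * X + (K₁ + K₂ + 64) * X + (K₃ + K₂ + 14 * K₅) * X + 6 * K₄ * X :=
        (abs_sub _ _).trans (add_le_add ((abs_sub _ _).trans (add_le_add
          ((abs_add_le _ _).trans (add_le_add hgold hsmall)) hlarge)) hSX)
    _ = _ := by ring

lemma singularSeries_le_mul_log {N : ℕ} (hN : 2 ≤ N) (hEven : Even N) :
    singularSeries N ≤ 8 * Real.log N := by
  have := singularSeries_le hEven (by omega : N ≠ 0)
  have := half_lt_log hN
  linarith

lemma goldbachSum_ge_of_bounds {A K L : ℝ} {N : ℕ} (hN : 2 ≤ N) (hEven : Even N) (hL : 0 ≤ L)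
    (h1 : |goldbachSum N - singularSeries N * ((N : ℝ) - moebiusTwistedSum N)| ≤
      K * ((N : ℝ) / Real.log N ^ A))
    (h2 : |squarefreeSum N - artinFactor N * N| ≤ L * ((N : ℝ) / Real.log N ^ (A + 1))) :
    goldbachSum N ≥ singularSeries N * (1 - artinFactor N) * N -
      (K + 8 * L) * ((N : ℝ) / Real.log N ^ A) := by
  have hl := half_lt_log hN
  have hl0 : 0 < Real.log N := by linarith
  have hS1 := one_le_singularSeries hEven
  have hS2 := singularSeries_le_mul_log hN hEven
  have h3 := moebiusTwistedSum_le_squarefreeSum N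
  have h4 := (abs_le.1 h1).1
  have h5 := (abs_le.1 h2).2
  have h6 : singularSeries N * moebiusTwistedSum N ≤
      singularSeries N * (artinFactor N * N + L * ((N : ℝ) / Real.log N ^ (A + 1))) :=
    mul_le_mul_of_nonneg_left (by linarith) (by linarith)
  have h7 : singularSeries N * (L * ((N : ℝ) / Real.log N ^ (A + 1))) ≤
      8 * L * ((N : ℝ) / Real.log N ^ A) := by
    calc _ ≤ 8 * Real.log N * (L * ((N : ℝ) / Real.log N ^ (A + 1))) := by gcongr
      _ = _ := by
          rw [Real.rpow_add_one hl0.ne']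
          field_simp
  rw [mul_add] at h6
  linarith

lemma isLittleO_div_log_rpow {A : ℝ} (hA : 0 < A) :
    (fun N : ℕ => (N : ℝ) / Real.log N ^ A) =o[atTop] fun N : ℕ => (N : ℝ) := by
  have h1 : Tendsto (fun N : ℕ => (Real.log N ^ A)⁻¹) atTop (𝓝 0) :=
    ((tendsto_rpow_atTop hA).comp
      (Real.tendsto_log_atTop.comp tendsto_natCast_atTop_atTop)).inv_tendsto_atTop
  have h2 := (isBigO_refl (fun N : ℕ => (N : ℝ)) atTop).mul_isLittleO
    ((isLittleO_one_iff ℝ).2 h1)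
  simpa only [div_eq_mul_inv, mul_one] using h2

/-- The error is `o(N)`, hence `o(𝔖(N) N)` because `𝔖(N) ≥ 1`. The asymptotic thus says that `𝔖(N)`
times the twisted sum is `o(𝔖(N) N)`, and the positive factor `𝔖(N)` cancels without any upper bound
for it. -/
lemma isEquivalent_iff_of_bound {A K : ℝ} (hA : 0 < A)
    (h : ∀ N : ℕ, 2 ≤ N → Even N →
      |goldbachSum N - singularSeries N * ((N : ℝ) - moebiusTwistedSum N)| ≤
        K * ((N : ℝ) / Real.log N ^ A)) :
    IsEquivalent (atTop ⊓ 𝓟 {N : ℕ | Even N})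
        (fun N : ℕ => goldbachSum N) (fun N : ℕ => singularSeries N * (N : ℝ)) ↔
      IsLittleO (atTop ⊓ 𝓟 {N : ℕ | Even N})
        (fun N : ℕ => moebiusTwistedSum N) (fun N : ℕ => (N : ℝ)) := by
  set F : Filter ℕ := atTop ⊓ 𝓟 {N : ℕ | Even N} with hF
  have hev : ∀ᶠ N in F, 2 ≤ N ∧ Even N := by
    rw [hF, eventually_inf_principal]
    filter_upwards [eventually_ge_atTop 2] with N hN hE
    exact ⟨hN, hE⟩
  set e : ℕ → ℝ := fun N => goldbachSum N - singularSeries N * ((N : ℝ) - moebiusTwistedSum N)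
    with he
  have heo : e =o[F] fun N : ℕ => (N : ℝ) := by
    refine IsBigO.trans_isLittleO ?_ ((isLittleO_div_log_rpow hA).mono inf_le_left)
    refine IsBigO.of_bound K ?_
    filter_upwards [hev] with N hN
    have h0 : 0 ≤ (N : ℝ) / Real.log N ^ A :=
      div_nonneg (Nat.cast_nonneg N) (Real.rpow_nonneg (Real.log_natCast_nonneg N) _)
    rw [Real.norm_eq_abs, Real.norm_eq_abs, abs_of_nonneg h0]
    exact h N hN.1 hN.2
  have hNO : (fun N : ℕ => (N : ℝ)) =O[F] fun N : ℕ => singularSeries N * (N : ℝ) := by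
    refine IsBigO.of_bound 1 ?_
    filter_upwards [hev] with N hN
    have h1 := one_le_singularSeries hN.2
    rw [norm_mul, one_mul]
    refine le_mul_of_one_le_left (norm_nonneg _) ?_
    rw [Real.norm_eq_abs]
    exact h1.trans (le_abs_self _)
  have heo' := heo.trans_isBigO hNO
  have hiff : (fun N : ℕ => singularSeries N * moebiusTwistedSum N) =o[F]
      (fun N : ℕ => singularSeries N * (N : ℝ)) ↔
      (fun N : ℕ => moebiusTwistedSum N) =o[F] fun N : ℕ => (N : ℝ) := by
    constructor
    · intro hS
      refine IsLittleO.of_bound fun ε hε => ?_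
      filter_upwards [hev, hS.bound hε] with N hN hb
      have h1 := one_le_singularSeries hN.2
      rw [norm_mul, norm_mul, mul_left_comm] at hb
      refine le_of_mul_le_mul_left hb ?_
      rw [Real.norm_eq_abs]
      exact lt_of_lt_of_le (by linarith) (le_abs_self _)
    · intro hS
      exact (isBigO_refl _ F).mul_isLittleO hS
  rw [← hiff, IsEquivalent]
  constructor
  · intro hr
    have := heo'.sub hr
    refine this.congr_left fun N => ?_
    simp only [he, Pi.sub_apply]
    ring
  · intro hS
    have := heo'.sub hS
    refine this.congr_left fun N => ?_
    simp only [he, Pi.sub_apply]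
    ring

end

theorem theorem1 (A θ : ℝ) (hA : 0 < A) (hθ₀ : 0 < θ) (hθ₁ : θ < 1)
    (hEH : ElliottHalberstam θ (2 * A + 8))
    (hEHμ : ElliottHalberstamMoebius (1 - θ)) :
    (∃ K : ℝ, ∀ N : ℕ, 0 < N → Even N →
      goldbachSum N ≥
        singularSeries N * (1 - artinFactor N) * N - K * ((N : ℝ) / Real.log N ^ A)) ∧
    (∃ K : ℝ, ∀ N : ℕ, 0 < N → Even N →
      |goldbachSum N - singularSeries N * ((N : ℝ) - moebiusTwistedSum N)| ≤
        K * ((N : ℝ) / Real.log N ^ A)) ∧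
    (IsEquivalent (atTop ⊓ 𝓟 {N : ℕ | Even N})
        (fun N : ℕ => goldbachSum N) (fun N : ℕ => singularSeries N * (N : ℝ)) ↔
      IsLittleO (atTop ⊓ 𝓟 {N : ℕ | Even N})
        (fun N : ℕ => moebiusTwistedSum N) (fun N : ℕ => (N : ℝ))) := by
  obtain ⟨K, -, hK⟩ := goldbachSum_sub_bound hA hθ₀ hθ₁ hEH hEHμ
  obtain ⟨L, hL, hL'⟩ := squarefreeSum_sub_artinFactor_bound hA hθ₀ hθ₁ hEH
  have htwo : ∀ N : ℕ, 0 < N → Even N → 2 ≤ N := by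
    rintro N hN ⟨m, rfl⟩
    omega
  refine ⟨⟨K + 8 * L, fun N hN hEven => ?_⟩, ⟨K, fun N hN hEven => ?_⟩,
    isEquivalent_iff_of_bound hA hK⟩
  · have hN2 := htwo N hN hEven
    exact goldbachSum_ge_of_bounds hN2 hEven hL (hK N hN2 hEven) (hL' N hN2 hEven)
  · exact hK N (htwo N hN hEven) hEven
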